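/- Let $n\ge 1$ be an integer and let $0<\beta<2$ and $\beta\le\alpha<n$ be real numbers. For $f\in\mathcal S(\mathbb R^n)$ (complex-valued) write $\hat f(\xi)=\int_{\mathbb R^n}e^{2\pi i\xi\cdot x}f(x)\,dx$, and for $s\ge 0$ let $(-\Delta/4\pi^2)^s$ be the Fourier multiplier with symbol $|\xi|^{2s}$. Put $$g(x)=|x|^{(n-\beta)/2}\,(-\Delta/4\pi^2)^{(\alpha-\beta)/4}f(x),$$ $$C_\alpha=\pi^\alpha\left[\frac{\Gamma(\frac{n-\alpha}4)}{\Gamma(\frac{n+\alpha}4)}\right]^2,\qquad D_\beta=\frac4\beta\,\pi^{\frac n2+\beta}\,\frac{\Gamma(1-\frac\beta2)}{\Gamma(\frac{n+\beta}2)}.$$ Then for every $f\in\mathcal S(\mathbb R^n)$ the three integrals below are finite and $$C_\alpha\int_{\mathbb R^n}|\xi|^\alpha|\hat f(\xi)|^2\,d\xi\ \ge\ \int_{\mathbb R^n}|x|^{-\alpha}|f(x)|^2\,dx+\frac{C_\alpha}{D_\beta}\int_{\mathbb R^n\times\mathbb R^n}\frac{|g(x)-g(y)|^2}{|x-y|^{n+\beta}}\,|x|^{-(n-\beta)/2}|y|^{-(n-\beta)/2}\,dx\,dy.$$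 Moreover, the sharp constant in Pitt's inequality is not attained: $C_\alpha$ is the smallest constant $C$ such that $\int|x|^{-\alpha}|f|^2\,dx\le C\int|\xi|^\alpha|\hat f|^2\,d\xi$ for all $f\in\mathcal S(\mathbb R^n)$, and for every $f\in\mathcal S(\mathbb R^n)$ with $f\ne0$ one has $\int|x|^{-\alpha}|f|^2\,dx<C_\alpha\int|\xi|^\alpha|\hat f|^2\,d\xi$. -/

import Mathlib

open MeasureTheory SchwartzMap
open scoped FourierTransform

namespace Pitt

/-- The Fourier transform `f̂(ξ) = ∫ e^{2πi ξ·x} f(x) dx`; with this sign it is the transform that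
Mathlib writes `𝓕⁻`, and its inverse is Mathlib's `𝓕`. -/
noncomputable def hat {n : ℕ} (f : EuclideanSpace ℝ (Fin n) → ℂ) :
    EuclideanSpace ℝ (Fin n) → ℂ :=
  𝓕⁻ f

theorem hat_apply {n : ℕ} (f : EuclideanSpace ℝ (Fin n) → ℂ) (ξ : EuclideanSpace ℝ (Fin n)) :
    hat f ξ = ∫ x, Complex.exp ((2 * Real.pi * inner ℝ x ξ : ℝ) * Complex.I) * f x := by
  simp [hat, Real.fourierInv_eq', smul_eq_mul]

/-- The inverse Fourier transform `∫ e^{-2πi ξ·x} F(ξ) dξ`. -/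
noncomputable def invHat {n : ℕ} (F : EuclideanSpace ℝ (Fin n) → ℂ) :
    EuclideanSpace ℝ (Fin n) → ℂ :=
  𝓕 F

/-- The fractional power `(-Δ/4π²)^s f`, `s ≥ 0`: the Fourier multiplier with symbol `|ξ|^{2s}`. -/
noncomputable def fracLaplacian {n : ℕ} (s : ℝ) (f : EuclideanSpace ℝ (Fin n) → ℂ) :
    EuclideanSpace ℝ (Fin n) → ℂ :=
  invHat fun ξ => ((‖ξ‖ ^ (2 * s) : ℝ) : ℂ) * hat f ξ

/-- For a Schwartz function and `s ≥ 0` the integral that defines `fracLaplacian s f`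
converges absolutely. -/
theorem integrable_fracLaplacian_symbol {n : ℕ} {s : ℝ} (hs : 0 ≤ s)
    (f : 𝓢(EuclideanSpace ℝ (Fin n), ℂ)) :
    Integrable fun ξ : EuclideanSpace ℝ (Fin n) => ((‖ξ‖ ^ (2 * s) : ℝ) : ℂ) * hat (⇑f) ξ := by
  have e : hat (⇑f) = ⇑(𝓕⁻ f : 𝓢(EuclideanSpace ℝ (Fin n), ℂ)) := by rw [hat, SchwartzMap.fourierInv_coe]
  rw [e]
  obtain ⟨k, hk⟩ := exists_nat_ge (2 * s)
  have h0 := (𝓕⁻ f).integrable_pow_mul volume 0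
  have h1 := (𝓕⁻ f).integrable_pow_mul volume k
  refine (h0.add h1).mono' ?_ (Filter.Eventually.of_forall fun ξ => ?_)
  · have hc : Continuous fun ξ : EuclideanSpace ℝ (Fin n) => ‖ξ‖ ^ (2 * s) :=
      continuous_norm.rpow_const fun _ => Or.inr (by positivity)
    exact ((Complex.continuous_ofReal.comp hc).mul (𝓕⁻ f).continuous).aestronglyMeasurable
  · have hp : ‖ξ‖ ^ (2 * s) ≤ ‖ξ‖ ^ 0 + ‖ξ‖ ^ k := by
      rcases le_total ‖ξ‖ 1 with h | h
      · have := Real.rpow_le_one (norm_nonneg ξ) h (by positivity : 0 ≤ 2 * s)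
        have : 0 ≤ ‖ξ‖ ^ k := by positivity
        rw [pow_zero]; linarith
      · have := Real.rpow_le_rpow_of_exponent_le h hk
        rw [Real.rpow_natCast] at this
        rw [pow_zero]; linarith
    rw [norm_mul, Complex.norm_real, Real.norm_of_nonneg (by positivity)]
    simp only [Pi.add_apply, ← add_mul]
    gcongr

/-- The function `g(x) = |x|^{(n-β)/2} (-Δ/4π²)^{(α-β)/4} f(x)`. -/
noncomputable def groundState {n : ℕ} (α β : ℝ) (f : EuclideanSpace ℝ (Fin n) → ℂ) :
    EuclideanSpace ℝ (Fin n) → ℂ :=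
  fun x => ((‖x‖ ^ ((n - β) / 2) : ℝ) : ℂ) * fracLaplacian ((α - β) / 4) f x

/-- The integrand of the weighted Besov norm,
`|g(x) - g(y)|² |x - y|^{-n-β} |x|^{-(n-β)/2} |y|^{-(n-β)/2}`. -/
noncomputable def besovIntegrand {n : ℕ} (β : ℝ) (g : EuclideanSpace ℝ (Fin n) → ℂ)
    (p : EuclideanSpace ℝ (Fin n) × EuclideanSpace ℝ (Fin n)) : ℝ :=
  ‖g p.1 - g p.2‖ ^ 2 / ‖p.1 - p.2‖ ^ (n + β)
    * ‖p.1‖ ^ (-((n - β) / 2)) * ‖p.2‖ ^ (-((n - β) / 2))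

/-- `C_α = π^α [Γ((n-α)/4) / Γ((n+α)/4)]²`. -/
noncomputable def pittConst (n : ℕ) (α : ℝ) : ℝ :=
  Real.pi ^ α * (Real.Gamma ((n - α) / 4) / Real.Gamma ((n + α) / 4)) ^ 2

/-- `D_β = (4/β) π^{n/2+β} Γ(1-β/2) / Γ((n+β)/2)`. -/
noncomputable def besovConst (n : ℕ) (β : ℝ) : ℝ :=
  4 / β * Real.pi ^ ((n : ℝ) / 2 + β) * (Real.Gamma (1 - β / 2) / Real.Gamma ((n + β) / 2))

/-- `∫ |ξ|^α |f̂(ξ)|² dξ`. -/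
noncomputable def freqEnergy {n : ℕ} (α : ℝ) (f : EuclideanSpace ℝ (Fin n) → ℂ) : ℝ :=
  ∫ ξ : EuclideanSpace ℝ (Fin n), ‖ξ‖ ^ α * ‖hat f ξ‖ ^ 2

/-- `∫ |x|^{-α} |f(x)|² dx`. -/
noncomputable def weightedMass {n : ℕ} (α : ℝ) (f : EuclideanSpace ℝ (Fin n) → ℂ) : ℝ :=
  ∫ x : EuclideanSpace ℝ (Fin n), ‖x‖ ^ (-α) * ‖f x‖ ^ 2

end Pitt

/-!
The inequality is the composition of two sharp ones. Put `u = (-Δ/4π²)^{(α-β)/4} f`.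

*Stein–Weiss.* `f` is a Riesz potential of `u`, and Schur's test with a power of `|x|` gives
`∫ |x|^{-α} |f|² ≤ (C_α / C_β) ∫ |x|^{-β} |u|²` (`lintegral_riesz_potential_le`,
`weightedMass_le_fracLaplacian`).

*Fractional Hardy with remainder.* For `h` a multiple of `|x|^{-(n-β)/2}` and `u = |x|^{-(n-β)/2} g`
there is the pointwise ground state identity
`|u(x) - u(y)|² + |u(x)|² h(y)/h(x) + |u(y)|² h(x)/h(y)`
`= |g(x) - g(y)|² (|x||y|)^{-(n-β)/2} + |u(x)|² + |u(y)|²`.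
Integrated against the heat kernel in `x - y`, and then against `t^{-β/2-1} dt` over the heat time `t`,
it becomes the Besov remainder plus `C_β^{-1} ∫ |x|^{-β} |u|²`, bounded by `∫ |ξ|^β |û|²`, which is
`∫ |ξ|^α |f̂|²` (`hardy_besov_le`).

The Riesz kernels and `h` are written as superpositions `∫₀^∞ s^{a-1} heat_s ds` of heat kernels
(`riesz`). Compositions of such kernels then reduce, through the semigroup property, to convolutions of
truncated powers on the line (`lintegral_pw_conv`), and the action of the fractional Laplacian on `h`
reduces to the one-dimensional `diffPos_moment`. At a fixed time `t` the identity contains terms such as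
`∫ |u|²`, whose integrals against `t^{-β/2-1} dt` diverge. They are cancelled before that integration,
which leaves the defect `h - heat_t * h`; its positive and negative parts are kept on opposite sides, so
that every term is nonnegative and all computations are done with lower integrals. Of Plancherel's
theorem only `∫ |𝓕 v|² ≤ ∫ |v|²` is needed (`lintegral_fourier_sq_le`).

*No extremals.* Equality would force the Besov term to vanish; then `g` is constant, and it vanishes at
the origin, so `u = 0` and `f = 0` (`weightedMass_lt`).

*Sharpness.* Both sides of Pitt's inequality are quadratic forms that, in the variable `log |x|`, are
invariant under translations. On superpositions `∑ e^{a_i (n-α)/4} e^{-π e^{a_i} |x|²}` of Gaussians with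
`a_i = δ i` they are Toeplitz forms of the kernels `(e^τ/(1+e^τ)²)^q`, `q = (n ∓ α)/4`
(`gaussianSum_energy`). With many terms and a small step `δ`, an inequality between the forms gives one
between the integrals of the kernels (`integral_le_of_toeplitz_le`). These are the Beta integrals
`Γ(q)²/Γ(2q)`, and their ratio yields `C_α` (`pittConst_le`).
-/

namespace Pitt

open scoped ENNReal

variable {n : ℕ}

/-! ### Integrals of truncated powers -/

/-- The truncated power `t₊^a`, extended by zero to `t ≤ 0`, with values in `[0, ∞]`. -/
noncomputable def pw (a t : ℝ) : ℝ≥0∞ := if 0 < t then ENNReal.ofReal (t ^ a) else 0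

lemma pw_of_pos {t : ℝ} (ht : 0 < t) (a : ℝ) : pw a t = ENNReal.ofReal (t ^ a) := if_pos ht

lemma pw_of_nonpos {t : ℝ} (ht : t ≤ 0) (a : ℝ) : pw a t = 0 := if_neg (not_lt.2 ht)

lemma pw_ne_top (a t : ℝ) : pw a t ≠ ∞ := by
  unfold pw; split_ifs <;> simp

@[fun_prop]
lemma measurable_pw (a : ℝ) : Measurable (pw a) :=
  Measurable.ite measurableSet_Ioi (by fun_prop) measurable_const

lemma pw_mul_pw (a b t : ℝ) : pw a t * pw b t = pw (a + b) t := by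
  by_cases ht : 0 < t
  · rw [pw_of_pos ht, pw_of_pos ht, pw_of_pos ht, ← ENNReal.ofReal_mul (by positivity),
      Real.rpow_add ht]
  · simp [pw, ht]

lemma pw_mul {s : ℝ} (hs : 0 < s) (a t : ℝ) : pw a (s * t) = pw a s * pw a t := by
  by_cases ht : 0 < t
  · rw [pw_of_pos ht, pw_of_pos hs, pw_of_pos (by positivity), ← ENNReal.ofReal_mul (by positivity),
      Real.mul_rpow hs.le ht.le]
  · rw [pw_of_nonpos (not_lt.1 ht), pw_of_nonpos, mul_zero]
    exact mul_nonpos_of_nonneg_of_nonpos hs.le (not_lt.1 ht)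

/-- The substitution `t ↦ s * t` in a lower integral. -/
lemma lintegral_comp_mul {s : ℝ} (hs : 0 < s) (f : ℝ → ℝ≥0∞) :
    ∫⁻ t, f t = ENNReal.ofReal s * ∫⁻ t, f (s * t) := by
  have h := (Homeomorph.mulLeft₀ s hs.ne').toMeasurableEquiv.measurableEmbedding.lintegral_map
    (μ := volume) f
  have e : Measure.map (⇑(Homeomorph.mulLeft₀ s hs.ne').toMeasurableEquiv) volume
      = ENNReal.ofReal |s⁻¹| • (volume : Measure ℝ) := Real.map_volume_mul_left hs.ne'
  rw [e, lintegral_smul_measure, abs_of_pos (by positivity)] at h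
  have h' : ∫⁻ t, f (s * t) = ENNReal.ofReal s⁻¹ * ∫⁻ t, f t := h.symm
  rw [h', ← mul_assoc, ← ENNReal.ofReal_mul hs.le, mul_inv_cancel₀ hs.ne', ENNReal.ofReal_one,
    one_mul]

lemma lintegral_pw_mul (a : ℝ) (f : ℝ → ℝ≥0∞) :
    ∫⁻ t, pw a t * f t = ∫⁻ t in Set.Ioi 0, ENNReal.ofReal (t ^ a) * f t := by
  rw [← lintegral_indicator measurableSet_Ioi]
  congr 1; ext t
  by_cases ht : 0 < t <;> simp [pw, ht]

lemma lintegral_pw_mul_exp {a r : ℝ} (ha : 0 < a) (hr : 0 < r) :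
    ∫⁻ t, pw (a - 1) t * ENNReal.ofReal (Real.exp (-(r * t)))
      = ENNReal.ofReal (Real.Gamma a * r ^ (-a)) := by
  have e := Real.integral_rpow_mul_exp_neg_mul_Ioi ha hr
  have hG := Real.Gamma_pos_of_pos ha
  have hpos : 0 < (1 / r) ^ a * Real.Gamma a := by positivity
  have hi : Integrable (fun t => t ^ (a - 1) * Real.exp (-(r * t)))
      (volume.restrict (Set.Ioi 0)) := by
    by_contra h
    rw [integral_undef h] at e
    exact hpos.ne e
  rw [lintegral_pw_mul]
  have h2 := ofReal_integral_eq_lintegral_ofReal hi (by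
    filter_upwards [ae_restrict_mem measurableSet_Ioi] with t ht
    have : (0:ℝ) < t := ht
    positivity)
  rw [e] at h2
  rw [mul_comm (Real.Gamma a), Real.rpow_neg hr.le, ← Real.inv_rpow hr.le, ← one_div, h2]
  refine setLIntegral_congr_fun measurableSet_Ioi fun t ht => ?_
  have : (0:ℝ) < t := ht
  exact (ENNReal.ofReal_mul (by positivity)).symm

/-- The Gamma integral after the substitution `t ↦ 1/t`. -/
lemma lintegral_pw_mul_exp_div {a r : ℝ} (ha : 0 < a) (hr : 0 < r) :
    ∫⁻ t, pw (-a - 1) t * ENNReal.ofReal (Real.exp (-(r / t)))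
      = ENNReal.ofReal (Real.Gamma a * r ^ (-a)) := by
  rw [← lintegral_pw_mul_exp ha hr, lintegral_pw_mul, lintegral_pw_mul]
  have him : (fun t : ℝ => t⁻¹) '' Set.Ioi 0 = Set.Ioi 0 := by
    ext t; constructor
    · rintro ⟨s, hs, rfl⟩; exact Set.mem_Ioi.2 (inv_pos.2 (Set.mem_Ioi.1 hs))
    · intro ht; exact ⟨t⁻¹, Set.mem_Ioi.2 (inv_pos.2 (Set.mem_Ioi.1 ht)), inv_inv t⟩
  have h := lintegral_image_eq_lintegral_abs_deriv_mul (s := Set.Ioi 0) (f := fun t : ℝ => t⁻¹)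
    (f' := fun t => -(t ^ 2)⁻¹) measurableSet_Ioi
    (fun x hx => (hasDerivAt_inv (ne_of_gt hx)).hasDerivWithinAt) (inv_injective.injOn)
    (fun t => ENNReal.ofReal (t ^ (a - 1)) * ENNReal.ofReal (Real.exp (-(r * t))))
  rw [him] at h
  rw [h]
  refine setLIntegral_congr_fun measurableSet_Ioi fun t ht => ?_
  have ht : (0:ℝ) < t := ht
  simp only [abs_neg]
  rw [abs_of_pos (by positivity), ← mul_assoc, ← ENNReal.ofReal_mul (by positivity), div_eq_mul_inv]
  rw [Real.inv_rpow ht.le, ← Real.rpow_natCast, ← Real.rpow_neg ht.le, ← Real.rpow_neg ht.le,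
    ← ENNReal.ofReal_mul (by positivity), ← ENNReal.ofReal_mul (by positivity), ← Real.rpow_add ht]
  congr 3; push_cast; ring

/-- `∫₀^∞ t^{-b-1} (1 - e^{-rt}) dt`, by writing `1 - e^{-rt} = ∫₀^t r e^{-rw} dw`. -/
lemma lintegral_pw_mul_one_sub_exp {b r : ℝ} (hb : 0 < b) (hb1 : b < 1) (hr : 0 ≤ r) :
    ∫⁻ t, pw (-b - 1) t * ENNReal.ofReal (1 - Real.exp (-(r * t)))
      = ENNReal.ofReal (Real.Gamma (1 - b) / b * r ^ b) := by
  rcases hr.eq_or_lt with rfl | hr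
  · simp [Real.zero_rpow hb.ne']
  have h1 : ∀ t : ℝ, 0 < t → ENNReal.ofReal (1 - Real.exp (-(r * t)))
      = ∫⁻ w in Set.Ioo 0 t, ENNReal.ofReal (r * Real.exp (-(r * w))) := by
    intro t ht
    have hi : IntervalIntegrable (fun w => r * Real.exp (-(r * w))) volume 0 t :=
      (by fun_prop : Continuous fun w => r * Real.exp (-(r * w))).intervalIntegrable _ _
    have hd := intervalIntegral.integral_eq_sub_of_hasDerivAt (a := 0) (b := t)
      (f := fun w => -Real.exp (-(r * w))) (f' := fun w => r * Real.exp (-(r * w)))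
      (fun w _ => by
        have := ((hasDerivAt_id w).const_mul r).fun_neg.exp.fun_neg
        exact this.congr_deriv (by rw [id_eq]; ring)) hi
    rw [show 1 - Real.exp (-(r * t)) = -Real.exp (-(r * t)) - -Real.exp (-(r * 0)) by simp; ring,
      ← hd, intervalIntegral.integral_of_le ht.le, integral_Ioc_eq_integral_Ioo,
      ofReal_integral_eq_lintegral_ofReal]
    · exact ((intervalIntegrable_iff_integrableOn_Ioo_of_le ht.le).1 hi)
    · exact Filter.Eventually.of_forall fun w => by positivity
  have h2 : ∀ w : ℝ, 0 < w → ∫⁻ t in Set.Ioi w, ENNReal.ofReal (t ^ (-b - 1))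
      = ENNReal.ofReal (w ^ (-b) / b) := by
    intro w hw
    have hi := integrableOn_Ioi_rpow_of_lt (by linarith : -b - 1 < -1) hw
    rw [← ofReal_integral_eq_lintegral_ofReal hi, integral_Ioi_rpow_of_lt (by linarith) hw]
    · congr 1; simp [neg_div_neg_eq]
    · filter_upwards [ae_restrict_mem measurableSet_Ioi] with t ht
      have : (0:ℝ) < t := hw.trans ht
      positivity
  -- Tonelli on the region `0 < w < t`
  let F : ℝ → ℝ → ℝ≥0∞ := fun t w => pw (-b - 1) t * (if 0 < w ∧ w < t then
      ENNReal.ofReal (r * Real.exp (-(r * w))) else 0)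
  have hF : Measurable (Function.uncurry F) := by
    refine ((measurable_pw _).comp measurable_fst).mul (Measurable.ite ?_ (by fun_prop) (by fun_prop))
    exact (measurableSet_lt measurable_const measurable_snd).inter
      (measurableSet_lt measurable_snd measurable_fst)
  calc ∫⁻ t, pw (-b - 1) t * ENNReal.ofReal (1 - Real.exp (-(r * t)))
      = ∫⁻ t, ∫⁻ w, F t w := by
        refine lintegral_congr fun t => ?_
        rw [lintegral_const_mul]
        swap
        · exact Measurable.ite ((measurableSet_lt measurable_const measurable_id).inter
            (measurableSet_lt measurable_id measurable_const)) (by fun_prop) (by fun_prop)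
        by_cases ht : 0 < t
        · rw [h1 t ht, ← lintegral_indicator measurableSet_Ioo]
          congr 1
          refine lintegral_congr fun w => ?_
          simp [Set.indicator]
        · simp [pw, ht]
    _ = ∫⁻ w, ∫⁻ t, F t w := lintegral_lintegral_swap hF.aemeasurable
    _ = ∫⁻ w, ENNReal.ofReal (r / b) * (pw (1 - b - 1) w * ENNReal.ofReal (Real.exp (-(r * w)))) := by
        refine lintegral_congr fun w => ?_
        by_cases hw : 0 < w
        · have : ∀ t, F t w = (Set.Ioi w).indicator (fun t => ENNReal.ofReal (t ^ (-b - 1))) t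
              * ENNReal.ofReal (r * Real.exp (-(r * w))) := by
            intro t
            by_cases htw : w < t
            · simp [F, hw, htw, pw_of_pos (hw.trans htw)]
            · simp [F, htw]
          simp_rw [this]
          rw [lintegral_mul_const _ ((by fun_prop : Measurable _).indicator measurableSet_Ioi),
            lintegral_indicator measurableSet_Ioi, h2 w hw, pw_of_pos hw,
            ← ENNReal.ofReal_mul (by positivity), ← ENNReal.ofReal_mul (by positivity),
            ← ENNReal.ofReal_mul (by positivity)]
          congr 1
          rw [show 1 - b - 1 = -b by ring]; ring
        · simp [F, hw, pw]
    _ = _ := by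
        rw [lintegral_const_mul _ (by fun_prop), lintegral_pw_mul_exp (by linarith) hr,
          ← ENNReal.ofReal_mul (by positivity)]
        congr 1
        rw [show -(1 - b) = b - 1 by ring, Real.rpow_sub_one hr.ne']
        field_simp

/-- The Beta integral `s₊^{a-1} * s₊^{b-1} = Γ(a)Γ(b)/Γ(a+b) s₊^{a+b-1}`. By scaling the convolution is
a multiple of `w₊^{a+b-1}`, and integrating both sides against `e^{-w}` identifies the factor. -/
lemma lintegral_pw_conv {a b : ℝ} (ha : 0 < a) (hb : 0 < b) (w : ℝ) :
    ∫⁻ s, pw (a - 1) s * pw (b - 1) (w - s)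
      = ENNReal.ofReal (Real.Gamma a * Real.Gamma b / Real.Gamma (a + b)) * pw (a + b - 1) w := by
  set k : ℝ≥0∞ := ∫⁻ s, pw (a - 1) s * pw (b - 1) (1 - s) with hk
  have hscale : ∀ w, ∫⁻ s, pw (a - 1) s * pw (b - 1) (w - s) = k * pw (a + b - 1) w := by
    intro w
    by_cases hw : 0 < w
    · rw [lintegral_comp_mul hw]
      have : ∀ s, pw (a - 1) (w * s) * pw (b - 1) (w - w * s)
          = (pw (a - 1) w * pw (b - 1) w) * (pw (a - 1) s * pw (b - 1) (1 - s)) := by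
        intro s
        rw [show w - w * s = w * (1 - s) by ring, pw_mul hw, pw_mul hw]; ring
      simp_rw [this]
      rw [lintegral_const_mul _ (by fun_prop), ← hk, ← mul_assoc, mul_comm k]
      congr 1
      rw [show a + b - 1 = 1 + (a - 1 + (b - 1)) by ring, ← pw_mul_pw 1, ← pw_mul_pw (a - 1),
        pw_of_pos hw 1, Real.rpow_one]
    · rw [pw_of_nonpos (not_lt.1 hw), mul_zero]
      refine lintegral_eq_zero_of_ae_eq_zero (Filter.Eventually.of_forall fun s => ?_)
      by_cases hs : 0 < s
      · simp [pw, show ¬ s < w by linarith]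
      · simp [pw, hs]
  have hE : ∀ c : ℝ, 0 < c → ∫⁻ w, pw (c - 1) w * ENNReal.ofReal (Real.exp (-w))
      = ENNReal.ofReal (Real.Gamma c) := by
    intro c hc; simpa using lintegral_pw_mul_exp hc one_pos
  have hkey : ENNReal.ofReal (Real.Gamma a) * ENNReal.ofReal (Real.Gamma b)
      = k * ENNReal.ofReal (Real.Gamma (a + b)) := by
    calc _ = ∫⁻ s, pw (a - 1) s * ENNReal.ofReal (Real.exp (-s)) * ENNReal.ofReal (Real.Gamma b) := by
            rw [lintegral_mul_const _ (by fun_prop), hE a ha]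
      _ = ∫⁻ s, ∫⁻ w, pw (a - 1) s * pw (b - 1) (w - s) * ENNReal.ofReal (Real.exp (-w)) := by
            refine lintegral_congr fun s => ?_
            rw [← hE b hb, ← lintegral_const_mul _ (by fun_prop)]
            rw [← lintegral_sub_right_eq_self _ s]
            refine lintegral_congr fun w => ?_
            rw [show -w = -s + -(w - s) by ring, Real.exp_add,
              ENNReal.ofReal_mul (Real.exp_pos _).le]
            ring
      _ = ∫⁻ w, ∫⁻ s, pw (a - 1) s * pw (b - 1) (w - s) * ENNReal.ofReal (Real.exp (-w)) :=
            lintegral_lintegral_swap (by unfold Function.uncurry; fun_prop)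
      _ = ∫⁻ w, k * (pw (a + b - 1) w * ENNReal.ofReal (Real.exp (-w))) := by
            refine lintegral_congr fun w => ?_
            rw [lintegral_mul_const _ (by fun_prop), hscale w, mul_assoc]
      _ = _ := by rw [lintegral_const_mul _ (by fun_prop), hE _ (by positivity)]
  rw [hscale w]
  congr 1
  have hG := Real.Gamma_pos_of_pos (by positivity : 0 < a + b)
  rw [ENNReal.ofReal_div_of_pos hG, ENNReal.ofReal_mul (Real.Gamma_pos_of_pos ha).le, hkey]
  exact (ENNReal.mul_div_cancel_right (by simpa using hG) (by simp)).symm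

/-! ### Differences of truncated powers and their half-moments -/

/-- Positive part of `s₊^{c-1} - (s-t)₊^{c-1}`. -/
noncomputable def diffPos (c s t : ℝ) : ℝ≥0∞ := pw (c - 1) s - pw (c - 1) (s - t)

/-- Negative part of `s₊^{c-1} - (s-t)₊^{c-1}`. -/
noncomputable def diffNeg (c s t : ℝ) : ℝ≥0∞ := pw (c - 1) (s - t) - pw (c - 1) s

lemma measurable_diffPos (c : ℝ) : Measurable fun p : ℝ × ℝ => diffPos c p.1 p.2 := by
  unfold diffPos; fun_prop

lemma measurable_diffNeg (c : ℝ) : Measurable fun p : ℝ × ℝ => diffNeg c p.1 p.2 := by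
  unfold diffNeg; fun_prop

/-- `s₊^{c-1} - (s-t)₊^{c-1} = diffPos - diffNeg`, written without subtraction. -/
lemma pw_add_diffNeg (c s t : ℝ) :
    pw (c - 1) s + diffNeg c s t = pw (c - 1) (s - t) + diffPos c s t := by
  unfold diffNeg diffPos
  rw [add_tsub_eq_max, add_tsub_eq_max, max_comm]

/-- By homogeneity, the half-moment `∫ t^{-b-1} diffPos c s t dt` is a multiple of `s₊^{c-b-1}`. -/
lemma lintegral_pw_mul_diffPos (b c s : ℝ) :
    ∫⁻ t, pw (-b - 1) t * diffPos c s t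
      = (∫⁻ t, pw (-b - 1) t * diffPos c 1 t) * pw (c - b - 1) s := by
  by_cases hs : 0 < s
  · rw [lintegral_comp_mul hs]
    have : ∀ t, pw (-b - 1) (s * t) * diffPos c s (s * t)
        = (pw (-b - 1) s * pw (c - 1) s) * (pw (-b - 1) t * diffPos c 1 t) := by
      intro t
      have h1 : diffPos c s (s * t) = pw (c - 1) s * diffPos c 1 t := by
        unfold diffPos
        rw [ENNReal.mul_sub fun _ _ => pw_ne_top _ _, ← pw_mul hs, ← pw_mul hs]
        congr 2 <;> ring
      rw [h1, pw_mul hs]; ring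
    simp_rw [this]
    have hm : Measurable fun t => pw (-b - 1) t * diffPos c 1 t :=
      (measurable_pw _).mul ((measurable_diffPos c).comp measurable_prodMk_left)
    rw [lintegral_const_mul _ hm, ← mul_assoc, mul_comm (lintegral _ _)]
    congr 1
    rw [show ENNReal.ofReal s = pw 1 s by rw [pw_of_pos hs, Real.rpow_one], pw_mul_pw, pw_mul_pw]
    congr 1; ring
  · rw [pw_of_nonpos (not_lt.1 hs), mul_zero]
    refine lintegral_eq_zero_of_ae_eq_zero (Filter.Eventually.of_forall fun t => ?_)
    simp [diffPos, pw, hs]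

lemma lintegral_pw_mul_diffNeg (b c s : ℝ) :
    ∫⁻ t, pw (-b - 1) t * diffNeg c s t
      = (∫⁻ t, pw (-b - 1) t * diffNeg c 1 t) * pw (c - b - 1) s := by
  by_cases hs : 0 < s
  · rw [lintegral_comp_mul hs]
    have : ∀ t, pw (-b - 1) (s * t) * diffNeg c s (s * t)
        = (pw (-b - 1) s * pw (c - 1) s) * (pw (-b - 1) t * diffNeg c 1 t) := by
      intro t
      have h1 : diffNeg c s (s * t) = pw (c - 1) s * diffNeg c 1 t := by
        unfold diffNeg
        rw [ENNReal.mul_sub fun _ _ => pw_ne_top _ _, ← pw_mul hs, ← pw_mul hs]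
        congr 2 <;> ring
      rw [h1, pw_mul hs]; ring
    simp_rw [this]
    have hm : Measurable fun t => pw (-b - 1) t * diffNeg c 1 t :=
      (measurable_pw _).mul ((measurable_diffNeg c).comp measurable_prodMk_left)
    rw [lintegral_const_mul _ hm, ← mul_assoc, mul_comm (lintegral _ _)]
    congr 1
    rw [show ENNReal.ofReal s = pw 1 s by rw [pw_of_pos hs, Real.rpow_one], pw_mul_pw, pw_mul_pw]
    congr 1; ring
  · rw [pw_of_nonpos (not_lt.1 hs), mul_zero]
    refine lintegral_eq_zero_of_ae_eq_zero (Filter.Eventually.of_forall fun t => ?_)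
    by_cases ht : 0 < t
    · simp [diffNeg, pw, hs, show ¬ t < s by linarith]
    · simp [pw, ht]

/-- Integrating `s₊^{c-1} - (s-t)₊^{c-1}` against `e^{-s} ds` gives `Γ(c) (1 - e^{-t})`; a further
integration against `t^{-b-1} dt` yields the relation between the two half-moments. -/
lemma diff_moment_relation {b c : ℝ} (hb : 0 < b) (hb1 : b < 1) (hbc : b < c) :
    (∫⁻ t, pw (-b - 1) t * diffPos c 1 t) * ENNReal.ofReal (Real.Gamma (c - b))
      = (∫⁻ t, pw (-b - 1) t * diffNeg c 1 t) * ENNReal.ofReal (Real.Gamma (c - b))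
        + ENNReal.ofReal (Real.Gamma c * (Real.Gamma (1 - b) / b)) := by
  have hc : 0 < c := hb.trans hbc
  have hE : ∀ c : ℝ, 0 < c → ∫⁻ w, pw (c - 1) w * ENNReal.ofReal (Real.exp (-w))
      = ENNReal.ofReal (Real.Gamma c) := by
    intro c hc; simpa using lintegral_pw_mul_exp hc one_pos
  have hP := measurable_diffPos c
  have hN := measurable_diffNeg c
  have swap : ∀ D : ℝ → ℝ → ℝ≥0∞, (Measurable fun p : ℝ × ℝ => D p.1 p.2) →
      (∀ s, ∫⁻ t, pw (-b - 1) t * D s t = (∫⁻ t, pw (-b - 1) t * D 1 t) * pw (c - b - 1) s) →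
      (∫⁻ t, pw (-b - 1) t * D 1 t) * ENNReal.ofReal (Real.Gamma (c - b))
        = ∫⁻ t, pw (-b - 1) t * ∫⁻ s, D s t * ENNReal.ofReal (Real.exp (-s)) := by
    intro D hD hs
    have hDm : ∀ t, Measurable fun s => D s t := fun t => hD.comp measurable_prodMk_right
    have hDm' : ∀ s, Measurable fun t => D s t := fun s => hD.comp measurable_prodMk_left
    rw [← hE _ (by linarith), ← lintegral_const_mul _ (by fun_prop)]
    calc _ = ∫⁻ s, ∫⁻ t, pw (-b - 1) t * D s t * ENNReal.ofReal (Real.exp (-s)) := by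
            refine lintegral_congr fun s => ?_
            rw [lintegral_mul_const _ (by have := hDm' s; fun_prop), hs s, mul_assoc]
      _ = ∫⁻ t, ∫⁻ s, pw (-b - 1) t * D s t * ENNReal.ofReal (Real.exp (-s)) :=
            lintegral_lintegral_swap (by unfold Function.uncurry; fun_prop)
      _ = _ := by
            refine lintegral_congr fun t => ?_
            rw [← lintegral_const_mul _ (by have := hDm t; fun_prop)]
            simp_rw [mul_assoc]
  rw [swap _ hP (lintegral_pw_mul_diffPos b c), swap _ hN (lintegral_pw_mul_diffNeg b c)]
  have hG : ENNReal.ofReal (Real.Gamma c * (Real.Gamma (1 - b) / b))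
      = ∫⁻ t, pw (-b - 1) t * (ENNReal.ofReal (Real.Gamma c)
          * ENNReal.ofReal (1 - Real.exp (-t))) := by
    have := lintegral_pw_mul_one_sub_exp hb hb1 zero_le_one
    simp only [one_mul, Real.one_rpow, mul_one] at this
    rw [ENNReal.ofReal_mul (Real.Gamma_pos_of_pos hc).le, ← this,
      ← lintegral_const_mul _ (by fun_prop)]
    refine lintegral_congr fun t => ?_
    ring
  have hNm : Measurable fun t => ∫⁻ s, diffNeg c s t * ENNReal.ofReal (Real.exp (-s)) :=
    Measurable.lintegral_prod_left'
      (f := fun p : ℝ × ℝ => diffNeg c p.1 p.2 * ENNReal.ofReal (Real.exp (-p.1)))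
      (hN.mul (by fun_prop))
  rw [hG, ← lintegral_add_right _ (by fun_prop)]
  refine lintegral_congr fun t => ?_
  rw [← mul_add]
  by_cases ht : 0 < t
  swap
  · simp [pw, ht]
  congr 1
  have hsum : ENNReal.ofReal (Real.Gamma c)
        + ∫⁻ s, diffNeg c s t * ENNReal.ofReal (Real.exp (-s))
      = ENNReal.ofReal (Real.exp (-t)) * ENNReal.ofReal (Real.Gamma c)
        + ∫⁻ s, diffPos c s t * ENNReal.ofReal (Real.exp (-s)) := by
    have hshift : ENNReal.ofReal (Real.exp (-t)) * ENNReal.ofReal (Real.Gamma c)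
        = ∫⁻ s, pw (c - 1) (s - t) * ENNReal.ofReal (Real.exp (-s)) := by
      rw [← hE c hc, ← lintegral_const_mul _ (by fun_prop), ← lintegral_sub_right_eq_self _ t]
      refine lintegral_congr fun s => ?_
      rw [show -s = -t + -(s - t) by ring, Real.exp_add, ENNReal.ofReal_mul (Real.exp_pos _).le]
      ring
    rw [hshift, ← hE c hc, ← lintegral_add_left (by fun_prop), ← lintegral_add_left (by fun_prop)]
    refine lintegral_congr fun s => ?_
    rw [← add_mul, ← add_mul, pw_add_diffNeg]
  have he : ENNReal.ofReal (Real.exp (-t)) ≤ 1 := by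
    rw [ENNReal.ofReal_le_one, Real.exp_le_one_iff]; linarith
  have hsplit : ENNReal.ofReal (Real.Gamma c) = ENNReal.ofReal (Real.exp (-t)) * ENNReal.ofReal (Real.Gamma c)
      + ENNReal.ofReal (Real.Gamma c) * ENNReal.ofReal (1 - Real.exp (-t)) := by
    rw [mul_comm, ← mul_add, ← ENNReal.ofReal_add (Real.exp_pos _).le
      (by rw [sub_nonneg, Real.exp_le_one_iff]; linarith)]
    simp
  nth_rewrite 1 [hsplit] at hsum
  rw [add_assoc] at hsum
  have hne : ENNReal.ofReal (Real.exp (-t)) * ENNReal.ofReal (Real.Gamma c) ≠ ∞ :=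
    ENNReal.mul_ne_top (by simp) (by simp)
  rw [← (ENNReal.add_right_inj hne).1 hsum, add_comm]

/-- The half-moment of the negative part is finite: for `c ≥ 1` it vanishes, and for `c < 1`
the positive part is supported in `t ≥ 1`, so that its half-moment is finite. -/
lemma diffNeg_moment_ne_top {b c : ℝ} (hb : 0 < b) (hb1 : b < 1) (hbc : b < c) :
    ∫⁻ t, pw (-b - 1) t * diffNeg c 1 t ≠ ∞ := by
  rcases le_or_gt 1 c with hc | hc
  · have : ∀ t, pw (-b - 1) t * diffNeg c 1 t = 0 := by
      intro t
      by_cases ht : 0 < t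
      · have : pw (c - 1) (1 - t) ≤ pw (c - 1) 1 := by
          by_cases h1 : t < 1
          · rw [pw_of_pos (by linarith), pw_of_pos one_pos]
            exact ENNReal.ofReal_le_ofReal
              (Real.rpow_le_rpow (by linarith) (by linarith) (by linarith))
          · rw [pw_of_nonpos (by linarith)]; exact zero_le
        rw [diffNeg, tsub_eq_zero_of_le this, mul_zero]
      · simp [pw, ht]
    simp [this]
  · have hP : ∫⁻ t, pw (-b - 1) t * diffPos c 1 t ≠ ∞ := by
      have hle : ∀ t, pw (-b - 1) t * diffPos c 1 t
          ≤ (Set.Ici 1).indicator (fun t => ENNReal.ofReal (t ^ (-b - 1))) t := by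
        intro t
        by_cases ht : 0 < t
        · by_cases h1 : t < 1
          · have : pw (c - 1) 1 ≤ pw (c - 1) (1 - t) := by
              rw [pw_of_pos one_pos, pw_of_pos (by linarith)]
              exact ENNReal.ofReal_le_ofReal
                (Real.rpow_le_rpow_of_nonpos (by linarith) (by linarith) (by linarith))
            rw [diffPos, tsub_eq_zero_of_le this, mul_zero]; exact zero_le
          · rw [Set.indicator_of_mem (by simpa using h1), pw_of_pos ht]
            calc _ ≤ ENNReal.ofReal (t ^ (-b - 1)) * 1 := by
                  gcongr
                  refine tsub_le_self.trans ?_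
                  simp [pw]
              _ = _ := mul_one _
        · simp [pw, ht]
      refine ne_top_of_le_ne_top ?_ (lintegral_mono hle)
      rw [lintegral_indicator measurableSet_Ici]
      have hi := integrableOn_Ioi_rpow_of_lt (by linarith : -b - 1 < -1) one_pos
      rw [← integrableOn_Ici_iff_integrableOn_Ioi] at hi
      exact hi.lintegral_lt_top.ne
    have hr := diff_moment_relation hb hb1 hbc
    have hG := Real.Gamma_pos_of_pos (by linarith : 0 < c - b)
    intro htop
    rw [htop, ENNReal.top_mul (by simpa using hG), top_add] at hr
    exact ENNReal.mul_ne_top hP (by simp) hr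

/-- The two half-moments differ by `(Γ(1-b)/b) Γ(c)/Γ(c-b)`. This constant yields the sharp constant of
the fractional Hardy inequality. -/
lemma diffPos_moment {b c : ℝ} (hb : 0 < b) (hb1 : b < 1) (hbc : b < c) :
    ∫⁻ t, pw (-b - 1) t * diffPos c 1 t = (∫⁻ t, pw (-b - 1) t * diffNeg c 1 t)
      + ENNReal.ofReal (Real.Gamma (1 - b) / b * (Real.Gamma c / Real.Gamma (c - b))) := by
  have hr := diff_moment_relation hb hb1 hbc
  have hG := Real.Gamma_pos_of_pos (by linarith : 0 < c - b)
  have h2 : ENNReal.ofReal (Real.Gamma c * (Real.Gamma (1 - b) / b))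
      = ENNReal.ofReal (Real.Gamma (1 - b) / b * (Real.Gamma c / Real.Gamma (c - b)))
        * ENNReal.ofReal (Real.Gamma (c - b)) := by
    rw [← ENNReal.ofReal_mul' hG.le]
    congr 1; field_simp
  rw [h2, ← add_mul] at hr
  exact (ENNReal.mul_left_inj (by simpa using hG) (by simp)).1 hr

/-! ### The heat kernel and the Riesz kernels -/

/-- The heat kernel `s^{-n/2} e^{-π|x|²/s}`, of total mass one, at time `s > 0`; it is zero
for `s ≤ 0`. -/
noncomputable def heat (s : ℝ) (x : EuclideanSpace ℝ (Fin n)) : ℝ≥0∞ :=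
  pw (-((n : ℝ) / 2)) s * ENNReal.ofReal (Real.exp (-(Real.pi * ‖x‖ ^ 2 / s)))

lemma heat_of_pos {s : ℝ} (hs : 0 < s) (x : EuclideanSpace ℝ (Fin n)) :
    heat s x = ENNReal.ofReal (s ^ (-((n : ℝ) / 2)) * Real.exp (-(Real.pi * ‖x‖ ^ 2 / s))) := by
  rw [heat, pw_of_pos hs, ENNReal.ofReal_mul (by positivity)]

lemma measurable_heat :
    Measurable fun p : ℝ × EuclideanSpace ℝ (Fin n) => heat p.1 p.2 := by
  unfold heat; fun_prop

@[fun_prop]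
lemma Measurable.heat {α : Type*} [MeasurableSpace α] {f : α → ℝ}
    {g : α → EuclideanSpace ℝ (Fin n)} (hf : Measurable f) (hg : Measurable g) :
    Measurable fun a => heat (f a) (g a) :=
  measurable_heat.comp (hf.prodMk hg)

lemma heat_sub_comm (s : ℝ) (x y : EuclideanSpace ℝ (Fin n)) : heat s (x - y) = heat s (y - x) := by
  rw [heat, heat, norm_sub_rev]

lemma lintegral_heat {s : ℝ} (hs : 0 < s) : ∫⁻ x : EuclideanSpace ℝ (Fin n), heat s x = 1 := by
  have hb : 0 < Real.pi / s := by positivity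
  have e := GaussianFourier.integral_rexp_neg_mul_sq_norm (V := EuclideanSpace ℝ (Fin n)) hb
  have hpos : 0 < (Real.pi / (Real.pi / s)) ^ ((Module.finrank ℝ (EuclideanSpace ℝ (Fin n)) : ℝ) / 2) := by
    positivity
  have hi : Integrable fun x : EuclideanSpace ℝ (Fin n) => Real.exp (-(Real.pi / s) * ‖x‖ ^ 2) := by
    by_contra h
    rw [integral_undef h] at e
    exact hpos.ne e
  have h2 := ofReal_integral_eq_lintegral_ofReal hi (Filter.Eventually.of_forall fun x => by positivity)
  rw [e] at h2
  have : ∀ x : EuclideanSpace ℝ (Fin n), heat s x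
      = pw (-((n : ℝ) / 2)) s * ENNReal.ofReal (Real.exp (-(Real.pi / s) * ‖x‖ ^ 2)) := by
    intro x; rw [heat]; congr 3; ring
  simp_rw [this]
  rw [lintegral_const_mul _ (by fun_prop), ← h2, pw_of_pos hs, ← ENNReal.ofReal_mul (by positivity)]
  rw [div_div_cancel₀ Real.pi_pos.ne', finrank_euclideanSpace_fin, ← Real.rpow_add hs]
  simp

lemma lintegral_heat_sub_left {s : ℝ} (hs : 0 < s) (x : EuclideanSpace ℝ (Fin n)) :
    ∫⁻ y, heat s (x - y) = 1 := by
  rw [lintegral_sub_left_eq_self (fun y => heat s y), lintegral_heat hs]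

lemma lintegral_heat_sub_right {s : ℝ} (hs : 0 < s) (x : EuclideanSpace ℝ (Fin n)) :
    ∫⁻ y, heat s (y - x) = 1 := by
  rw [lintegral_sub_right_eq_self (fun y => heat s y), lintegral_heat hs]

/-- Completion of the square: in `y`, a product of two Gaussians is again a Gaussian. -/
lemma heat_mul_heat {s t : ℝ} (hs : 0 < s) (ht : 0 < t) (x y : EuclideanSpace ℝ (Fin n)) :
    heat s (x - y) * heat t y = heat (s + t) x * heat (s * t / (s + t)) (y - (t / (s + t)) • x) := by
  have hst : 0 < s + t := by positivity
  have hq : 0 < s * t / (s + t) := by positivity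
  rw [heat_of_pos hs, heat_of_pos ht, heat_of_pos hst, heat_of_pos hq,
    ← ENNReal.ofReal_mul (by positivity), ← ENNReal.ofReal_mul (by positivity)]
  congr 1
  rw [mul_mul_mul_comm (s ^ _), mul_mul_mul_comm ((s + t) ^ _), ← Real.exp_add, ← Real.exp_add,
    ← Real.mul_rpow hs.le ht.le, ← Real.mul_rpow hst.le hq.le]
  congr 2
  · field_simp
  · rw [norm_sub_sq_real, norm_sub_sq_real, norm_smul, inner_smul_right, real_inner_comm x y,
      Real.norm_of_nonneg (by positivity)]
    field_simp
    ring

/-- The semigroup property of the heat kernel. -/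
lemma lintegral_heat_conv {s t : ℝ} (hs : 0 < s) (ht : 0 < t) (x : EuclideanSpace ℝ (Fin n)) :
    ∫⁻ y, heat s (x - y) * heat t y = heat (s + t) x := by
  simp_rw [heat_mul_heat hs ht]
  rw [lintegral_const_mul _ (by fun_prop), lintegral_heat_sub_right (by positivity), mul_one]

/-- The Riesz kernel of order `2a` as a superposition `∫₀^∞ s^{a-1} heat s x ds` of heat kernels;
off the origin it is a multiple of `|x|^{2a-n}`. -/
noncomputable def riesz (a : ℝ) (x : EuclideanSpace ℝ (Fin n)) : ℝ≥0∞ :=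
  ∫⁻ s, pw (a - 1) s * heat s x

@[fun_prop]
lemma measurable_riesz (a : ℝ) : Measurable (riesz a : EuclideanSpace ℝ (Fin n) → ℝ≥0∞) :=
  Measurable.lintegral_prod_right' (f := fun p : EuclideanSpace ℝ (Fin n) × ℝ =>
    pw (a - 1) p.2 * heat p.2 p.1) (by fun_prop)

lemma riesz_eq {a : ℝ} (ha : a < (n : ℝ) / 2) {x : EuclideanSpace ℝ (Fin n)} (hx : x ≠ 0) :
    riesz a x = ENNReal.ofReal (Real.Gamma ((n : ℝ) / 2 - a)
      * (Real.pi ^ (a - (n : ℝ) / 2) * ‖x‖ ^ (2 * a - n))) := by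
  have hx' : 0 < ‖x‖ := norm_pos_iff.2 hx
  have h := lintegral_pw_mul_exp_div (sub_pos.2 ha) (by positivity : 0 < Real.pi * ‖x‖ ^ 2)
  rw [neg_sub, Real.mul_rpow Real.pi_pos.le (by positivity), ← Real.rpow_natCast,
    ← Real.rpow_mul hx'.le] at h
  rw [riesz]
  simp_rw [heat, ← mul_assoc, pw_mul_pw]
  rw [show a - 1 + -((n : ℝ) / 2) = a - (n : ℝ) / 2 - 1 by ring]
  have e : ((2 : ℕ) : ℝ) * (a - (n : ℝ) / 2) = 2 * a - n := by push_cast; ring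
  rw [e] at h
  rw [mul_assoc, ← h, ← Real.rpow_natCast]

/-- Composition of Riesz kernels, from the semigroup property and the Beta integral. -/
lemma lintegral_riesz_conv {a b : ℝ} (ha : 0 < a) (hb : 0 < b) (x : EuclideanSpace ℝ (Fin n)) :
    ∫⁻ y, riesz a (x - y) * riesz b y
      = ENNReal.ofReal (Real.Gamma a * Real.Gamma b / Real.Gamma (a + b)) * riesz (a + b) x := by
  calc ∫⁻ y, riesz a (x - y) * riesz b y
      = ∫⁻ y, ∫⁻ s, ∫⁻ r, pw (a - 1) s * heat s (x - y) * (pw (b - 1) r * heat r y) := by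
        refine lintegral_congr fun y => ?_
        rw [riesz, riesz, ← lintegral_mul_const _ (by fun_prop)]
        refine lintegral_congr fun s => ?_
        rw [← lintegral_const_mul _ (by fun_prop)]
    _ = ∫⁻ s, ∫⁻ y, ∫⁻ r, pw (a - 1) s * heat s (x - y) * (pw (b - 1) r * heat r y) := by
        refine lintegral_lintegral_swap (Measurable.aemeasurable ?_)
        exact Measurable.lintegral_prod_right' (f := fun p : (EuclideanSpace ℝ (Fin n) × ℝ) × ℝ =>
          pw (a - 1) p.1.2 * heat p.1.2 (x - p.1.1) * (pw (b - 1) p.2 * heat p.2 p.1.1)) (by fun_prop)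
    _ = ∫⁻ s, ∫⁻ r, ∫⁻ y, pw (a - 1) s * heat s (x - y) * (pw (b - 1) r * heat r y) := by
        refine lintegral_congr fun s => lintegral_lintegral_swap (Measurable.aemeasurable ?_)
        unfold Function.uncurry; fun_prop
    _ = ∫⁻ s, ∫⁻ r, pw (a - 1) s * pw (b - 1) r * heat (s + r) x := by
        refine lintegral_congr fun s => lintegral_congr fun r => ?_
        by_cases hs : 0 < s
        · by_cases hr : 0 < r
          · rw [← lintegral_heat_conv hs hr, ← lintegral_const_mul _ (by fun_prop)]
            refine lintegral_congr fun y => ?_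
            ring
          · simp [pw, hr]
        · simp [pw, hs]
    _ = ∫⁻ s, ∫⁻ w, pw (a - 1) s * pw (b - 1) (w - s) * heat w x := by
        refine lintegral_congr fun s => ?_
        rw [← lintegral_sub_right_eq_self _ s]
        simp
    _ = ∫⁻ w, ∫⁻ s, pw (a - 1) s * pw (b - 1) (w - s) * heat w x := by
        refine lintegral_lintegral_swap (Measurable.aemeasurable ?_)
        unfold Function.uncurry; fun_prop
    _ = ∫⁻ w, ENNReal.ofReal (Real.Gamma a * Real.Gamma b / Real.Gamma (a + b))
          * (pw (a + b - 1) w * heat w x) := by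
        refine lintegral_congr fun w => ?_
        rw [lintegral_mul_const _ (by fun_prop), lintegral_pw_conv ha hb, mul_assoc]
    _ = _ := by rw [lintegral_const_mul _ (by fun_prop), riesz]

/-! ### The Fourier transform and the heat kernel -/

lemma fourier_modulate (v : EuclideanSpace ℝ (Fin n) → ℂ) (z y : EuclideanSpace ℝ (Fin n)) :
    𝓕 (fun ξ => Complex.exp ((-2 * Real.pi * inner ℝ ξ z : ℝ) * Complex.I) * v ξ) y
      = 𝓕 v (y + z) := by
  rw [Real.fourier_eq', Real.fourier_eq']
  congr 1; ext ξ
  rw [smul_eq_mul, smul_eq_mul, ← mul_assoc, ← Complex.exp_add, inner_add_right]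
  congr 2; push_cast; ring

lemma integrable_modulate {v : EuclideanSpace ℝ (Fin n) → ℂ} (hv : Integrable v)
    (z : EuclideanSpace ℝ (Fin n)) :
    Integrable fun ξ => Complex.exp ((-2 * Real.pi * inner ℝ ξ z : ℝ) * Complex.I) * v ξ := by
  refine hv.bdd_mul (c := 1) (Continuous.aestronglyMeasurable (by fun_prop)) ?_
  exact Filter.Eventually.of_forall fun ξ => (Complex.norm_exp_ofReal_mul_I _).le

/-- The heat kernel at time `s` has Fourier transform `e^{-πs|ξ|²}`. -/
lemma fourier_heat {s : ℝ} (hs : 0 < s) (ξ : EuclideanSpace ℝ (Fin n)) :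
    𝓕 (fun x : EuclideanSpace ℝ (Fin n) =>
      ((s ^ (-((n : ℝ) / 2)) * Real.exp (-(Real.pi * ‖x‖ ^ 2 / s)) : ℝ) : ℂ)) ξ
      = (Real.exp (-(Real.pi * s * ‖ξ‖ ^ 2)) : ℝ) := by
  have h := fourier_gaussian_innerProductSpace (V := EuclideanSpace ℝ (Fin n))
    (b := ((Real.pi / s : ℝ) : ℂ)) (by rw [Complex.ofReal_re]; positivity) ξ
  rw [Real.fourier_eq'] at h ⊢
  have e : ∀ x : EuclideanSpace ℝ (Fin n),
      ((s ^ (-((n : ℝ) / 2)) * Real.exp (-(Real.pi * ‖x‖ ^ 2 / s)) : ℝ) : ℂ)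
      = ((s ^ (-((n : ℝ) / 2)) : ℝ) : ℂ) * Complex.exp (-((Real.pi / s : ℝ) : ℂ) * (‖x‖ : ℂ) ^ 2) := by
    intro x
    rw [Complex.ofReal_mul, Complex.ofReal_exp]
    congr 2; push_cast; ring
  simp_rw [e, smul_eq_mul, mul_left_comm, integral_const_mul]
  simp_rw [smul_eq_mul] at h
  rw [h, finrank_euclideanSpace_fin]
  have e1 : (Real.pi : ℂ) / ((Real.pi / s : ℝ) : ℂ) = (s : ℂ) := by
    rw [← Complex.ofReal_div, div_div_cancel₀ Real.pi_pos.ne']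
  rw [e1, show ((n : ℂ) / 2) = (((n : ℝ) / 2 : ℝ) : ℂ) by push_cast; ring,
    ← Complex.ofReal_cpow hs.le, ← mul_assoc, ← Complex.ofReal_mul, ← Real.rpow_add hs,
    neg_add_cancel, Real.rpow_zero, Complex.ofReal_one, one_mul, Complex.ofReal_exp]
  congr 1
  push_cast
  have : (Real.pi : ℂ) ≠ 0 := by exact_mod_cast Real.pi_pos.ne'
  have : (s : ℂ) ≠ 0 := by exact_mod_cast hs.ne'
  field_simp

lemma integrable_gaussian {b : ℝ} (hb : 0 < b) :
    Integrable fun x : EuclideanSpace ℝ (Fin n) => Real.exp (-(b * ‖x‖ ^ 2)) := by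
  have e := GaussianFourier.integral_rexp_neg_mul_sq_norm (V := EuclideanSpace ℝ (Fin n)) hb
  by_contra h
  simp_rw [neg_mul] at e
  rw [integral_undef h] at e
  have : 0 < (Real.pi / b) ^ ((Module.finrank ℝ (EuclideanSpace ℝ (Fin n)) : ℝ) / 2) := by positivity
  exact this.ne e

lemma integrable_heat {s : ℝ} (hs : 0 < s) :
    Integrable fun x : EuclideanSpace ℝ (Fin n) =>
      ((s ^ (-((n : ℝ) / 2)) * Real.exp (-(Real.pi * ‖x‖ ^ 2 / s)) : ℝ) : ℂ) := by
  have := ((integrable_gaussian (n := n) (b := Real.pi / s) (by positivity)).const_mul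
    (s ^ (-((n : ℝ) / 2)))).ofReal (𝕜 := ℂ)
  refine this.congr (Filter.Eventually.of_forall fun x => ?_)
  simp only
  congr 4; ring

/-- The multiplication formula `∫ 𝓕(heat_s) v = ∫ heat_s 𝓕 v`. -/
lemma integral_gaussian_mul {v : EuclideanSpace ℝ (Fin n) → ℂ} (hv : Integrable v)
    {s : ℝ} (hs : 0 < s) :
    ∫ ξ, ((Real.exp (-(Real.pi * s * ‖ξ‖ ^ 2)) : ℝ) : ℂ) * v ξ
      = ∫ y, ((s ^ (-((n : ℝ) / 2)) * Real.exp (-(Real.pi * ‖y‖ ^ 2 / s)) : ℝ) : ℂ) * 𝓕 v y := by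
  have h := VectorFourier.integral_fourierIntegral_smul_eq_flip (μ := volume) (ν := volume)
    (L := innerₗ (EuclideanSpace ℝ (Fin n))) Real.continuous_fourierChar
    (by exact continuous_inner) (integrable_heat (n := n) hs) hv
  rw [flip_innerₗ] at h
  refine Eq.trans ?_ h
  refine integral_congr_ae (Filter.Eventually.of_forall fun ξ => ?_)
  simp only
  rw [← fourier_heat hs, smul_eq_mul]; rfl

/-- `heat_s * 𝓕 v` is the Fourier transform of `e^{-πs|ξ|²} v(ξ)`; only the resulting bound on
absolute values is recorded. -/
lemma enorm_integral_gaussian_le {v : EuclideanSpace ℝ (Fin n) → ℂ} (hv : Integrable v)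
    {s : ℝ} (hs : 0 < s) (x : EuclideanSpace ℝ (Fin n)) :
    ‖∫ ξ, ((Real.exp (-(Real.pi * s * ‖ξ‖ ^ 2)) : ℝ) : ℂ)
        * (Complex.exp ((-2 * Real.pi * inner ℝ ξ x : ℝ) * Complex.I) * v ξ)‖ₑ
      ≤ ∫⁻ y, heat s (x - y) * ‖𝓕 v y‖ₑ := by
  rw [integral_gaussian_mul (integrable_modulate hv x) hs]
  refine (enorm_integral_le_lintegral_enorm _).trans_eq ?_
  rw [← lintegral_add_right_eq_self (fun y => heat s (x - y) * ‖𝓕 v y‖ₑ) x]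
  refine lintegral_congr fun y => ?_
  rw [fourier_modulate, enorm_mul, heat_sub_comm, add_sub_cancel_right, heat_of_pos hs,
    ← ofReal_norm, Complex.norm_real, Real.norm_of_nonneg (by positivity)]

lemma continuous_fourier {v : EuclideanSpace ℝ (Fin n) → ℂ} (hv : Integrable v) :
    Continuous (𝓕 v) :=
  VectorFourier.fourierIntegral_continuous Real.continuous_fourierChar
    (by exact continuous_inner) hv

lemma norm_fourier_le (v : EuclideanSpace ℝ (Fin n) → ℂ) (x : EuclideanSpace ℝ (Fin n)) :
    ‖𝓕 v x‖ ≤ ∫ ξ, ‖v ξ‖ :=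
  VectorFourier.norm_fourierIntegral_le_integral_norm _ _ _ _ _

/-- The regularized form of `∫ |𝓕 v|² ≤ ∫ |v|²`. With `g = e^{-πε|x|²} conj (𝓕 v)`, the left-hand side is
`∫ 𝓕 v · g = ∫ v · 𝓕 g`; as `|𝓕 g| ≤ heat_ε * |v|` and the heat kernel has mass one, the bound follows
from `2|v(ξ)||v(η)| ≤ |v(ξ)|² + |v(η)|²`. -/
lemma lintegral_fourier_sq_gaussian_le {v : EuclideanSpace ℝ (Fin n) → ℂ} (hvc : Continuous v)
    (hv : Integrable v) {ε : ℝ} (hε : 0 < ε) :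
    ∫⁻ x, ‖𝓕 v x‖ₑ ^ 2 * ENNReal.ofReal (Real.exp (-(Real.pi * ε * ‖x‖ ^ 2))) ≤ ∫⁻ ξ, ‖v ξ‖ₑ ^ 2 := by
  have hu := continuous_fourier hv
  have hG : Integrable fun x : EuclideanSpace ℝ (Fin n) =>
      (Real.exp (-(Real.pi * ε * ‖x‖ ^ 2)) : ℝ) := integrable_gaussian (by positivity)
  set g : EuclideanSpace ℝ (Fin n) → ℂ := fun x =>
    ((Real.exp (-(Real.pi * ε * ‖x‖ ^ 2)) : ℝ) : ℂ) * (starRingEnd ℂ) (𝓕 v x) with hg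
  have hgi : Integrable g := by
    refine hG.ofReal.mul_bdd (c := ∫ ξ, ‖v ξ‖)
      (Complex.continuous_conj.comp hu).aestronglyMeasurable ?_
    exact Filter.Eventually.of_forall fun x => by simpa using norm_fourier_le v x
  have h := VectorFourier.integral_fourierIntegral_smul_eq_flip (μ := volume) (ν := volume)
    (L := innerₗ (EuclideanSpace ℝ (Fin n))) Real.continuous_fourierChar
    (by exact continuous_inner) hv hgi
  rw [flip_innerₗ] at h
  have h : ∫ x, 𝓕 v x • g x = ∫ ξ, v ξ • 𝓕 g ξ := h
  have hl : ∀ x, 𝓕 v x • g x = ((‖𝓕 v x‖ ^ 2 * Real.exp (-(Real.pi * ε * ‖x‖ ^ 2)) : ℝ) : ℂ) := by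
    intro x
    rw [hg, smul_eq_mul, mul_left_comm, Complex.mul_conj, Complex.normSq_eq_norm_sq,
      ← Complex.ofReal_mul, mul_comm]
  have hli : Integrable fun x => ‖𝓕 v x‖ ^ 2 * Real.exp (-(Real.pi * ε * ‖x‖ ^ 2)) := by
    refine hG.bdd_mul (c := (∫ ξ, ‖v ξ‖) ^ 2) (hu.norm.pow 2).aestronglyMeasurable ?_
    refine Filter.Eventually.of_forall fun x => ?_
    rw [Real.norm_of_nonneg (by positivity)]
    gcongr
    exact norm_fourier_le v x
  have hgF : ∀ ξ, ‖𝓕 g ξ‖ₑ ≤ ∫⁻ η, heat ε (ξ - η) * ‖v η‖ₑ := by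
    intro ξ
    have e1 : 𝓕 g ξ = (starRingEnd ℂ) (∫ x, ((Real.exp (-(Real.pi * ε * ‖x‖ ^ 2)) : ℝ) : ℂ)
        * 𝓕 (fun η => v (η + ξ)) x) := by
      rw [Real.fourier_eq', ← integral_conj]
      refine integral_congr_ae (Filter.Eventually.of_forall fun x => ?_)
      have e2 : 𝓕 (fun η => v (η + ξ)) x
          = Complex.exp ((2 * Real.pi * inner ℝ x ξ : ℝ) * Complex.I) * 𝓕 v x := by
        rw [Real.fourier_eq', Real.fourier_eq', ← integral_const_mul,
          ← integral_add_right_eq_self (fun η => Complex.exp ((2 * Real.pi * inner ℝ x ξ : ℝ) * Complex.I)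
            * (Complex.exp (((-2 * Real.pi * inner ℝ η x : ℝ) : ℂ) * Complex.I) • v η)) ξ]
        congr 1; ext η
        rw [smul_eq_mul, smul_eq_mul, ← mul_assoc, ← Complex.exp_add, inner_add_left,
          real_inner_comm ξ x]
        congr 2; push_cast; ring
      simp only [hg]
      rw [e2, map_mul, map_mul, Complex.conj_ofReal, ← Complex.exp_conj, map_mul, Complex.conj_I,
        Complex.conj_ofReal, smul_eq_mul, mul_left_comm]
      congr 3
      push_cast; ring_nf
    have hvi : Integrable fun η => v (η + ξ) := hv.comp_add_right ξ
    have hs : 0 < ε⁻¹ := by positivity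
    have e3 := integral_gaussian_mul hvi hs
    have e4 : ∀ x : EuclideanSpace ℝ (Fin n),
        (((ε⁻¹) ^ (-((n : ℝ) / 2)) * Real.exp (-(Real.pi * ‖x‖ ^ 2 / ε⁻¹)) : ℝ) : ℂ)
          = (((ε⁻¹) ^ (-((n : ℝ) / 2)) : ℝ) : ℂ) * ((Real.exp (-(Real.pi * ε * ‖x‖ ^ 2)) : ℝ) : ℂ) := by
      intro x
      rw [Complex.ofReal_mul]
      congr 4; field_simp
    have hA : ((ε ^ (-((n : ℝ) / 2)) : ℝ) : ℂ) * (((ε⁻¹) ^ (-((n : ℝ) / 2)) : ℝ) : ℂ) = 1 := by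
      rw [← Complex.ofReal_mul, ← Real.mul_rpow hε.le hs.le, mul_inv_cancel₀ hε.ne', Real.one_rpow,
        Complex.ofReal_one]
    have e5 : ∫ x, ((Real.exp (-(Real.pi * ε * ‖x‖ ^ 2)) : ℝ) : ℂ) * 𝓕 (fun η => v (η + ξ)) x
        = ∫ η, ((ε ^ (-((n : ℝ) / 2)) : ℝ) : ℂ)
          * (((Real.exp (-(Real.pi * ε⁻¹ * ‖η‖ ^ 2)) : ℝ) : ℂ) * v (η + ξ)) := by
      rw [integral_const_mul, e3, ← integral_const_mul]
      refine integral_congr_ae (Filter.Eventually.of_forall fun x => ?_)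
      simp only
      rw [e4 x, ← mul_assoc, ← mul_assoc, hA, one_mul]
    rw [e1, ← enorm_norm, RCLike.norm_conj, enorm_norm, e5]
    refine (enorm_integral_le_lintegral_enorm _).trans_eq ?_
    rw [← lintegral_add_right_eq_self (fun η => heat ε (ξ - η) * ‖v η‖ₑ) ξ]
    refine lintegral_congr fun η => ?_
    rw [heat_sub_comm, add_sub_cancel_right, heat_of_pos hε, ← mul_assoc, enorm_mul,
      ← Complex.ofReal_mul, ← ofReal_norm (Complex.ofReal _), Complex.norm_real,
      Real.norm_of_nonneg (by positivity)]
    congr 4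
    field_simp
  have hvm : Measurable v := hvc.measurable
  -- The heat kernel has mass one in either variable.
  have hm1 : ∫⁻ ξ, ∫⁻ η, heat ε (ξ - η) * ‖v ξ‖ₑ ^ 2 = ∫⁻ ξ, ‖v ξ‖ₑ ^ 2 := by
    refine lintegral_congr fun ξ => ?_
    rw [lintegral_mul_const _ (by fun_prop), lintegral_heat_sub_left hε, one_mul]
  have hm2 : ∫⁻ ξ, ∫⁻ η, heat ε (ξ - η) * ‖v η‖ₑ ^ 2 = ∫⁻ ξ, ‖v ξ‖ₑ ^ 2 := by
    rw [lintegral_lintegral_swap (by unfold Function.uncurry; fun_prop)]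
    refine lintegral_congr fun ξ => ?_
    rw [lintegral_mul_const _ (by fun_prop), lintegral_heat_sub_right hε, one_mul]
  have hlhs : ∫⁻ x, ‖𝓕 v x‖ₑ ^ 2 * ENNReal.ofReal (Real.exp (-(Real.pi * ε * ‖x‖ ^ 2)))
      = ‖∫ x, 𝓕 v x • g x‖ₑ := by
    simp_rw [hl]
    rw [integral_complex_ofReal, ← ofReal_norm, Complex.norm_real, Real.norm_of_nonneg
      (integral_nonneg fun x => by positivity), ofReal_integral_eq_lintegral_ofReal hli
      (Filter.Eventually.of_forall fun x => by positivity)]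
    refine lintegral_congr fun x => ?_
    rw [ENNReal.ofReal_mul (by positivity), ENNReal.ofReal_pow (norm_nonneg _), ofReal_norm]
  have htwo : (2 : ℝ≥0∞) * ∫⁻ ξ, ∫⁻ η, heat ε (ξ - η) * (‖v ξ‖ₑ * ‖v η‖ₑ)
      ≤ 2 * ∫⁻ ξ, ‖v ξ‖ₑ ^ 2 := by
    rw [two_mul (∫⁻ ξ, ‖v ξ‖ₑ ^ 2)]
    nth_rewrite 1 [← hm1]
    rw [← hm2, ← lintegral_add_left (by fun_prop), ← lintegral_const_mul _ (by fun_prop)]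
    refine lintegral_mono fun ξ => ?_
    rw [← lintegral_add_left (by fun_prop), ← lintegral_const_mul _ (by fun_prop)]
    refine lintegral_mono fun η => ?_
    rw [← mul_add, mul_left_comm]
    gcongr
    rw [← mul_assoc, ← ofReal_norm, ← ofReal_norm, ← ENNReal.ofReal_pow (norm_nonneg _),
      ← ENNReal.ofReal_pow (norm_nonneg _), ← ENNReal.ofReal_add (by positivity) (by positivity),
      show (2 : ℝ≥0∞) = ENNReal.ofReal 2 by simp, ← ENNReal.ofReal_mul (by positivity),
      ← ENNReal.ofReal_mul (by positivity)]
    exact ENNReal.ofReal_le_ofReal (two_mul_le_add_sq _ _)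
  rw [hlhs, h]
  calc ‖∫ ξ, v ξ • 𝓕 g ξ‖ₑ ≤ ∫⁻ ξ, ‖v ξ‖ₑ * ∫⁻ η, heat ε (ξ - η) * ‖v η‖ₑ := by
        refine (enorm_integral_le_lintegral_enorm _).trans (lintegral_mono fun ξ => ?_)
        rw [smul_eq_mul, enorm_mul]
        gcongr
        exact hgF ξ
    _ = ∫⁻ ξ, ∫⁻ η, heat ε (ξ - η) * (‖v ξ‖ₑ * ‖v η‖ₑ) := by
        refine lintegral_congr fun ξ => ?_
        rw [← lintegral_const_mul _ (by fun_prop)]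
        refine lintegral_congr fun η => ?_
        ring
    _ ≤ _ := (ENNReal.mul_le_mul_iff_right (by simp) (by simp)).1 htwo

/-- Half of Plancherel's theorem: the Fourier transform of an integrable continuous function does
not increase the `L²` norm. -/
lemma lintegral_fourier_sq_le {v : EuclideanSpace ℝ (Fin n) → ℂ} (hvc : Continuous v)
    (hv : Integrable v) : ∫⁻ x, ‖𝓕 v x‖ₑ ^ 2 ≤ ∫⁻ ξ, ‖v ξ‖ₑ ^ 2 := by
  have hu := (continuous_fourier hv).measurable
  have hlim : ∀ x : EuclideanSpace ℝ (Fin n), Filter.Tendsto (fun k : ℕ => ‖𝓕 v x‖ₑ ^ 2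
      * ENNReal.ofReal (Real.exp (-(Real.pi * (1 / ((k : ℝ) + 1)) * ‖x‖ ^ 2)))) Filter.atTop
      (nhds (‖𝓕 v x‖ₑ ^ 2)) := by
    intro x
    have h1 : Filter.Tendsto (fun k : ℕ => Real.exp (-(Real.pi * (1 / ((k : ℝ) + 1)) * ‖x‖ ^ 2)))
        Filter.atTop (nhds 1) := by
      have := ((tendsto_one_div_add_atTop_nhds_zero_nat (𝕜 := ℝ)).const_mul Real.pi).mul_const (‖x‖ ^ 2)
      have := (Real.continuous_exp.tendsto _).comp this.neg
      simpa [Function.comp_def] using this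
    have h2 := (ENNReal.continuous_ofReal.tendsto _).comp h1
    have := ENNReal.Tendsto.const_mul (a := ‖𝓕 v x‖ₑ ^ 2) h2 (Or.inr (by simp))
    simpa using this
  calc ∫⁻ x, ‖𝓕 v x‖ₑ ^ 2 = ∫⁻ x, Filter.liminf (fun k : ℕ => ‖𝓕 v x‖ₑ ^ 2
      * ENNReal.ofReal (Real.exp (-(Real.pi * (1 / ((k : ℝ) + 1)) * ‖x‖ ^ 2)))) Filter.atTop :=
        lintegral_congr fun x => (hlim x).liminf_eq.symm
    _ ≤ Filter.liminf (fun k : ℕ => ∫⁻ x, ‖𝓕 v x‖ₑ ^ 2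
      * ENNReal.ofReal (Real.exp (-(Real.pi * (1 / ((k : ℝ) + 1)) * ‖x‖ ^ 2)))) Filter.atTop :=
        lintegral_liminf_le fun k => by fun_prop
    _ ≤ ∫⁻ ξ, ‖v ξ‖ₑ ^ 2 := by
        refine (Filter.liminf_le_liminf (Filter.Eventually.of_forall fun k : ℕ =>
          lintegral_fourier_sq_gaussian_le hvc hv (by positivity : 0 < 1 / ((k : ℝ) + 1)))).trans ?_
        simp

/-- `|1 - e^{-2πi ξ·z}|² = 2(1 - cos 2πξ·z)` averaged against the heat kernel. -/
lemma lintegral_heat_mul_one_sub_exp {t : ℝ} (ht : 0 < t) (ξ : EuclideanSpace ℝ (Fin n)) :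
    ∫⁻ z, heat t z * ‖1 - Complex.exp ((-2 * Real.pi * inner ℝ ξ z : ℝ) * Complex.I)‖ₑ ^ 2
      = ENNReal.ofReal (2 * (1 - Real.exp (-(Real.pi * t * ‖ξ‖ ^ 2)))) := by
  have hi := integrable_heat (n := n) ht
  have hF := fourier_heat (n := n) ht ξ
  have hF0 := fourier_heat (n := n) ht 0
  set k : EuclideanSpace ℝ (Fin n) → ℝ := fun x =>
    t ^ (-((n : ℝ) / 2)) * Real.exp (-(Real.pi * ‖x‖ ^ 2 / t)) with hk
  have hki : Integrable k := hi.re.congr (Filter.Eventually.of_forall fun x => Complex.ofReal_re _)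
  have hkpos : ∀ x, 0 ≤ k x := fun x => by rw [hk]; positivity
  have hnorm : ∀ θ : ℝ, ‖1 - Complex.exp (θ * Complex.I)‖ ^ 2 = 2 * (1 - Real.cos θ) := by
    intro θ
    rw [← Complex.normSq_eq_norm_sq, Complex.normSq_apply]
    simp only [Complex.sub_re, Complex.one_re, Complex.exp_ofReal_mul_I_re, Complex.sub_im,
      Complex.one_im, Complex.exp_ofReal_mul_I_im]
    nlinarith [Real.sin_sq_add_cos_sq θ]
  have hcos : ∫ z, k z * Real.cos (-2 * Real.pi * inner ℝ ξ z) = Real.exp (-(Real.pi * t * ‖ξ‖ ^ 2)) := by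
    rw [Real.fourier_eq'] at hF
    have := congrArg Complex.re hF
    rw [Complex.ofReal_re, ← RCLike.re_eq_complex_re, ← integral_re] at this
    · rw [← this]
      refine integral_congr_ae (Filter.Eventually.of_forall fun z => ?_)
      simp only [smul_eq_mul, RCLike.re_eq_complex_re, Complex.re_mul_ofReal,
        Complex.exp_ofReal_mul_I_re]
      rw [mul_comm, real_inner_comm]
    · refine hi.bdd_mul (c := 1) (Continuous.aestronglyMeasurable (by fun_prop)) ?_
      exact Filter.Eventually.of_forall fun ξ => (Complex.norm_exp_ofReal_mul_I _).le
  have hone : ∫ z, k z = 1 := by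
    rw [Real.fourier_eq'] at hF0
    have : ∫ z, ((k z : ℝ) : ℂ) = 1 := by
      simpa only [inner_zero_right, mul_zero, Complex.ofReal_zero, zero_mul, Complex.exp_zero, one_smul,
        norm_zero, ne_eq, OfNat.ofNat_ne_zero, not_false_eq_true, zero_pow, neg_zero, Real.exp_zero,
        Complex.ofReal_one] using hF0
    rw [integral_complex_ofReal] at this
    exact_mod_cast this
  have hkci : Integrable fun z => k z * Real.cos (-2 * Real.pi * inner ℝ ξ z) := by
    refine hki.mul_bdd (c := 1) (Continuous.aestronglyMeasurable (by fun_prop)) ?_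
    exact Filter.Eventually.of_forall fun z => by simpa using Real.abs_cos_le_one _
  have htot : ∫ z, k z * (2 * (1 - Real.cos (-2 * Real.pi * inner ℝ ξ z)))
      = 2 * (1 - Real.exp (-(Real.pi * t * ‖ξ‖ ^ 2))) := by
    rw [← hcos]
    nth_rewrite 2 [← hone]
    rw [← integral_sub hki hkci, ← integral_const_mul]
    congr 1; ext z; ring
  rw [← htot, ofReal_integral_eq_lintegral_ofReal]
  · refine lintegral_congr fun z => ?_
    rw [heat_of_pos ht, ← ofReal_norm, ← ENNReal.ofReal_pow (norm_nonneg _),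
      ← ENNReal.ofReal_mul (by positivity), hnorm]
  · have := (hki.sub hkci).const_mul 2
    refine this.congr (Filter.Eventually.of_forall fun z => ?_)
    simp only [Pi.sub_apply]; ring
  · exact Filter.Eventually.of_forall fun z => mul_nonneg (hkpos z) (by
      have := Real.cos_le_one (-2 * Real.pi * inner ℝ ξ z)
      linarith)

/-- The heat-kernel energy of `u = 𝓕 v` is bounded by its expression on the Fourier side
(equality holds, but only this half is needed). -/
lemma lintegral_heat_energy_le {v : EuclideanSpace ℝ (Fin n) → ℂ} (hvc : Continuous v)
    (hv : Integrable v) {t : ℝ} (ht : 0 < t) :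
    ∫⁻ x, ∫⁻ y, heat t (x - y) * ‖𝓕 v x - 𝓕 v y‖ₑ ^ 2
      ≤ ∫⁻ ξ, ENNReal.ofReal (2 * (1 - Real.exp (-(Real.pi * t * ‖ξ‖ ^ 2)))) * ‖v ξ‖ₑ ^ 2 := by
  have hu := (continuous_fourier hv).measurable
  have hvm : Measurable v := hvc.measurable
  calc ∫⁻ x, ∫⁻ y, heat t (x - y) * ‖𝓕 v x - 𝓕 v y‖ₑ ^ 2
      = ∫⁻ x, ∫⁻ z, heat t z * ‖𝓕 v x - 𝓕 v (x + z)‖ₑ ^ 2 := by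
        refine lintegral_congr fun x => ?_
        rw [← lintegral_add_left_eq_self _ x]
        refine lintegral_congr fun z => ?_
        rw [heat_sub_comm, add_sub_cancel_left]
    _ = ∫⁻ z, ∫⁻ x, heat t z * ‖𝓕 v x - 𝓕 v (x + z)‖ₑ ^ 2 :=
        lintegral_lintegral_swap (by unfold Function.uncurry; fun_prop)
    _ ≤ ∫⁻ z, ∫⁻ ξ, heat t z *
          (‖1 - Complex.exp ((-2 * Real.pi * inner ℝ ξ z : ℝ) * Complex.I)‖ₑ ^ 2 * ‖v ξ‖ₑ ^ 2) := by
        -- `u - u(· + z)` is the Fourier transform of `(1 - e^{-2πi ξ·z}) v(ξ)`.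
        refine lintegral_mono fun z => ?_
        rw [lintegral_const_mul _ (by fun_prop), lintegral_const_mul _ (by fun_prop)]
        refine mul_le_mul' le_rfl ?_
        have hmi := integrable_modulate hv z
        have hd : 𝓕 (fun ξ => v ξ - Complex.exp ((-2 * Real.pi * inner ℝ ξ z : ℝ) * Complex.I) * v ξ)
            = fun x => 𝓕 v x - 𝓕 v (x + z) := by
          ext x
          have h1 := integrable_modulate hv x
          have h2 := integrable_modulate hmi x
          rw [← fourier_modulate, Real.fourier_eq', Real.fourier_eq', Real.fourier_eq']
          simp_rw [smul_eq_mul, mul_sub]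
          exact integral_sub h1 h2
        have := lintegral_fourier_sq_le (v := fun ξ => v ξ
          - Complex.exp ((-2 * Real.pi * inner ℝ ξ z : ℝ) * Complex.I) * v ξ) (by fun_prop) (hv.sub hmi)
        rw [hd] at this
        refine this.trans_eq (lintegral_congr fun ξ => ?_)
        rw [← mul_pow, ← enorm_mul]
        congr 2; ring
    _ = ∫⁻ ξ, ∫⁻ z, heat t z *
          (‖1 - Complex.exp ((-2 * Real.pi * inner ℝ ξ z : ℝ) * Complex.I)‖ₑ ^ 2 * ‖v ξ‖ₑ ^ 2) :=
        lintegral_lintegral_swap (by unfold Function.uncurry; fun_prop)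
    _ = _ := by
        refine lintegral_congr fun ξ => ?_
        simp_rw [← mul_assoc]
        rw [lintegral_mul_const _ (by fun_prop), lintegral_heat_mul_one_sub_exp ht]

/-! ### The Stein–Weiss inequality -/

/-- The constant with `riesz a x = rieszConst n a * |x|^{2a-n}` off the origin. -/
noncomputable def rieszConst (n : ℕ) (a : ℝ) : ℝ :=
  Real.Gamma ((n : ℝ) / 2 - a) * Real.pi ^ (a - (n : ℝ) / 2)

lemma rieszConst_pos {a : ℝ} (ha : a < (n : ℝ) / 2) : 0 < rieszConst n a :=
  mul_pos (Real.Gamma_pos_of_pos (sub_pos.2 ha)) (Real.rpow_pos_of_pos Real.pi_pos _)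

lemma riesz_eq_rieszConst {a : ℝ} (ha : a < (n : ℝ) / 2) {x : EuclideanSpace ℝ (Fin n)} (hx : x ≠ 0) :
    riesz a x = ENNReal.ofReal (rieszConst n a * ‖x‖ ^ (2 * a - n)) := by
  rw [riesz_eq ha hx, rieszConst, mul_assoc]

lemma riesz_ne_zero {a : ℝ} (ha : a < (n : ℝ) / 2) {x : EuclideanSpace ℝ (Fin n)} (hx : x ≠ 0) :
    riesz a x ≠ 0 := by
  have := norm_pos_iff.2 hx
  have := rieszConst_pos ha
  rw [riesz_eq_rieszConst ha hx]
  simp only [ne_eq, ENNReal.ofReal_eq_zero, not_le]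
  positivity

lemma riesz_ne_top {a : ℝ} (ha : a < (n : ℝ) / 2) {x : EuclideanSpace ℝ (Fin n)} (hx : x ≠ 0) :
    riesz a x ≠ ∞ := by
  rw [riesz_eq_rieszConst ha hx]; simp

/-- Powers of `|x|` turn one Riesz kernel into another. -/
lemma rpow_mul_riesz {a b : ℝ} (ha : a < (n : ℝ) / 2) (hb : b < (n : ℝ) / 2)
    {x : EuclideanSpace ℝ (Fin n)} (hx : x ≠ 0) :
    ENNReal.ofReal (‖x‖ ^ (2 * (b - a))) * riesz a x
      = ENNReal.ofReal (rieszConst n a / rieszConst n b) * riesz b x := by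
  have hx' := norm_pos_iff.2 hx
  have h1 := rieszConst_pos ha
  have h2 := rieszConst_pos hb
  rw [riesz_eq_rieszConst ha hx, riesz_eq_rieszConst hb hx, ← ENNReal.ofReal_mul (by positivity),
    ← ENNReal.ofReal_mul (by positivity)]
  congr 1
  rw [mul_left_comm, ← Real.rpow_add hx', show 2 * (b - a) + (2 * a - n) = 2 * b - n by ring]
  field_simp

/-- Cauchy–Schwarz with a weight, the core of Schur's test. -/
lemma lintegral_mul_sq_le {X : Type*} [MeasurableSpace X] {μ : Measure X} {k h U : X → ℝ≥0∞}
    (hk : Measurable k) (hh : Measurable h) (hU : Measurable U)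
    (h0 : ∀ᵐ x ∂μ, h x ≠ 0) (h1 : ∀ᵐ x ∂μ, h x ≠ ∞) :
    (∫⁻ x, k x * U x ∂μ) ^ 2 ≤ (∫⁻ x, k x * h x ∂μ) * ∫⁻ x, k x * (U x ^ 2 / h x) ∂μ := by
  have hH := ENNReal.lintegral_mul_le_Lp_mul_Lq μ Real.HolderConjugate.two_two
    (f := fun x => (k x * h x) ^ (1 / 2 : ℝ)) (g := fun x => (k x * (U x ^ 2 / h x)) ^ (1 / 2 : ℝ))
    (by fun_prop) (by fun_prop)
  have hsq : ∀ a : ℝ≥0∞, (a ^ (1 / 2 : ℝ)) ^ (2 : ℝ) = a := by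
    intro a; rw [← ENNReal.rpow_mul]; norm_num
  have hsq' : ∀ a : ℝ≥0∞, (a ^ (1 / 2 : ℝ)) ^ 2 = a := by
    intro a; rw [← ENNReal.rpow_natCast]; exact_mod_cast hsq a
  simp_rw [hsq] at hH
  have he : ∫⁻ x, k x * U x ∂μ = ∫⁻ x, ((fun x => (k x * h x) ^ (1 / 2 : ℝ))
      * fun x => (k x * (U x ^ 2 / h x)) ^ (1 / 2 : ℝ)) x ∂μ := by
    refine lintegral_congr_ae ?_
    filter_upwards [h0, h1] with x hx0 hx1
    rw [Pi.mul_apply, ← ENNReal.mul_rpow_of_nonneg _ _ (by norm_num)]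
    have : k x * h x * (k x * (U x ^ 2 / h x)) = (k x * U x) ^ (2 : ℝ) := by
      rw [mul_mul_mul_comm, ENNReal.mul_div_cancel hx0 hx1]
      rw [show (2 : ℝ) = ((2 : ℕ) : ℝ) by norm_num, ENNReal.rpow_natCast]; ring
    rw [this, ← ENNReal.rpow_mul]; norm_num
  rw [he]
  calc _ ≤ ((∫⁻ x, k x * h x ∂μ) ^ (1 / 2 : ℝ) * (∫⁻ x, k x * (U x ^ 2 / h x) ∂μ) ^ (1 / 2 : ℝ)) ^ 2 := by
        gcongr
    _ = _ := by rw [mul_pow, hsq', hsq']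

lemma ae_ne_zero (hn : 0 < n) : ∀ᵐ x : EuclideanSpace ℝ (Fin n), x ≠ 0 := by
  have : Nonempty (Fin n) := ⟨⟨0, hn⟩⟩
  exact Measure.ae_ne volume 0

/-- The Stein–Weiss inequality for the Riesz potential, with its sharp constant, by Schur's test
with the powers of `|x|` that the Riesz kernels map to each other. -/
lemma lintegral_riesz_potential_le {α β : ℝ} (hβ : 0 < β) (hβα : β < α) (hαn : α < n)
    {U : EuclideanSpace ℝ (Fin n) → ℝ≥0∞} (hU : Measurable U) :
    ∫⁻ x : EuclideanSpace ℝ (Fin n), ENNReal.ofReal (‖x‖ ^ (-α))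
        * (∫⁻ y, riesz ((α - β) / 4) (x - y) * U y) ^ 2
      ≤ ENNReal.ofReal ((Real.Gamma ((α - β) / 4) * Real.pi ^ (-((α - β) / 4))) ^ 2
          * (pittConst n α / pittConst n β))
        * ∫⁻ y, ENNReal.ofReal (‖y‖ ^ (-β)) * U y ^ 2 := by
  have hn : 0 < n := by
    have : (0 : ℝ) < n := by linarith
    exact_mod_cast this
  set A := (α - β) / 4 with hA
  set B := ((n : ℝ) + β) / 4 with hB
  set B' := ((n : ℝ) - α) / 4 with hB'
  have hA0 : 0 < A := by rw [hA]; linarith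
  have hB0 : 0 < B := by rw [hB]; linarith
  have hB'0 : 0 < B' := by rw [hB']; linarith
  have hAB : A + B < (n : ℝ) / 2 := by rw [hA, hB]; linarith
  have hAB' : A + B' < (n : ℝ) / 2 := by rw [hA, hB']; linarith
  have hBn : B < (n : ℝ) / 2 := by linarith
  have hB'n : B' < (n : ℝ) / 2 := by linarith
  -- The test power is `|y|^{-(n-β)/2}`, a multiple of `riesz B`; `riesz A` maps it to `riesz (A + B)`,
  -- which is `|x|^α` times a multiple of `riesz B'`. Dually, `riesz A` maps `riesz B'` to `|y|^{-β}` times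
  -- a multiple of `riesz B`.
  set c1 := Real.Gamma A * Real.Gamma B / Real.Gamma (A + B) with hc1
  set c2 := rieszConst n (A + B) / rieszConst n B' with hc2
  set c3 := Real.Gamma A * Real.Gamma B' / Real.Gamma (A + B') with hc3
  set c4 := rieszConst n (A + B') / rieszConst n B with hc4
  have hc1p : 0 ≤ c1 := by
    have := Real.Gamma_pos_of_pos hA0; have := Real.Gamma_pos_of_pos hB0
    have := Real.Gamma_pos_of_pos (add_pos hA0 hB0); positivity
  have hc3p : 0 ≤ c3 := by
    have := Real.Gamma_pos_of_pos hA0; have := Real.Gamma_pos_of_pos hB'0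
    have := Real.Gamma_pos_of_pos (add_pos hA0 hB'0); positivity
  have hc2p : 0 ≤ c2 := (div_pos (rieszConst_pos hAB) (rieszConst_pos hB'n)).le
  have hc4p : 0 ≤ c4 := (div_pos (rieszConst_pos hAB') (rieszConst_pos hBn)).le
  have hconst : c1 * c2 * c3 * c4
      = (Real.Gamma A * Real.pi ^ (-A)) ^ 2 * (pittConst n α / pittConst n β) := by
    have g1 := (Real.Gamma_pos_of_pos hB0).ne'
    have g2 := (Real.Gamma_pos_of_pos hB'0).ne'
    have g3 := (Real.Gamma_pos_of_pos (add_pos hA0 hB0)).ne'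
    have g4 := (Real.Gamma_pos_of_pos (add_pos hA0 hB'0)).ne'
    have p1 : ∀ r : ℝ, Real.pi ^ r ≠ 0 := fun r => (Real.rpow_pos_of_pos Real.pi_pos r).ne'
    have e1 : (n : ℝ) / 2 - (A + B) = B' := by rw [hA, hB, hB']; ring
    have e2 : (n : ℝ) / 2 - B' = A + B := by rw [hA, hB, hB']; ring
    have e3 : (n : ℝ) / 2 - (A + B') = B := by rw [hA, hB, hB']; ring
    have e4 : (n : ℝ) / 2 - B = A + B' := by rw [hA, hB, hB']; ring
    have e5 : ((n : ℝ) + α) / 4 = A + B := by rw [hA, hB]; ring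
    have e6 : ((n : ℝ) - β) / 4 = A + B' := by rw [hA, hB']; ring
    have hpi : Real.pi ^ (A + B - (n : ℝ) / 2) / Real.pi ^ (B' - (n : ℝ) / 2)
        * (Real.pi ^ (A + B' - (n : ℝ) / 2) / Real.pi ^ (B - (n : ℝ) / 2))
        = (Real.pi ^ (-A)) ^ 2 * (Real.pi ^ α / Real.pi ^ β) := by
      rw [← Real.rpow_sub Real.pi_pos, ← Real.rpow_sub Real.pi_pos, ← Real.rpow_sub Real.pi_pos,
        ← Real.rpow_natCast, ← Real.rpow_mul Real.pi_pos.le, ← Real.rpow_add Real.pi_pos,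
        ← Real.rpow_add Real.pi_pos]
      congr 1; rw [hA]; push_cast; ring
    calc c1 * c2 * c3 * c4
        = (Real.Gamma A * (Real.Gamma B' / Real.Gamma (A + B)) / (Real.Gamma (A + B') / Real.Gamma B)) ^ 2
          * (Real.pi ^ (A + B - (n : ℝ) / 2) / Real.pi ^ (B' - (n : ℝ) / 2)
        * (Real.pi ^ (A + B' - (n : ℝ) / 2) / Real.pi ^ (B - (n : ℝ) / 2))) := by
          rw [hc1, hc2, hc3, hc4, rieszConst, rieszConst, rieszConst, rieszConst, e1, e2, e3, e4]
          field_simp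
      _ = _ := by
          rw [hpi, pittConst, pittConst, ← hB, ← hB', e5, e6]
          field_simp
  have hpot : ∀ x : EuclideanSpace ℝ (Fin n), x ≠ 0 →
      ENNReal.ofReal (‖x‖ ^ (-α)) * (∫⁻ y, riesz A (x - y) * U y) ^ 2
        ≤ ENNReal.ofReal (c1 * c2) * ∫⁻ y, riesz A (y - x) * riesz B' x * (U y ^ 2 / riesz B y) := by
    intro x hx
    have hsym : ∀ y, riesz A (y - x) = riesz A (x - y) := by
      intro y; simp_rw [riesz, heat_sub_comm]
    have hs := lintegral_mul_sq_le (μ := volume) (k := fun y => riesz A (x - y)) (h := riesz B) (U := U)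
      (by fun_prop) (by fun_prop) hU
      ((ae_ne_zero hn).mono fun y hy => riesz_ne_zero hBn hy)
      ((ae_ne_zero hn).mono fun y hy => riesz_ne_top hBn hy)
    rw [lintegral_riesz_conv hA0 hB0] at hs
    have hw := rpow_mul_riesz hAB hB'n hx
    rw [show 2 * (B' - (A + B)) = -α by rw [hA, hB, hB']; ring] at hw
    calc _ ≤ ENNReal.ofReal (‖x‖ ^ (-α)) * (ENNReal.ofReal c1 * riesz (A + B) x
          * ∫⁻ y, riesz A (x - y) * (U y ^ 2 / riesz B y)) := by gcongr
      _ = ENNReal.ofReal c1 * (ENNReal.ofReal (‖x‖ ^ (-α)) * riesz (A + B) x)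
          * ∫⁻ y, riesz A (x - y) * (U y ^ 2 / riesz B y) := by ring
      _ = ENNReal.ofReal (c1 * c2) * (riesz B' x * ∫⁻ y, riesz A (x - y) * (U y ^ 2 / riesz B y)) := by
          rw [hw, ENNReal.ofReal_mul hc1p]; ring
      _ = _ := by
          rw [← lintegral_const_mul _ (by fun_prop)]
          congr 1
          refine lintegral_congr fun y => ?_
          rw [hsym]; ring
  calc _ ≤ ∫⁻ x : EuclideanSpace ℝ (Fin n),
          ENNReal.ofReal (c1 * c2) * ∫⁻ y, riesz A (y - x) * riesz B' x * (U y ^ 2 / riesz B y) :=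
        lintegral_mono_ae ((ae_ne_zero hn).mono hpot)
    _ = ENNReal.ofReal (c1 * c2) * ∫⁻ y, ∫⁻ x, riesz A (y - x) * riesz B' x * (U y ^ 2 / riesz B y) := by
        rw [lintegral_const_mul _ (by fun_prop),
          lintegral_lintegral_swap (by unfold Function.uncurry; fun_prop)]
    _ = ENNReal.ofReal (c1 * c2) * ∫⁻ y, ENNReal.ofReal (c3 * c4)
          * (ENNReal.ofReal (‖y‖ ^ (-β)) * U y ^ 2) := by
        congr 1
        refine lintegral_congr_ae ((ae_ne_zero hn).mono fun y hy => ?_)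
        simp only
        rw [lintegral_mul_const _ (by fun_prop), lintegral_riesz_conv hA0 hB'0]
        have hw := rpow_mul_riesz hAB' hBn hy
        rw [show 2 * (B - (A + B')) = β by rw [hA, hB, hB']; ring] at hw
        have hinv : ENNReal.ofReal (‖y‖ ^ (-β)) * ENNReal.ofReal (‖y‖ ^ β) = 1 := by
          have := norm_pos_iff.2 hy
          rw [← ENNReal.ofReal_mul (by positivity), ← Real.rpow_add this]; simp
        calc _ = ENNReal.ofReal c3 * ((ENNReal.ofReal (‖y‖ ^ (-β)) * ENNReal.ofReal (‖y‖ ^ β))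
                * riesz (A + B') y) * (U y ^ 2 / riesz B y) := by rw [hinv, one_mul]
          _ = ENNReal.ofReal c3 * ENNReal.ofReal (‖y‖ ^ (-β)) * (ENNReal.ofReal (‖y‖ ^ β)
                * riesz (A + B') y) * (U y ^ 2 / riesz B y) := by ring
          _ = ENNReal.ofReal c3 * ENNReal.ofReal c4 * ENNReal.ofReal (‖y‖ ^ (-β)) *
                (riesz B y * (U y ^ 2 / riesz B y)) := by rw [hw]; ring
          _ = _ := by
            rw [ENNReal.mul_div_cancel (riesz_ne_zero hBn hy) (riesz_ne_top hBn hy),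
              ENNReal.ofReal_mul hc3p]; ring
    _ = _ := by
        rw [lintegral_const_mul _ (by fun_prop), ← mul_assoc, ← ENNReal.ofReal_mul (by positivity),
          ← hconst]
        congr 2; ring

/-- If `û = |ξ|^{2a} f̂`, then `f` is a multiple of the Riesz potential of `u`. Only the bound on
absolute values is recorded; it needs no integrability of `u`. -/
lemma enorm_fourier_le_riesz_potential {a : ℝ} (ha : 0 < a) (hn : 0 < n)
    {F : EuclideanSpace ℝ (Fin n) → ℂ} (hFc : Continuous F) (hF : Integrable F)
    (hv : Integrable fun ξ => ((‖ξ‖ ^ (2 * a) : ℝ) : ℂ) * F ξ) (x : EuclideanSpace ℝ (Fin n)) :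
    ENNReal.ofReal (Real.Gamma a * Real.pi ^ (-a)) * ‖𝓕 F x‖ₑ
      ≤ ∫⁻ y, riesz a (x - y) * ‖𝓕 (fun ξ => ((‖ξ‖ ^ (2 * a) : ℝ) : ℂ) * F ξ) y‖ₑ := by
  set v : EuclideanSpace ℝ (Fin n) → ℂ := fun ξ => ((‖ξ‖ ^ (2 * a) : ℝ) : ℂ) * F ξ with hvdef
  set e : EuclideanSpace ℝ (Fin n) → ℂ := fun ξ =>
    Complex.exp ((-2 * Real.pi * inner ℝ ξ x : ℝ) * Complex.I) with he
  have hec : Continuous e := by rw [he]; fun_prop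
  have hvc : Continuous v := by
    have : Continuous fun ξ : EuclideanSpace ℝ (Fin n) => ‖ξ‖ ^ (2 * a) :=
      continuous_norm.rpow_const fun _ => Or.inr (by positivity)
    exact (Complex.continuous_ofReal.comp this).mul hFc
  have hum := (continuous_fourier hv).measurable
  -- `Γ(a) π^{-a} |ξ|^{-2a} = ∫₀^∞ s^{a-1} e^{-πs|ξ|²} ds`; Fubini is applied in `(s, ξ)`, where the
  -- double integral converges absolutely because `F` is integrable.
  have hgam : ∀ ξ : EuclideanSpace ℝ (Fin n), ξ ≠ 0 →
      ∫ s in Set.Ioi (0 : ℝ), s ^ (a - 1) * Real.exp (-(Real.pi * s * ‖ξ‖ ^ 2))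
        = Real.Gamma a * Real.pi ^ (-a) * ‖ξ‖ ^ (-(2 * a)) := by
    intro ξ hξ
    have hξ' := norm_pos_iff.2 hξ
    have := Real.integral_rpow_mul_exp_neg_mul_Ioi ha (by positivity : 0 < Real.pi * ‖ξ‖ ^ 2)
    simp_rw [show ∀ s, Real.pi * ‖ξ‖ ^ 2 * s = Real.pi * s * ‖ξ‖ ^ 2 by intro s; ring] at this
    rw [this, one_div, Real.inv_rpow (by positivity), ← Real.rpow_neg (by positivity),
      Real.mul_rpow Real.pi_pos.le (by positivity), ← Real.rpow_natCast, ← Real.rpow_mul hξ'.le]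
    rw [show ((2 : ℕ) : ℝ) * -a = -(2 * a) by push_cast; ring]; ring
  let Φ : ℝ → EuclideanSpace ℝ (Fin n) → ℂ := fun s ξ =>
    ((s ^ (a - 1) * Real.exp (-(Real.pi * s * ‖ξ‖ ^ 2)) : ℝ) : ℂ) * (e ξ * v ξ)
  have hΦm : Measurable (Function.uncurry Φ) := by
    have := hec.measurable; have := hvc.measurable
    unfold Φ Function.uncurry; fun_prop
  have hkey : ∀ ξ : EuclideanSpace ℝ (Fin n), ξ ≠ 0 →
      ∫ s in Set.Ioi (0 : ℝ), Φ s ξ = ((Real.Gamma a * Real.pi ^ (-a) : ℝ) : ℂ) * (e ξ * F ξ) := by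
    intro ξ hξ
    have hξ' := norm_pos_iff.2 hξ
    simp only [Φ]
    rw [integral_mul_const, integral_complex_ofReal, hgam ξ hξ, Complex.ofReal_mul _ (‖ξ‖ ^ _)]
    simp only [hvdef]
    have : ((‖ξ‖ ^ (-(2 * a)) : ℝ) : ℂ) * ((‖ξ‖ ^ (2 * a) : ℝ) : ℂ) = 1 := by
      rw [← Complex.ofReal_mul, ← Real.rpow_add hξ']; simp
    linear_combination ((Real.Gamma a * Real.pi ^ (-a) : ℝ) : ℂ) * (e ξ * F ξ) * this
  have hkeyabs : ∀ ξ : EuclideanSpace ℝ (Fin n), ξ ≠ 0 →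
      ∫⁻ s in Set.Ioi (0 : ℝ), ‖Φ s ξ‖ₑ = ENNReal.ofReal (Real.Gamma a * Real.pi ^ (-a)) * ‖F ξ‖ₑ := by
    intro ξ hξ
    have hξ' := norm_pos_iff.2 hξ
    have h := lintegral_pw_mul_exp ha (by positivity : 0 < Real.pi * ‖ξ‖ ^ 2)
    rw [lintegral_pw_mul] at h
    have hG := Real.Gamma_pos_of_pos ha
    calc _ = ∫⁻ s in Set.Ioi (0 : ℝ), ENNReal.ofReal (s ^ (a - 1))
            * ENNReal.ofReal (Real.exp (-(Real.pi * ‖ξ‖ ^ 2 * s))) * ‖v ξ‖ₑ := by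
          refine setLIntegral_congr_fun measurableSet_Ioi fun s hs => ?_
          have hs : (0 : ℝ) < s := hs
          simp only [Φ, he]
          rw [enorm_mul, enorm_mul, ← ofReal_norm, Complex.norm_real, Real.norm_of_nonneg (by positivity),
            ← ofReal_norm (Complex.exp _), Complex.norm_exp_ofReal_mul_I, ENNReal.ofReal_one, one_mul,
            ← ENNReal.ofReal_mul (by positivity)]
          congr 4; ring
      _ = _ := by
          rw [lintegral_mul_const _ (by fun_prop), h, hvdef]
          simp only
          rw [enorm_mul, ← ofReal_norm (Complex.ofReal _), Complex.norm_real,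
            Real.norm_of_nonneg (by positivity), ← mul_assoc, ← ENNReal.ofReal_mul (by positivity)]
          congr 2
          rw [Real.mul_rpow Real.pi_pos.le (by positivity), ← Real.rpow_natCast, ← Real.rpow_mul hξ'.le,
            mul_assoc, mul_assoc, ← Real.rpow_add hξ']
          rw [show ((2 : ℕ) : ℝ) * -a + 2 * a = 0 by push_cast; ring, Real.rpow_zero, mul_one]
  have hint : Integrable (Function.uncurry Φ)
      ((volume.restrict (Set.Ioi (0 : ℝ))).prod volume) := by
    refine ⟨hΦm.aestronglyMeasurable, ?_⟩
    rw [HasFiniteIntegral, lintegral_prod_symm _ hΦm.enorm.aemeasurable]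
    simp only [Function.uncurry]
    rw [lintegral_congr_ae ((ae_ne_zero hn).mono hkeyabs), lintegral_const_mul _ hFc.measurable.enorm]
    exact ENNReal.mul_lt_top (by simp) hF.2
  have hfub := integral_integral_swap hint
  have hrhs : ∫ ξ, ∫ s in Set.Ioi (0 : ℝ), Φ s ξ = ((Real.Gamma a * Real.pi ^ (-a) : ℝ) : ℂ) * 𝓕 F x := by
    rw [integral_congr_ae ((ae_ne_zero hn).mono hkey), integral_const_mul, Real.fourier_eq']
    rfl
  have hG := Real.Gamma_pos_of_pos ha
  calc ENNReal.ofReal (Real.Gamma a * Real.pi ^ (-a)) * ‖𝓕 F x‖ₑ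
      = ‖∫ s in Set.Ioi (0 : ℝ), ∫ ξ, Φ s ξ‖ₑ := by
        rw [hfub, hrhs, enorm_mul, ← ofReal_norm (Complex.ofReal _), Complex.norm_real,
          Real.norm_of_nonneg (by positivity)]
    _ ≤ ∫⁻ s in Set.Ioi (0 : ℝ), ‖∫ ξ, Φ s ξ‖ₑ := enorm_integral_le_lintegral_enorm _
    _ ≤ ∫⁻ s in Set.Ioi (0 : ℝ), ENNReal.ofReal (s ^ (a - 1)) * ∫⁻ y, heat s (x - y) * ‖𝓕 v y‖ₑ := by
        refine setLIntegral_mono' measurableSet_Ioi fun s hs => ?_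
        have hs : (0 : ℝ) < s := hs
        have e1 : ∫ ξ, Φ s ξ = ((s ^ (a - 1) : ℝ) : ℂ)
            * ∫ ξ, ((Real.exp (-(Real.pi * s * ‖ξ‖ ^ 2)) : ℝ) : ℂ) * (e ξ * v ξ) := by
          rw [← integral_const_mul]
          congr 1; ext ξ
          simp only [Φ]; push_cast; ring
        rw [e1, enorm_mul, ← ofReal_norm (Complex.ofReal _), Complex.norm_real,
          Real.norm_of_nonneg (by positivity)]
        gcongr
        exact enorm_integral_gaussian_le hv hs x
    _ = ∫⁻ s, ∫⁻ y, pw (a - 1) s * heat s (x - y) * ‖𝓕 v y‖ₑ := by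
        rw [← lintegral_pw_mul]
        refine lintegral_congr fun s => ?_
        rw [← lintegral_const_mul _ (by fun_prop)]
        simp_rw [mul_assoc]
    _ = ∫⁻ y, ∫⁻ s, pw (a - 1) s * heat s (x - y) * ‖𝓕 v y‖ₑ :=
        lintegral_lintegral_swap (by unfold Function.uncurry; fun_prop)
    _ = _ := by
        refine lintegral_congr fun y => ?_
        rw [lintegral_mul_const _ (by fun_prop), riesz]

/-! ### The ground state representation -/

/-- The heat flow of the Riesz kernel is a time shift inside its superposition. -/
lemma lintegral_heat_riesz {c t : ℝ} (ht : 0 < t) (x : EuclideanSpace ℝ (Fin n)) :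
    ∫⁻ y, heat t (x - y) * riesz c y = ∫⁻ s, pw (c - 1) (s - t) * heat s x := by
  calc ∫⁻ y, heat t (x - y) * riesz c y
      = ∫⁻ y, ∫⁻ s, pw (c - 1) s * (heat t (x - y) * heat s y) := by
        refine lintegral_congr fun y => ?_
        rw [riesz, ← lintegral_const_mul _ (by fun_prop)]
        refine lintegral_congr fun s => ?_
        ring
    _ = ∫⁻ s, ∫⁻ y, pw (c - 1) s * (heat t (x - y) * heat s y) :=
        lintegral_lintegral_swap (by unfold Function.uncurry; fun_prop)
    _ = ∫⁻ s, pw (c - 1) s * heat (s + t) x := by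
        refine lintegral_congr fun s => ?_
        rw [lintegral_const_mul _ (by fun_prop)]
        by_cases hs : 0 < s
        · rw [lintegral_heat_conv ht hs, add_comm]
        · simp [pw, hs]
    _ = _ := by
        rw [← lintegral_sub_right_eq_self _ t]
        simp

/-- Superposition of heat kernels with density `diffPos c · t`. -/
noncomputable def rieszPos (c t : ℝ) (x : EuclideanSpace ℝ (Fin n)) : ℝ≥0∞ :=
  ∫⁻ s, diffPos c s t * heat s x

/-- Superposition of heat kernels with density `diffNeg c · t`. -/
noncomputable def rieszNeg (c t : ℝ) (x : EuclideanSpace ℝ (Fin n)) : ℝ≥0∞ :=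
  ∫⁻ s, diffNeg c s t * heat s x

lemma Measurable.diffPos {α : Type*} [MeasurableSpace α] {f g : α → ℝ} (c : ℝ)
    (hf : Measurable f) (hg : Measurable g) : Measurable fun a => diffPos c (f a) (g a) :=
  (measurable_diffPos c).comp (hf.prodMk hg)

lemma Measurable.diffNeg {α : Type*} [MeasurableSpace α] {f g : α → ℝ} (c : ℝ)
    (hf : Measurable f) (hg : Measurable g) : Measurable fun a => diffNeg c (f a) (g a) :=
  (measurable_diffNeg c).comp (hf.prodMk hg)

attribute [fun_prop] Measurable.diffPos Measurable.diffNeg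

lemma measurable_rieszPos (c : ℝ) :
    Measurable fun p : ℝ × EuclideanSpace ℝ (Fin n) => rieszPos c p.1 p.2 :=
  Measurable.lintegral_prod_right' (f := fun p : (ℝ × EuclideanSpace ℝ (Fin n)) × ℝ =>
    diffPos c p.2 p.1.1 * heat p.2 p.1.2) (by fun_prop)

lemma measurable_rieszNeg (c : ℝ) :
    Measurable fun p : ℝ × EuclideanSpace ℝ (Fin n) => rieszNeg c p.1 p.2 :=
  Measurable.lintegral_prod_right' (f := fun p : (ℝ × EuclideanSpace ℝ (Fin n)) × ℝ =>
    diffNeg c p.2 p.1.1 * heat p.2 p.1.2) (by fun_prop)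

/-- The defect of the Riesz kernel from being stationary under the heat flow,
`riesz c - heat t * riesz c = rieszPos - rieszNeg`, written without subtraction. -/
lemma riesz_add_rieszNeg {c t : ℝ} (ht : 0 < t) (x : EuclideanSpace ℝ (Fin n)) :
    riesz c x + rieszNeg c t x = (∫⁻ y, heat t (x - y) * riesz c y) + rieszPos c t x := by
  rw [lintegral_heat_riesz ht, riesz, rieszNeg, rieszPos, ← lintegral_add_left (by fun_prop),
    ← lintegral_add_left (by fun_prop)]
  refine lintegral_congr fun s => ?_
  rw [← add_mul, ← add_mul, pw_add_diffNeg]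

lemma lintegral_pw_mul_rieszPos (b c : ℝ) (x : EuclideanSpace ℝ (Fin n)) :
    ∫⁻ t, pw (-b - 1) t * rieszPos c t x
      = (∫⁻ t, pw (-b - 1) t * diffPos c 1 t) * riesz (c - b) x := by
  calc _ = ∫⁻ t, ∫⁻ s, pw (-b - 1) t * diffPos c s t * heat s x := by
        refine lintegral_congr fun t => ?_
        rw [rieszPos, ← lintegral_const_mul _ (by fun_prop)]
        simp_rw [mul_assoc]
    _ = ∫⁻ s, ∫⁻ t, pw (-b - 1) t * diffPos c s t * heat s x :=
        lintegral_lintegral_swap (by unfold Function.uncurry; fun_prop)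
    _ = _ := by
        rw [riesz, ← lintegral_const_mul _ (by fun_prop)]
        refine lintegral_congr fun s => ?_
        rw [lintegral_mul_const _ (by fun_prop), lintegral_pw_mul_diffPos, mul_assoc]

lemma lintegral_pw_mul_rieszNeg (b c : ℝ) (x : EuclideanSpace ℝ (Fin n)) :
    ∫⁻ t, pw (-b - 1) t * rieszNeg c t x
      = (∫⁻ t, pw (-b - 1) t * diffNeg c 1 t) * riesz (c - b) x := by
  calc _ = ∫⁻ t, ∫⁻ s, pw (-b - 1) t * diffNeg c s t * heat s x := by
        refine lintegral_congr fun t => ?_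
        rw [rieszNeg, ← lintegral_const_mul _ (by fun_prop)]
        simp_rw [mul_assoc]
    _ = ∫⁻ s, ∫⁻ t, pw (-b - 1) t * diffNeg c s t * heat s x :=
        lintegral_lintegral_swap (by unfold Function.uncurry; fun_prop)
    _ = _ := by
        rw [riesz, ← lintegral_const_mul _ (by fun_prop)]
        refine lintegral_congr fun s => ?_
        rw [lintegral_mul_const _ (by fun_prop), lintegral_pw_mul_diffNeg, mul_assoc]

/-- The ground state substitution, pointwise: with `u = g h` and `h` positive,
`|u(x) - u(y)|² + |u(x)|² h(y)/h(x) + |u(y)|² h(x)/h(y) = |g(x) - g(y)|² h(x) h(y) + |u(x)|² + |u(y)|²`.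
Here `p`, `q` are the values of `h` at `x`, `y`, which may be replaced by `κp`, `κq` in the quotients.
All terms are nonnegative, so that the identity can be integrated in `[0, ∞]`. -/
lemma ground_state_identity (a b : ℂ) {p q κ : ℝ} (hp : 0 < p) (hq : 0 < q) (hκ : 0 < κ) :
    ‖(p : ℂ) * a - q * b‖ₑ ^ 2
        + (‖(p : ℂ) * a‖ₑ ^ 2 / ENNReal.ofReal (κ * p) * ENNReal.ofReal (κ * q)
          + ‖(q : ℂ) * b‖ₑ ^ 2 / ENNReal.ofReal (κ * q) * ENNReal.ofReal (κ * p))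
      = ‖a - b‖ₑ ^ 2 * (ENNReal.ofReal p * ENNReal.ofReal q)
        + (‖(p : ℂ) * a‖ₑ ^ 2 + ‖(q : ℂ) * b‖ₑ ^ 2) := by
  simp_rw [← ofReal_norm, ← ENNReal.ofReal_pow (norm_nonneg _)]
  rw [← ENNReal.ofReal_div_of_pos (by positivity), ← ENNReal.ofReal_div_of_pos (by positivity),
    ← ENNReal.ofReal_mul (by positivity), ← ENNReal.ofReal_mul (by positivity),
    ← ENNReal.ofReal_mul (by positivity), ← ENNReal.ofReal_mul (by positivity),
    ← ENNReal.ofReal_add (by positivity) (by positivity),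
    ← ENNReal.ofReal_add (by positivity) (by positivity),
    ← ENNReal.ofReal_add (by positivity) (by positivity),
    ← ENNReal.ofReal_add (by positivity) (by positivity)]
  congr 1
  simp_rw [← Complex.normSq_eq_norm_sq, Complex.normSq_apply]
  simp only [Complex.sub_re, Complex.sub_im, Complex.mul_re, Complex.mul_im, Complex.ofReal_re,
    Complex.ofReal_im]
  field_simp
  ring

/-- Integration of the ground state identity against the heat kernel. Here `w` stands for `|u|²`,
`h` for the ground state, and `P`, `N` for the two parts of its defect from being stationary. -/
lemma lintegral_heat_identity {t : ℝ} (ht : 0 < t) {w h P N : EuclideanSpace ℝ (Fin n) → ℝ≥0∞}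
    {L G : EuclideanSpace ℝ (Fin n) → EuclideanSpace ℝ (Fin n) → ℝ≥0∞}
    (hw : Measurable w) (hh : Measurable h)
    (hL : Measurable (Function.uncurry L)) (hG : Measurable (Function.uncurry G))
    (h0 : ∀ᵐ x, h x ≠ 0) (h1 : ∀ᵐ x, h x ≠ ∞) (hfin : ∫⁻ x, w x ≠ ∞)
    (hpt : ∀ᵐ x, ∀ᵐ y, L x y + (w x / h x * h y + w y / h y * h x) = G x y + (w x + w y))
    (hPN : ∀ x, h x + N x = (∫⁻ y, heat t (x - y) * h y) + P x) :
    (∫⁻ x, ∫⁻ y, heat t (x - y) * G x y) + 2 * ∫⁻ x, w x / h x * P x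
      = (∫⁻ x, ∫⁻ y, heat t (x - y) * L x y) + 2 * ∫⁻ x, w x / h x * N x := by
  have hLx : ∀ x, Measurable (L x) := fun x => hL.comp measurable_prodMk_left
  have hGx : ∀ x, Measurable (G x) := fun x => hG.comp measurable_prodMk_left
  set Q : EuclideanSpace ℝ (Fin n) → ℝ≥0∞ := fun x => ∫⁻ y, heat t (x - y) * h y with hQ
  have hQm : Measurable Q := Measurable.lintegral_prod_right'
    (f := fun p : EuclideanSpace ℝ (Fin n) × EuclideanSpace ℝ (Fin n) =>
      heat t (p.1 - p.2) * h p.2) (by fun_prop)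
  have e1 : ∫⁻ x, w x / h x * Q x = ∫⁻ x, ∫⁻ y, heat t (x - y) * (w x / h x * h y) := by
    refine lintegral_congr fun x => ?_
    rw [hQ, ← lintegral_const_mul _ (by fun_prop)]
    refine lintegral_congr fun y => ?_
    ring
  have e2 : ∫⁻ x, w x / h x * Q x = ∫⁻ x, ∫⁻ y, heat t (x - y) * (w y / h y * h x) := by
    rw [e1, lintegral_lintegral_swap (by unfold Function.uncurry; fun_prop)]
    simp_rw [heat_sub_comm]
  have e3 : ∫⁻ x, w x = ∫⁻ x, ∫⁻ y, heat t (x - y) * w x := by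
    refine lintegral_congr fun x => ?_
    rw [lintegral_mul_const _ (by fun_prop), lintegral_heat_sub_left ht, one_mul]
  have e4 : ∫⁻ x, w x = ∫⁻ x, ∫⁻ y, heat t (x - y) * w y := by
    rw [e3, lintegral_lintegral_swap (by unfold Function.uncurry; fun_prop)]
    simp_rw [heat_sub_comm]
  have hA : (∫⁻ x, ∫⁻ y, heat t (x - y) * L x y)
        + ((∫⁻ x, w x / h x * Q x) + ∫⁻ x, w x / h x * Q x)
      = (∫⁻ x, ∫⁻ y, heat t (x - y) * G x y) + ((∫⁻ x, w x) + ∫⁻ x, w x) := by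
    calc _ = ∫⁻ x, ∫⁻ y, heat t (x - y) * (L x y + (w x / h x * h y + w y / h y * h x)) := by
          nth_rewrite 1 [e1]
          rw [e2, ← lintegral_add_left (by fun_prop), ← lintegral_add_left (by fun_prop)]
          refine lintegral_congr fun x => ?_
          rw [← lintegral_add_left (by fun_prop), ← lintegral_add_left (by fun_prop)]
          simp_rw [mul_add]
      _ = ∫⁻ x, ∫⁻ y, heat t (x - y) * (G x y + (w x + w y)) := by
          refine lintegral_congr_ae (hpt.mono fun x hx => lintegral_congr_ae (hx.mono fun y hy => ?_))
          simp only
          rw [hy]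
      _ = _ := by
          nth_rewrite 1 [e3]
          rw [e4, ← lintegral_add_left (by fun_prop), ← lintegral_add_left (by fun_prop)]
          refine lintegral_congr fun x => ?_
          rw [← lintegral_add_left (by fun_prop), ← lintegral_add_left (by fun_prop)]
          simp_rw [mul_add]
  have hB : (∫⁻ x, w x) + ∫⁻ x, w x / h x * N x
      = (∫⁻ x, w x / h x * Q x) + ∫⁻ x, w x / h x * P x := by
    rw [← lintegral_add_left (by fun_prop), ← lintegral_add_left (by fun_prop)]
    refine lintegral_congr_ae ?_
    filter_upwards [h0, h1] with x hx0 hx1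
    rw [← mul_add, ← hPN, mul_add, ENNReal.div_mul_cancel hx0 hx1]
  have h2U : (∫⁻ x, w x) + ∫⁻ x, w x ≠ ∞ := ENNReal.add_ne_top.2 ⟨hfin, hfin⟩
  rw [← ENNReal.add_left_inj h2U]
  generalize ∫⁻ x, w x = a1 at *
  generalize (∫⁻ x, w x / h x * Q x) = a2 at *
  generalize (∫⁻ x, w x / h x * P x) = a3 at *
  generalize (∫⁻ x, w x / h x * N x) = a4 at *
  generalize (∫⁻ x, ∫⁻ y, heat t (x - y) * L x y) = a5 at *
  generalize (∫⁻ x, ∫⁻ y, heat t (x - y) * G x y) = a6 at *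
  calc a6 + 2 * a3 + (a1 + a1) = (a6 + (a1 + a1)) + 2 * a3 := by ring
    _ = a5 + 2 * (a2 + a3) := by rw [← hA]; ring
    _ = a5 + 2 * a4 + (a1 + a1) := by rw [← hB]; ring

/-- `|g(x) - g(y)|² |x|^{2c-n} |y|^{2c-n}` for `g(x) = |x|^{n-2c} u(x)`. -/
noncomputable def groundDiff (c : ℝ) (u : EuclideanSpace ℝ (Fin n) → ℂ)
    (x y : EuclideanSpace ℝ (Fin n)) : ℝ≥0∞ :=
  ‖((‖x‖ ^ (n - 2 * c) : ℝ) : ℂ) * u x - ((‖y‖ ^ (n - 2 * c) : ℝ) : ℂ) * u y‖ₑ ^ 2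
    * (ENNReal.ofReal (‖x‖ ^ (2 * c - n)) * ENNReal.ofReal (‖y‖ ^ (2 * c - n)))

lemma measurable_groundDiff (c : ℝ) {u : EuclideanSpace ℝ (Fin n) → ℂ} (hu : Measurable u) :
    Measurable (Function.uncurry (groundDiff c u)) := by
  unfold groundDiff Function.uncurry
  fun_prop

/-- The ground state substitution with `h = riesz c`, a multiple of `|x|^{2c-n}`. -/
lemma groundDiff_identity {c : ℝ} (hc : c < (n : ℝ) / 2) (u : EuclideanSpace ℝ (Fin n) → ℂ)
    {x y : EuclideanSpace ℝ (Fin n)} (hx : x ≠ 0) (hy : y ≠ 0) :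
    ‖u x - u y‖ₑ ^ 2 + (‖u x‖ₑ ^ 2 / riesz c x * riesz c y + ‖u y‖ₑ ^ 2 / riesz c y * riesz c x)
      = groundDiff c u x y + (‖u x‖ₑ ^ 2 + ‖u y‖ₑ ^ 2) := by
  have hx' := norm_pos_iff.2 hx
  have hy' := norm_pos_iff.2 hy
  have hcancel : ∀ z : EuclideanSpace ℝ (Fin n), 0 < ‖z‖ →
      ((‖z‖ ^ (2 * c - n) : ℝ) : ℂ) * (((‖z‖ ^ (n - 2 * c) : ℝ) : ℂ) * u z) = u z := by
    intro z hz
    rw [← mul_assoc, ← Complex.ofReal_mul, ← Real.rpow_add hz]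
    simp
  have := ground_state_identity (((‖x‖ ^ (n - 2 * c) : ℝ) : ℂ) * u x)
    (((‖y‖ ^ (n - 2 * c) : ℝ) : ℂ) * u y) (Real.rpow_pos_of_pos hx' (2 * c - n))
    (Real.rpow_pos_of_pos hy' (2 * c - n)) (rieszConst_pos hc)
  rwa [hcancel x hx', hcancel y hy', ← riesz_eq_rieszConst hc hx, ← riesz_eq_rieszConst hc hy] at this

/-- The ground state representation at heat time `t`. -/
lemma lintegral_heat_groundDiff {c t : ℝ} (hn : 0 < n) (hc : c < (n : ℝ) / 2) (ht : 0 < t)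
    {u : EuclideanSpace ℝ (Fin n) → ℂ} (hu : Measurable u) (hu2 : ∫⁻ x, ‖u x‖ₑ ^ 2 ≠ ∞) :
    (∫⁻ x, ∫⁻ y, heat t (x - y) * groundDiff c u x y)
      + 2 * ∫⁻ x, ‖u x‖ₑ ^ 2 / riesz c x * rieszPos c t x
    = (∫⁻ x, ∫⁻ y, heat t (x - y) * ‖u x - u y‖ₑ ^ 2)
      + 2 * ∫⁻ x, ‖u x‖ₑ ^ 2 / riesz c x * rieszNeg c t x := by
  refine lintegral_heat_identity ht (w := fun x => ‖u x‖ₑ ^ 2) (L := fun x y => ‖u x - u y‖ₑ ^ 2)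
    (by fun_prop) (by fun_prop) (by unfold Function.uncurry; fun_prop)
    (measurable_groundDiff c hu) ((ae_ne_zero hn).mono fun x hx => riesz_ne_zero hc hx)
    ((ae_ne_zero hn).mono fun x hx => riesz_ne_top hc hx) hu2 ?_ (riesz_add_rieszNeg ht)
  filter_upwards [ae_ne_zero hn] with x hx
  filter_upwards [ae_ne_zero hn] with y hy
  exact groundDiff_identity hc u hx hy

/-! ### The fractional Hardy inequality with remainder -/

/-- Superposition of the heat energies on the Fourier side gives the multiplier `|ξ|^{2b}`. -/
lemma lintegral_pw_mul_energy {b : ℝ} (hb : 0 < b) (hb1 : b < 1)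
    {v : EuclideanSpace ℝ (Fin n) → ℂ} (hv : Measurable v) :
    ∫⁻ t, pw (-b - 1) t
        * ∫⁻ ξ, ENNReal.ofReal (2 * (1 - Real.exp (-(Real.pi * t * ‖ξ‖ ^ 2)))) * ‖v ξ‖ₑ ^ 2
      = ENNReal.ofReal (2 * (Real.Gamma (1 - b) / b) * Real.pi ^ b)
        * ∫⁻ ξ, ENNReal.ofReal (‖ξ‖ ^ (2 * b)) * ‖v ξ‖ₑ ^ 2 := by
  have hG := Real.Gamma_pos_of_pos (sub_pos.2 hb1)
  calc _ = ∫⁻ t, ∫⁻ ξ, pw (-b - 1) t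
        * ENNReal.ofReal (2 * (1 - Real.exp (-(Real.pi * t * ‖ξ‖ ^ 2)))) * ‖v ξ‖ₑ ^ 2 := by
        refine lintegral_congr fun t => ?_
        rw [← lintegral_const_mul _ (by fun_prop)]
        simp_rw [mul_assoc]
    _ = ∫⁻ ξ, ∫⁻ t, pw (-b - 1) t
        * ENNReal.ofReal (2 * (1 - Real.exp (-(Real.pi * t * ‖ξ‖ ^ 2)))) * ‖v ξ‖ₑ ^ 2 :=
        lintegral_lintegral_swap (by unfold Function.uncurry; fun_prop)
    _ = _ := by
        rw [← lintegral_const_mul _ (by fun_prop)]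
        refine lintegral_congr fun ξ => ?_
        rw [lintegral_mul_const _ (by fun_prop), ← mul_assoc]
        congr 1
        have h := lintegral_pw_mul_one_sub_exp hb hb1 (by positivity : 0 ≤ Real.pi * ‖ξ‖ ^ 2)
        have e : ∀ t, pw (-b - 1) t * ENNReal.ofReal (2 * (1 - Real.exp (-(Real.pi * t * ‖ξ‖ ^ 2))))
            = ENNReal.ofReal 2 * (pw (-b - 1) t * ENNReal.ofReal (1 - Real.exp (-(Real.pi * ‖ξ‖ ^ 2 * t)))) := by
          intro t
          rw [ENNReal.ofReal_mul (by norm_num), mul_left_comm]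
          congr 5; ring
        simp_rw [e]
        rw [lintegral_const_mul _ (by fun_prop), h, Real.mul_rpow Real.pi_pos.le (by positivity),
          ← Real.rpow_natCast, ← Real.rpow_mul (norm_nonneg _), ← ENNReal.ofReal_mul (by positivity),
          ← ENNReal.ofReal_mul (by positivity)]
        congr 1; push_cast; ring

lemma lintegral_pw_mul_lintegral_swap (a : ℝ) {w : EuclideanSpace ℝ (Fin n) → ℝ≥0∞}
    {R : ℝ → EuclideanSpace ℝ (Fin n) → ℝ≥0∞} (hw : Measurable w) (hR : Measurable (Function.uncurry R)) :
    ∫⁻ t, pw a t * ∫⁻ x, w x * R t x = ∫⁻ x, w x * ∫⁻ t, pw a t * R t x := by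
  calc _ = ∫⁻ t, ∫⁻ x, w x * (pw a t * R t x) := by
        refine lintegral_congr fun t => ?_
        have hRt : Measurable (R t) := hR.comp measurable_prodMk_left
        rw [← lintegral_const_mul _ (by fun_prop)]
        simp_rw [mul_left_comm]
    _ = ∫⁻ x, ∫⁻ t, w x * (pw a t * R t x) :=
        lintegral_lintegral_swap (by unfold Function.uncurry; fun_prop)
    _ = _ := by
        refine lintegral_congr fun x => ?_
        have hRx : Measurable fun t => R t x := hR.comp measurable_prodMk_right
        rw [lintegral_const_mul _ (by fun_prop)]

lemma measurable_lintegral_heat {G : EuclideanSpace ℝ (Fin n) → EuclideanSpace ℝ (Fin n) → ℝ≥0∞}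
    (hG : Measurable (Function.uncurry G)) :
    Measurable fun p : ℝ × EuclideanSpace ℝ (Fin n) => ∫⁻ y, heat p.1 (p.2 - y) * G p.2 y :=
  Measurable.lintegral_prod_right'
    (f := fun p : (ℝ × EuclideanSpace ℝ (Fin n)) × EuclideanSpace ℝ (Fin n) =>
      heat p.1.1 (p.1.2 - p.2) * G p.1.2 p.2) (by fun_prop)

/-- Superposition of the heat kernels inside a double integral gives the kernel `riesz a`; at `a = -b` it
is a multiple of `|x-y|^{-n-2b}`. -/
lemma lintegral_pw_mul_lintegral_heat (a : ℝ)
    {G : EuclideanSpace ℝ (Fin n) → EuclideanSpace ℝ (Fin n) → ℝ≥0∞}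
    (hG : Measurable (Function.uncurry G)) :
    ∫⁻ t, pw (a - 1) t * ∫⁻ x, ∫⁻ y, heat t (x - y) * G x y
      = ∫⁻ x, ∫⁻ y, riesz a (x - y) * G x y := by
  have hm := measurable_lintegral_heat hG
  have h1 := lintegral_pw_mul_lintegral_swap (a - 1) (w := fun _ => 1)
    (R := fun t x => ∫⁻ y, heat t (x - y) * G x y) measurable_const hm
  simp only [one_mul] at h1
  rw [h1]
  refine lintegral_congr fun x => ?_
  have hGx : Measurable (G x) := hG.comp measurable_prodMk_left
  have h2 := lintegral_pw_mul_lintegral_swap (a - 1) (w := G x)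
    (R := fun t y => heat t (x - y)) hGx (by unfold Function.uncurry; fun_prop)
  simp_rw [mul_comm (heat _ _), h2, riesz, mul_comm]

/-- The ground state inequality, obtained by integrating the heat-kernel identity against
`t^{-b-1} dt`. The negative half-moment is finite, so that it cancels and only the difference
`diffPos_moment` of the two remains. -/
lemma ground_state_riesz_le {b c : ℝ} (hn : 0 < n) (hb : 0 < b) (hb1 : b < 1) (hbc : b < c)
    (hc : c < (n : ℝ) / 2) {v : EuclideanSpace ℝ (Fin n) → ℂ} (hvc : Continuous v)
    (hv : Integrable v) (hv2 : ∫⁻ ξ, ‖v ξ‖ₑ ^ 2 ≠ ∞)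
    (hM : ∫⁻ x, ‖𝓕 v x‖ₑ ^ 2 / riesz c x * riesz (c - b) x ≠ ∞) :
    (∫⁻ x, ∫⁻ y, riesz (-b) (x - y) * groundDiff c (𝓕 v) x y)
      + ENNReal.ofReal (2 * (Real.Gamma (1 - b) / b * (Real.Gamma c / Real.Gamma (c - b))))
        * ∫⁻ x, ‖𝓕 v x‖ₑ ^ 2 / riesz c x * riesz (c - b) x
    ≤ ENNReal.ofReal (2 * (Real.Gamma (1 - b) / b) * Real.pi ^ b)
        * ∫⁻ ξ, ENNReal.ofReal (‖ξ‖ ^ (2 * b)) * ‖v ξ‖ₑ ^ 2 := by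
  have hum : Measurable (𝓕 v) := (continuous_fourier hv).measurable
  have hvm := hvc.measurable
  have hGm := measurable_groundDiff c hum
  have hu2 : ∫⁻ x, ‖𝓕 v x‖ₑ ^ 2 ≠ ∞ := ne_top_of_le_ne_top hv2 (lintegral_fourier_sq_le hvc hv)
  have hPm := measurable_rieszPos (n := n) c
  have hNm := measurable_rieszNeg (n := n) c
  set u := 𝓕 v with hu
  set w : EuclideanSpace ℝ (Fin n) → ℝ≥0∞ := fun x => ‖u x‖ₑ ^ 2 / riesz c x with hw
  have hwm : Measurable w := by rw [hw]; fun_prop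
  set kP := ∫⁻ t, pw (-b - 1) t * diffPos c 1 t with hkP
  set kN := ∫⁻ t, pw (-b - 1) t * diffNeg c 1 t with hkN
  set M := ∫⁻ x, w x * riesz (c - b) x with hMdef
  have hP : ∫⁻ t, pw (-b - 1) t * ∫⁻ x, w x * rieszPos c t x = kP * M := by
    rw [lintegral_pw_mul_lintegral_swap _ (R := rieszPos c) hwm hPm, hMdef, ← lintegral_const_mul _ (by fun_prop)]
    refine lintegral_congr fun x => ?_
    rw [lintegral_pw_mul_rieszPos]; ring
  have hN : ∫⁻ t, pw (-b - 1) t * ∫⁻ x, w x * rieszNeg c t x = kN * M := by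
    rw [lintegral_pw_mul_lintegral_swap _ (R := rieszNeg c) hwm hNm, hMdef, ← lintegral_const_mul _ (by fun_prop)]
    refine lintegral_congr fun x => ?_
    rw [lintegral_pw_mul_rieszNeg]; ring
  have hG := lintegral_pw_mul_lintegral_heat (-b) hGm
  have hGt : Measurable fun t => ∫⁻ x, ∫⁻ y, heat t (x - y) * groundDiff c u x y :=
    Measurable.lintegral_prod_right' (measurable_lintegral_heat hGm)
  have hEt : Measurable fun t : ℝ => ∫⁻ ξ,
      ENNReal.ofReal (2 * (1 - Real.exp (-(Real.pi * t * ‖ξ‖ ^ 2)))) * ‖v ξ‖ₑ ^ 2 :=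
    Measurable.lintegral_prod_right' (f := fun p : ℝ × EuclideanSpace ℝ (Fin n) =>
      ENNReal.ofReal (2 * (1 - Real.exp (-(Real.pi * p.1 * ‖p.2‖ ^ 2)))) * ‖v p.2‖ₑ ^ 2) (by fun_prop)
  have hle : (∫⁻ x, ∫⁻ y, riesz (-b) (x - y) * groundDiff c u x y) + 2 * (kP * M)
      ≤ ENNReal.ofReal (2 * (Real.Gamma (1 - b) / b) * Real.pi ^ b)
        * (∫⁻ ξ, ENNReal.ofReal (‖ξ‖ ^ (2 * b)) * ‖v ξ‖ₑ ^ 2) + 2 * (kN * M) := by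
    rw [← lintegral_pw_mul_energy hb hb1 hvm, ← hG, ← hP, ← hN,
      ← lintegral_const_mul' _ _ (by simp), ← lintegral_const_mul' _ _ (by simp),
      ← lintegral_add_left (by fun_prop), ← lintegral_add_left (by fun_prop)]
    refine lintegral_mono fun t => ?_
    by_cases ht : 0 < t
    · simp only
      rw [mul_left_comm 2, mul_left_comm 2, ← mul_add, ← mul_add,
        lintegral_heat_groundDiff hn hc ht hum hu2]
      exact mul_le_mul' le_rfl (add_le_add (lintegral_heat_energy_le hvc hv ht) le_rfl)
    · simp [pw, ht]
  have hkN' : kN ≠ ∞ := diffNeg_moment_ne_top hb hb1 hbc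
  have hkP' := diffPos_moment hb hb1 hbc
  rw [← hkP, ← hkN] at hkP'
  have hfin : 2 * (kN * M) ≠ ∞ := ENNReal.mul_ne_top (by simp) (ENNReal.mul_ne_top hkN' hM)
  rw [← ENNReal.add_le_add_iff_right hfin]
  refine le_trans (le_of_eq ?_) hle
  rw [hkP', ENNReal.ofReal_mul (by norm_num : (0:ℝ) ≤ 2), ENNReal.ofReal_ofNat]
  ring

/-- The integrand of the weighted Besov norm as a `groundDiff` with `c = (n+β)/4`, for which
`n - 2c = (n-β)/2`. -/
lemma ofReal_besovIntegrand (β : ℝ) (u : EuclideanSpace ℝ (Fin n) → ℂ)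
    (x y : EuclideanSpace ℝ (Fin n)) :
    ENNReal.ofReal (besovIntegrand β (fun x => ((‖x‖ ^ ((n - β) / 2) : ℝ) : ℂ) * u x) (x, y))
      = ENNReal.ofReal (‖x - y‖ ^ (-(n + β))) * groundDiff ((n + β) / 4) u x y := by
  rw [besovIntegrand, groundDiff, show (n : ℝ) - 2 * ((n + β) / 4) = (n - β) / 2 by ring,
    show 2 * ((n + β) / 4) - (n : ℝ) = -((n - β) / 2) by ring]
  simp only
  rw [← ofReal_norm, ← ENNReal.ofReal_pow (norm_nonneg _), ← ENNReal.ofReal_mul (by positivity),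
    ← ENNReal.ofReal_mul (by positivity), ← ENNReal.ofReal_mul (by positivity),
    Real.rpow_neg (norm_nonneg (x - y))]
  congr 1
  rw [div_eq_mul_inv]; ring

lemma pittConst_pos {α : ℝ} (hα : -n < α) (hαn : α < n) : 0 < pittConst n α := by
  have := Real.Gamma_pos_of_pos (by linarith : 0 < ((n : ℝ) - α) / 4)
  have := Real.Gamma_pos_of_pos (by linarith : 0 < ((n : ℝ) + α) / 4)
  unfold pittConst; positivity

lemma besovConst_pos {β : ℝ} (hβ : 0 < β) (hβ2 : β < 2) : 0 < besovConst n β := by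
  have := Real.Gamma_pos_of_pos (by linarith : 0 < 1 - β / 2)
  have := Real.Gamma_pos_of_pos (by positivity : 0 < ((n : ℝ) + β) / 2)
  unfold besovConst; positivity

/-- The case `α = β`: the sharp fractional Hardy inequality with its Besov remainder, for `u = 𝓕 v`. -/
lemma hardy_besov_le {β : ℝ} (hβ : 0 < β) (hβ2 : β < 2) (hβn : β < n)
    {v : EuclideanSpace ℝ (Fin n) → ℂ} (hvc : Continuous v)
    (hv : Integrable v) (hv2 : ∫⁻ ξ, ‖v ξ‖ₑ ^ 2 ≠ ∞)
    (hM : ∫⁻ x, ENNReal.ofReal (‖x‖ ^ (-β)) * ‖𝓕 v x‖ₑ ^ 2 ≠ ∞) :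
    ENNReal.ofReal (1 / besovConst n β) * (∫⁻ x, ∫⁻ y, ENNReal.ofReal
        (besovIntegrand β (fun x => ((‖x‖ ^ ((n - β) / 2) : ℝ) : ℂ) * 𝓕 v x) (x, y)))
      + ENNReal.ofReal (1 / pittConst n β) * ∫⁻ x, ENNReal.ofReal (‖x‖ ^ (-β)) * ‖𝓕 v x‖ₑ ^ 2
    ≤ ∫⁻ ξ, ENNReal.ofReal (‖ξ‖ ^ β) * ‖v ξ‖ₑ ^ 2 := by
  have hn : 0 < n := by
    have : (0 : ℝ) < n := by linarith
    exact_mod_cast this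
  have hum : Measurable (𝓕 v) := (continuous_fourier hv).measurable
  set b := β / 2 with hb
  set c := ((n : ℝ) + β) / 4 with hc
  have hb0 : 0 < b := by rw [hb]; positivity
  have hb1 : b < 1 := by rw [hb]; linarith
  have hbc : b < c := by rw [hb, hc]; linarith
  have hcn : c < (n : ℝ) / 2 := by rw [hc]; linarith
  have hcbn : c - b < (n : ℝ) / 2 := by linarith
  have hr1 := rieszConst_pos hcn
  have hr2 := rieszConst_pos hcbn
  have hr3 : 0 < rieszConst n (-b) := rieszConst_pos (by linarith)
  have g1 := Real.Gamma_pos_of_pos (by linarith : 0 < 1 - b)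
  have g2 := Real.Gamma_pos_of_pos (by linarith : 0 < c)
  have g3 := Real.Gamma_pos_of_pos (by linarith : 0 < c - b)
  have g4 := Real.Gamma_pos_of_pos (by positivity : 0 < ((n : ℝ) + β) / 2)
  set M := ∫⁻ x, ENNReal.ofReal (‖x‖ ^ (-β)) * ‖𝓕 v x‖ₑ ^ 2 with hMdef
  have hMeq : ∫⁻ x, ‖𝓕 v x‖ₑ ^ 2 / riesz c x * riesz (c - b) x
      = ENNReal.ofReal (rieszConst n (c - b) / rieszConst n c) * M := by
    rw [hMdef, ← lintegral_const_mul _ (by fun_prop)]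
    refine lintegral_congr_ae ((ae_ne_zero hn).mono fun x hx => ?_)
    simp only
    have h := rpow_mul_riesz hcn hcbn hx
    rw [show 2 * (c - b - c) = -β by rw [hb]; ring] at h
    have h1 : ENNReal.ofReal (rieszConst n (c - b) / rieszConst n c)
        * ENNReal.ofReal (rieszConst n c / rieszConst n (c - b)) = 1 := by
      rw [← ENNReal.ofReal_mul (by positivity)]
      rw [div_mul_div_cancel₀ hr1.ne', div_self hr2.ne', ENNReal.ofReal_one]
    calc _ = ‖𝓕 v x‖ₑ ^ 2 / riesz c x * (ENNReal.ofReal (rieszConst n (c - b) / rieszConst n c)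
          * ENNReal.ofReal (rieszConst n c / rieszConst n (c - b)) * riesz (c - b) x) := by
          rw [h1, one_mul]
      _ = ENNReal.ofReal (rieszConst n (c - b) / rieszConst n c) * (ENNReal.ofReal (‖x‖ ^ (-β))
          * (‖𝓕 v x‖ₑ ^ 2 / riesz c x * riesz c x)) := by rw [mul_assoc, ← h]; ring
      _ = _ := by rw [ENNReal.div_mul_cancel (riesz_ne_zero hcn hx) (riesz_ne_top hcn hx)]
  have hBeq : ∫⁻ x, ∫⁻ y, riesz (-b) (x - y) * groundDiff c (𝓕 v) x y
      = ENNReal.ofReal (rieszConst n (-b)) * ∫⁻ x, ∫⁻ y, ENNReal.ofReal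
        (besovIntegrand β (fun x => ((‖x‖ ^ ((n - β) / 2) : ℝ) : ℂ) * 𝓕 v x) (x, y)) := by
    rw [← lintegral_const_mul' _ _ (by simp)]
    refine lintegral_congr fun x => ?_
    rw [← lintegral_const_mul' _ _ (by simp)]
    have hxy : ∀ᵐ y : EuclideanSpace ℝ (Fin n), y ≠ x := by
      have : Nonempty (Fin n) := ⟨⟨0, hn⟩⟩
      exact Measure.ae_ne volume x
    refine lintegral_congr_ae (hxy.mono fun y hy => ?_)
    simp only
    rw [ofReal_besovIntegrand, ← hc, riesz_eq_rieszConst (by linarith) (sub_ne_zero.2 hy.symm),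
      ENNReal.ofReal_mul hr3.le, mul_assoc, show 2 * -b - (n : ℝ) = -(n + β) by rw [hb]; ring]
  have key := ground_state_riesz_le hn hb0 hb1 hbc hcn hvc hv hv2
    (by rw [hMeq]; exact ENNReal.mul_ne_top (by simp) hM)
  rw [hMeq, hBeq, show 2 * b = β by rw [hb]; ring] at key
  set E := 2 * (Real.Gamma (1 - b) / b) * Real.pi ^ b with hE
  have hE0 : 0 < E := by positivity
  have key2 := mul_le_mul_right key (ENNReal.ofReal E⁻¹)
  rw [← mul_assoc (ENNReal.ofReal E⁻¹) (ENNReal.ofReal E), ← ENNReal.ofReal_mul (by positivity),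
    inv_mul_cancel₀ hE0.ne', ENNReal.ofReal_one, one_mul, mul_add, ← mul_assoc, ← mul_assoc, ← mul_assoc,
    ← ENNReal.ofReal_mul (by positivity), ← ENNReal.ofReal_mul (by positivity),
    ← ENNReal.ofReal_mul (by positivity)] at key2
  have p1 : ∀ r : ℝ, Real.pi ^ r ≠ 0 := fun r => (Real.rpow_pos_of_pos Real.pi_pos r).ne'
  have c1 : E⁻¹ * rieszConst n (-b) = 1 / besovConst n β := by
    have hpi : Real.pi ^ ((n : ℝ) / 2 + β) = Real.pi ^ b / Real.pi ^ (-b - (n : ℝ) / 2) := by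
      rw [← Real.rpow_sub Real.pi_pos]; congr 1; rw [hb]; ring
    rw [hE, rieszConst, besovConst, show (n : ℝ) / 2 - -b = (n + β) / 2 by rw [hb]; ring, ← hb, hpi]
    have := p1 b
    have := p1 (-b - (n : ℝ) / 2)
    have e : 4 / β = 2 / b := by rw [hb]; field_simp; norm_num
    rw [e]
    field_simp
  have c2 : E⁻¹ * (2 * (Real.Gamma (1 - b) / b * (Real.Gamma c / Real.Gamma (c - b))))
      * (rieszConst n (c - b) / rieszConst n c) = 1 / pittConst n β := by
    have hpi : Real.pi ^ β = Real.pi ^ b * Real.pi ^ (c - (n : ℝ) / 2)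
        / Real.pi ^ (c - b - (n : ℝ) / 2) := by
      rw [← Real.rpow_add Real.pi_pos, ← Real.rpow_sub Real.pi_pos]; congr 1; rw [hb]; ring
    rw [hE, rieszConst, rieszConst, pittConst, show (n : ℝ) / 2 - (c - b) = c by rw [hb, hc]; ring,
      show (n : ℝ) / 2 - c = c - b by rw [hb, hc]; ring,
      show ((n : ℝ) - β) / 4 = c - b by rw [hb, hc]; ring, ← hc, hpi]
    have := p1 b
    have := p1 (c - (n : ℝ) / 2)
    have := p1 (c - b - (n : ℝ) / 2)
    field_simp
  rwa [c1, c2] at key2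

/-! ### Pitt's inequality for Schwartz functions -/

lemma hat_eq_coe (f : 𝓢(EuclideanSpace ℝ (Fin n), ℂ)) :
    hat (⇑f) = ⇑(𝓕⁻ f : 𝓢(EuclideanSpace ℝ (Fin n), ℂ)) := by
  rw [hat, SchwartzMap.fourierInv_coe]

lemma fourier_hat (f : 𝓢(EuclideanSpace ℝ (Fin n), ℂ)) : 𝓕 (hat (⇑f)) = ⇑f := by
  rw [hat_eq_coe, ← SchwartzMap.fourier_coe, FourierTransform.fourier_fourierInv_eq]

lemma exists_norm_le (f : 𝓢(EuclideanSpace ℝ (Fin n), ℂ)) : ∃ C : ℝ, 0 ≤ C ∧ ∀ x, ‖f x‖ ≤ C := by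
  obtain ⟨C, hC⟩ := f.decay 0 0
  exact ⟨C, hC.1.le, fun x => by simpa using hC.2 x⟩

/-- The Fourier-side density `|ξ|^{2s} f̂(ξ)` of `fracLaplacian s f`. -/
noncomputable def symbol (s : ℝ) (f : 𝓢(EuclideanSpace ℝ (Fin n), ℂ)) :
    EuclideanSpace ℝ (Fin n) → ℂ :=
  fun ξ => ((‖ξ‖ ^ (2 * s) : ℝ) : ℂ) * hat (⇑f) ξ

lemma fracLaplacian_eq (s : ℝ) (f : 𝓢(EuclideanSpace ℝ (Fin n), ℂ)) :
    fracLaplacian s (⇑f) = 𝓕 (symbol s f) := rfl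

lemma continuous_hat (f : 𝓢(EuclideanSpace ℝ (Fin n), ℂ)) : Continuous (hat (⇑f)) := by
  rw [hat_eq_coe]; exact SchwartzMap.continuous _

lemma integrable_hat (f : 𝓢(EuclideanSpace ℝ (Fin n), ℂ)) : Integrable (hat (⇑f)) := by
  rw [hat_eq_coe]; exact SchwartzMap.integrable _

lemma continuous_symbol {s : ℝ} (hs : 0 ≤ s) (f : 𝓢(EuclideanSpace ℝ (Fin n), ℂ)) :
    Continuous (symbol s f) := by
  have : Continuous fun ξ : EuclideanSpace ℝ (Fin n) => ‖ξ‖ ^ (2 * s) :=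
    continuous_norm.rpow_const fun _ => Or.inr (by positivity)
  exact (Complex.continuous_ofReal.comp this).mul (continuous_hat f)

lemma integrable_symbol {s : ℝ} (hs : 0 ≤ s) (f : 𝓢(EuclideanSpace ℝ (Fin n), ℂ)) :
    Integrable (symbol s f) := integrable_fracLaplacian_symbol hs f

lemma integrable_rpow_mul_hat_sq {r : ℝ} (hr : 0 ≤ r) (f : 𝓢(EuclideanSpace ℝ (Fin n), ℂ)) :
    Integrable fun ξ : EuclideanSpace ℝ (Fin n) => ‖ξ‖ ^ r * ‖hat (⇑f) ξ‖ ^ 2 := by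
  have h := (integrable_symbol (by positivity : 0 ≤ r / 2) f).norm
  obtain ⟨C, -, hC⟩ := exists_norm_le (𝓕⁻ f)
  rw [← hat_eq_coe] at hC
  have h2 := h.mul_bdd (c := C) (continuous_hat f).norm.aestronglyMeasurable
    (Filter.Eventually.of_forall fun x => by simpa using hC x)
  refine h2.congr (Filter.Eventually.of_forall fun ξ => ?_)
  simp only [symbol]
  rw [norm_mul, Complex.norm_real, Real.norm_of_nonneg (by positivity),
    show 2 * (r / 2) = r by ring]
  ring

/-- `|x|^{-β} |w|²` is integrable for bounded `w ∈ L²`, since `|x|^{-β}` is integrable near the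
origin and bounded away from it. -/
lemma integrable_rpow_neg_mul_sq {β C : ℝ} (hβ : 0 < β) (hβn : β < n)
    {w : EuclideanSpace ℝ (Fin n) → ℂ} (hw : Continuous w) (hC : ∀ x, ‖w x‖ ≤ C)
    (hw2 : Integrable fun x => ‖w x‖ ^ 2) :
    Integrable fun x : EuclideanSpace ℝ (Fin n) => ‖x‖ ^ (-β) * ‖w x‖ ^ 2 := by
  have hn : (1 : ℕ) ≤ n := by
    have : (0 : ℝ) < n := by linarith
    exact_mod_cast this
  have hm : AEStronglyMeasurable (fun x : EuclideanSpace ℝ (Fin n) => ‖x‖ ^ (-β) * ‖w x‖ ^ 2) volume := by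
    have := hw.measurable
    exact Measurable.aestronglyMeasurable (by fun_prop)
  rw [← integrableOn_univ, ← Set.union_compl_self (Metric.ball (0 : EuclideanSpace ℝ (Fin n)) 1)]
  refine IntegrableOn.union ?_ ?_
  · refine integrableOn_ball_of_norm_le_rpow (C := C ^ 2) (α := β) (by simpa using hn)
      (by simpa using hβn) (Filter.Eventually.of_forall fun x => ?_) hm
    rw [Real.norm_of_nonneg (by positivity), mul_comm]
    gcongr
    exact hC x
  · refine hw2.integrableOn.mono' hm.restrict ?_
    filter_upwards [ae_restrict_mem measurableSet_ball.compl] with x hx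
    have hx : 1 ≤ ‖x‖ := by simpa using hx
    rw [Real.norm_of_nonneg (by positivity)]
    exact mul_le_of_le_one_left (by positivity) (Real.rpow_le_one_of_one_le_of_nonpos hx (by linarith))

lemma ofReal_integral_rpow_mul_sq {r : ℝ} {w : EuclideanSpace ℝ (Fin n) → ℂ}
    (h : Integrable fun x : EuclideanSpace ℝ (Fin n) => ‖x‖ ^ r * ‖w x‖ ^ 2) :
    ENNReal.ofReal (∫ x : EuclideanSpace ℝ (Fin n), ‖x‖ ^ r * ‖w x‖ ^ 2)
      = ∫⁻ x, ENNReal.ofReal (‖x‖ ^ r) * ‖w x‖ₑ ^ 2 := by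
  rw [ofReal_integral_eq_lintegral_ofReal h (Filter.Eventually.of_forall fun x => by positivity)]
  refine lintegral_congr fun x => ?_
  rw [ENNReal.ofReal_mul (by positivity), ENNReal.ofReal_pow (norm_nonneg _), ofReal_norm]

lemma integrable_sq (f : 𝓢(EuclideanSpace ℝ (Fin n), ℂ)) : Integrable fun x => ‖f x‖ ^ 2 := by
  obtain ⟨C, -, hC⟩ := exists_norm_le f
  have := (f.integrable (μ := volume)).norm.mul_bdd (c := C) f.continuous.norm.aestronglyMeasurable
    (Filter.Eventually.of_forall fun x => by simpa using hC x)
  simpa only [sq] using this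

lemma lintegral_symbol_sq_ne_top {s : ℝ} (hs : 0 ≤ s) (f : 𝓢(EuclideanSpace ℝ (Fin n), ℂ)) :
    ∫⁻ ξ, ‖symbol s f ξ‖ₑ ^ 2 ≠ ∞ := by
  have h := integrable_rpow_mul_hat_sq (by positivity : 0 ≤ 4 * s) f
  refine ne_of_eq_of_ne (lintegral_congr fun ξ => ?_) h.lintegral_lt_top.ne
  rw [← ofReal_norm, ← ENNReal.ofReal_pow (norm_nonneg _), symbol, norm_mul, mul_pow, Complex.norm_real,
    Real.norm_of_nonneg (by positivity), ← Real.rpow_natCast, ← Real.rpow_mul (norm_nonneg _)]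
  congr 3; push_cast; ring

lemma integrable_fracLaplacian_sq {s : ℝ} (hs : 0 ≤ s) (f : 𝓢(EuclideanSpace ℝ (Fin n), ℂ)) :
    Integrable fun x => ‖fracLaplacian s (⇑f) x‖ ^ 2 := by
  have hc : Continuous (fracLaplacian s (⇑f)) := continuous_fourier (integrable_symbol hs f)
  refine ⟨(hc.norm.pow 2).aestronglyMeasurable, ?_⟩
  have := (lintegral_fourier_sq_le (continuous_symbol hs f) (integrable_symbol hs f)).trans_lt
    (lintegral_symbol_sq_ne_top hs f).lt_top
  refine lt_of_eq_of_lt (lintegral_congr fun x => ?_) this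
  rw [enorm_pow, enorm_norm, fracLaplacian_eq]

lemma integrable_weightedMass {α β : ℝ} (hβ : 0 < β) (hβα : β ≤ α) (hαn : α < n)
    (f : 𝓢(EuclideanSpace ℝ (Fin n), ℂ)) :
    Integrable fun x : EuclideanSpace ℝ (Fin n) => ‖x‖ ^ (-α) * ‖f x‖ ^ 2 := by
  obtain ⟨C, -, hC⟩ := exists_norm_le f
  exact integrable_rpow_neg_mul_sq (hβ.trans_le hβα) hαn f.continuous hC (integrable_sq f)

lemma integrable_weighted_fracLaplacian {α β : ℝ} (hβ : 0 < β) (hβα : β ≤ α) (hαn : α < n)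
    (f : 𝓢(EuclideanSpace ℝ (Fin n), ℂ)) :
    Integrable fun x : EuclideanSpace ℝ (Fin n) =>
      ‖x‖ ^ (-β) * ‖fracLaplacian ((α - β) / 4) (⇑f) x‖ ^ 2 := by
  have hs : 0 ≤ (α - β) / 4 := by linarith
  exact integrable_rpow_neg_mul_sq hβ (hβα.trans_lt hαn) (continuous_fourier (integrable_symbol hs f))
    (norm_fourier_le (symbol _ f)) (integrable_fracLaplacian_sq hs f)

/-- The Stein–Weiss step: `f` is the Riesz potential of `(-Δ/4π²)^{(α-β)/4} f`. -/
lemma weightedMass_le_fracLaplacian {α β : ℝ} (hβ : 0 < β) (hβα : β ≤ α) (hαn : α < n)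
    (f : 𝓢(EuclideanSpace ℝ (Fin n), ℂ)) :
    ENNReal.ofReal (weightedMass α (⇑f)) ≤ ENNReal.ofReal (pittConst n α / pittConst n β)
      * ∫⁻ x, ENNReal.ofReal (‖x‖ ^ (-β)) * ‖fracLaplacian ((α - β) / 4) (⇑f) x‖ₑ ^ 2 := by
  have hn : 0 < n := by
    have : (0 : ℝ) < n := by linarith
    exact_mod_cast this
  rw [weightedMass, ofReal_integral_rpow_mul_sq (integrable_weightedMass hβ hβα hαn f),
    fracLaplacian_eq]
  rcases hβα.eq_or_lt with rfl | hlt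
  · have : symbol ((β - β) / 4) f = hat (⇑f) := by
      ext ξ; simp [symbol]
    rw [this, fourier_hat, div_self (pittConst_pos (by linarith) hαn).ne', ENNReal.ofReal_one, one_mul]
  · set a := (α - β) / 4 with ha
    have ha0 : 0 < a := by rw [ha]; linarith
    have hG := Real.Gamma_pos_of_pos ha0
    have hK : 0 < Real.Gamma a * Real.pi ^ (-a) := by positivity
    have hrep := enorm_fourier_le_riesz_potential ha0 hn (continuous_hat f) (integrable_hat f)
      (integrable_symbol ha0.le f)
    rw [fourier_hat] at hrep
    have hU : Measurable fun y => ‖𝓕 (symbol a f) y‖ₑ :=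
      (continuous_fourier (integrable_symbol ha0.le f)).measurable.enorm
    have hsw := lintegral_riesz_potential_le hβ hlt hαn hU
    rw [← ha, ENNReal.ofReal_mul (by positivity), mul_assoc] at hsw
    set c := ENNReal.ofReal ((Real.Gamma a * Real.pi ^ (-a)) ^ 2) with hc
    have hc0 : c ≠ 0 := by
      rw [hc]; simp only [ne_eq, ENNReal.ofReal_eq_zero, not_le]; positivity
    refine (ENNReal.mul_le_mul_iff_right hc0 (by simp [hc])).1 (le_trans ?_ hsw)
    rw [← lintegral_const_mul' _ _ (by simp [hc])]
    refine lintegral_mono fun x => ?_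
    rw [mul_left_comm]
    gcongr
    rw [hc, ENNReal.ofReal_pow hK.le, ← mul_pow]
    gcongr
    exact hrep x

/-- The energy of order `β` of `(-Δ/4π²)^{(α-β)/4} f` is the energy of order `α` of `f`. -/
lemma lintegral_symbol_eq_freqEnergy {α β : ℝ} (hβ : 0 < β) (hβα : β ≤ α)
    (f : 𝓢(EuclideanSpace ℝ (Fin n), ℂ)) :
    ∫⁻ ξ, ENNReal.ofReal (‖ξ‖ ^ β) * ‖symbol ((α - β) / 4) f ξ‖ₑ ^ 2
      = ENNReal.ofReal (freqEnergy α (⇑f)) := by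
  have hα : 0 < α := hβ.trans_le hβα
  rw [freqEnergy, ofReal_integral_rpow_mul_sq (integrable_rpow_mul_hat_sq hα.le f)]
  refine lintegral_congr fun ξ => ?_
  rw [symbol, enorm_mul, mul_pow, ← mul_assoc, ← ofReal_norm (Complex.ofReal _), Complex.norm_real,
    Real.norm_of_nonneg (by positivity), ← ENNReal.ofReal_pow (by positivity),
    ← ENNReal.ofReal_mul (by positivity), ← Real.rpow_natCast, ← Real.rpow_mul (norm_nonneg _)]
  congr 2
  rcases (norm_nonneg ξ).eq_or_lt with h0 | h0
  · rw [← h0, Real.zero_rpow hβ.ne', Real.zero_rpow hα.ne', zero_mul]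
  · rw [← Real.rpow_add h0]; congr 1; push_cast; ring

/-- `hardy_besov_le` for `(-Δ/4π²)^{(α-β)/4} f`, followed by the Stein–Weiss step. Stated with lower
integrals, it also gives the finiteness of the Besov term. -/
lemma pitt_besov_lintegral {α β : ℝ} (hβ : 0 < β) (hβα : β ≤ α) (hαn : α < n)
    (hβ2 : β < 2) (f : 𝓢(EuclideanSpace ℝ (Fin n), ℂ)) :
    ENNReal.ofReal (pittConst n α / besovConst n β) * (∫⁻ p, ENNReal.ofReal
        (besovIntegrand β (groundState α β (⇑f)) p)) + ENNReal.ofReal (weightedMass α (⇑f))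
      ≤ ENNReal.ofReal (pittConst n α * freqEnergy α (⇑f)) := by
  have hs : 0 ≤ (α - β) / 4 := by linarith
  have hCα := pittConst_pos (n := n) (α := α) (by linarith) hαn
  have hM := (integrable_weighted_fracLaplacian hβ hβα hαn f)
  have hMtop : ∫⁻ x, ENNReal.ofReal (‖x‖ ^ (-β)) * ‖𝓕 (symbol ((α - β) / 4) f) x‖ₑ ^ 2 ≠ ∞ := by
    rw [← fracLaplacian_eq, ← ofReal_integral_rpow_mul_sq hM]; simp
  have key := hardy_besov_le hβ hβ2 (hβα.trans_lt hαn) (continuous_symbol hs f)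
    (integrable_symbol hs f) (lintegral_symbol_sq_ne_top hs f) hMtop
  rw [lintegral_symbol_eq_freqEnergy hβ hβα] at key
  have hum : Measurable (𝓕 (symbol ((α - β) / 4) f)) :=
    (continuous_fourier (integrable_symbol hs f)).measurable
  have hprod : ∫⁻ p, ENNReal.ofReal (besovIntegrand β (groundState α β (⇑f)) p)
      = ∫⁻ x, ∫⁻ y, ENNReal.ofReal (besovIntegrand β
        (fun x => ((‖x‖ ^ ((n - β) / 2) : ℝ) : ℂ) * 𝓕 (symbol ((α - β) / 4) f) x) (x, y)) := by
    rw [Measure.volume_eq_prod, lintegral_prod]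
    · rfl
    · unfold besovIntegrand groundState
      rw [fracLaplacian_eq]
      exact Measurable.aemeasurable (by fun_prop)
  rw [ENNReal.ofReal_mul hCα.le, hprod]
  refine le_trans ?_ (mul_le_mul' le_rfl key)
  rw [mul_add, ← mul_assoc, ← mul_assoc, ← ENNReal.ofReal_mul hCα.le, ← ENNReal.ofReal_mul hCα.le,
    mul_one_div, mul_one_div]
  exact add_le_add le_rfl (weightedMass_le_fracLaplacian hβ hβα hαn f)

lemma besovIntegrand_nonneg (β : ℝ) (g : EuclideanSpace ℝ (Fin n) → ℂ)
    (p : EuclideanSpace ℝ (Fin n) × EuclideanSpace ℝ (Fin n)) : 0 ≤ besovIntegrand β g p := by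
  unfold besovIntegrand; positivity

lemma integrable_besovIntegrand {α β : ℝ} (hβ : 0 < β) (hβα : β ≤ α) (hαn : α < n)
    (hβ2 : β < 2) (f : 𝓢(EuclideanSpace ℝ (Fin n), ℂ)) :
    Integrable (besovIntegrand β (groundState α β (⇑f))) := by
  have hs : 0 ≤ (α - β) / 4 := by linarith
  have hCα := pittConst_pos (n := n) (α := α) (by linarith) hαn
  have hD := besovConst_pos (n := n) hβ hβ2
  have hum : Measurable (𝓕 (symbol ((α - β) / 4) f)) :=
    (continuous_fourier (integrable_symbol hs f)).measurable
  have hm : Measurable (besovIntegrand β (groundState α β (⇑f))) := by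
    unfold besovIntegrand groundState
    rw [fracLaplacian_eq]
    fun_prop
  have h := (le_self_add.trans (pitt_besov_lintegral hβ hβα hαn hβ2 f)).trans_lt ENNReal.ofReal_lt_top
  refine ⟨hm.aestronglyMeasurable, ?_⟩
  have h' := ENNReal.lt_top_of_mul_ne_top_right h.ne (by
    simp only [ne_eq, ENNReal.ofReal_eq_zero, not_le]; positivity)
  refine lt_of_eq_of_lt (lintegral_congr fun p => ?_) h'
  rw [← ofReal_norm, Real.norm_of_nonneg (besovIntegrand_nonneg β _ p)]

theorem pitt_besov {α β : ℝ} (hβ : 0 < β) (hβα : β ≤ α) (hαn : α < n)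
    (hβ2 : β < 2) (f : 𝓢(EuclideanSpace ℝ (Fin n), ℂ)) :
    weightedMass α (⇑f) + pittConst n α / besovConst n β *
        ∫ p : EuclideanSpace ℝ (Fin n) × EuclideanSpace ℝ (Fin n),
          besovIntegrand β (groundState α β (⇑f)) p ≤ pittConst n α * freqEnergy α (⇑f) := by
  have hCα := pittConst_pos (n := n) (α := α) (by linarith) hαn
  have hD := besovConst_pos (n := n) hβ hβ2
  have hi := integrable_besovIntegrand hβ hβα hαn hβ2 f
  have hnn := besovIntegrand_nonneg β (groundState α β (⇑f))
  have h := pitt_besov_lintegral hβ hβα hαn hβ2 f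
  have hW : 0 ≤ weightedMass α (⇑f) := integral_nonneg fun x => by positivity
  have hF : 0 ≤ freqEnergy α (⇑f) := integral_nonneg fun x => by positivity
  have hB := integral_nonneg (μ := volume) (f := besovIntegrand β (groundState α β (⇑f))) hnn
  rw [← ofReal_integral_eq_lintegral_ofReal hi (Filter.Eventually.of_forall hnn),
    ← ENNReal.ofReal_mul (by positivity), ← ENNReal.ofReal_add (by positivity) hW,
    ENNReal.ofReal_le_ofReal_iff (by positivity)] at h
  linarith

/-- Equality would make the Besov term vanish, so that `g` is constant; as `g` is continuous with
`g(0) = 0`, it vanishes identically, and so does `f`. -/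
theorem weightedMass_lt {α β : ℝ} (hβ : 0 < β) (hβα : β ≤ α) (hαn : α < n)
    (hβ2 : β < 2) (f : 𝓢(EuclideanSpace ℝ (Fin n), ℂ)) (hf : f ≠ 0) :
    weightedMass α (⇑f) < pittConst n α * freqEnergy α (⇑f) := by
  by_contra! hcon
  have hn : 0 < n := by
    have : (0 : ℝ) < n := by linarith
    exact_mod_cast this
  have : Nonempty (Fin n) := ⟨⟨0, hn⟩⟩
  have hs : 0 ≤ (α - β) / 4 := by linarith
  have hCα := pittConst_pos (n := n) (α := α) (by linarith) hαn
  have hCβ := pittConst_pos (n := n) (α := β) (by linarith) (hβα.trans_lt hαn)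
  have hD := besovConst_pos (n := n) hβ hβ2
  have hi := integrable_besovIntegrand hβ hβα hαn hβ2 f
  have hnn := besovIntegrand_nonneg β (groundState α β (⇑f))
  have hineq := pitt_besov hβ hβα hαn hβ2 f
  have hB0 : ∫ p, besovIntegrand β (groundState α β (⇑f)) p = 0 := by
    refine le_antisymm ?_ (integral_nonneg hnn)
    have : pittConst n α / besovConst n β * ∫ p, besovIntegrand β (groundState α β (⇑f)) p ≤ 0 := by
      linarith
    by_contra! hpos
    have : 0 < pittConst n α / besovConst n β * ∫ p, besovIntegrand β (groundState α β (⇑f)) p := by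
      positivity
    linarith
  rw [integral_eq_zero_iff_of_nonneg hnn hi] at hB0
  have hae := Measure.ae_ae_of_ae_prod hB0
  obtain ⟨x, hx, hx0⟩ := (hae.and (ae_ne_zero hn)).exists
  have hx' := norm_pos_iff.2 hx0
  set g := groundState α β (⇑f) with hg
  have huc : Continuous (fracLaplacian ((α - β) / 4) (⇑f)) :=
    continuous_fourier (integrable_symbol hs f)
  have hpos : 0 < ((n : ℝ) - β) / 2 := by linarith
  have hgc : Continuous g := by
    have : Continuous fun x : EuclideanSpace ℝ (Fin n) => ‖x‖ ^ (((n : ℝ) - β) / 2) :=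
      continuous_norm.rpow_const fun _ => Or.inr hpos.le
    exact (Complex.continuous_ofReal.comp this).mul huc
  have hgconst : g =ᵐ[volume] fun _ => g x := by
    filter_upwards [hx, ae_ne_zero hn, Measure.ae_ne volume x] with y hy hy0 hyx
    have hy' := norm_pos_iff.2 hy0
    have hxy : 0 < ‖x - y‖ := norm_pos_iff.2 (sub_ne_zero.2 hyx.symm)
    have p1 := Real.rpow_pos_of_pos hx' (-(((n : ℝ) - β) / 2))
    have p2 := Real.rpow_pos_of_pos hy' (-(((n : ℝ) - β) / 2))
    have p3 := Real.rpow_pos_of_pos hxy ((n : ℝ) + β)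
    simp only [besovIntegrand, Pi.zero_apply, mul_eq_zero, p1.ne', p2.ne', or_false,
      div_eq_zero_iff, p3.ne', ne_eq, OfNat.ofNat_ne_zero, not_false_eq_true, pow_eq_zero_iff,
      norm_eq_zero, sub_eq_zero] at hy
    exact hy.symm
  have hgall : g = fun _ => g x := (hgc.ae_eq_iff_eq volume continuous_const).1 hgconst
  have hg0 : g 0 = 0 := by
    simp [hg, groundState, Real.zero_rpow hpos.ne']
  have hgzero : ∀ y, g y = 0 := by
    intro y
    rw [congrFun hgall y, ← hg0]; exact (congrFun hgall 0).symm
  have hu0 : ∀ᵐ y, fracLaplacian ((α - β) / 4) (⇑f) y = 0 := by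
    filter_upwards [ae_ne_zero hn] with y hy0
    have hy' := norm_pos_iff.2 hy0
    have := hgzero y
    rw [hg, groundState, mul_eq_zero] at this
    refine this.resolve_left ?_
    exact_mod_cast (Real.rpow_pos_of_pos hy' _).ne'
  have hW := weightedMass_le_fracLaplacian hβ hβα hαn f
  have hM0 : ∫⁻ x, ENNReal.ofReal (‖x‖ ^ (-β)) * ‖fracLaplacian ((α - β) / 4) (⇑f) x‖ₑ ^ 2 = 0 := by
    refine lintegral_eq_zero_of_ae_eq_zero (hu0.mono fun y hy => ?_)
    simp [hy]
  rw [hM0, mul_zero, nonpos_iff_eq_zero, ENNReal.ofReal_eq_zero] at hW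
  have hW0 : ∫ x : EuclideanSpace ℝ (Fin n), ‖x‖ ^ (-α) * ‖f x‖ ^ 2 = 0 :=
    le_antisymm hW (integral_nonneg fun x => by positivity)
  rw [integral_eq_zero_iff_of_nonneg (fun x => by positivity)
    (integrable_weightedMass hβ hβα hαn f)] at hW0
  have hf0 : (⇑f : EuclideanSpace ℝ (Fin n) → ℂ) =ᵐ[volume] fun _ => 0 := by
    filter_upwards [hW0, ae_ne_zero hn] with y hy hy0
    have hy' := norm_pos_iff.2 hy0
    simpa [(Real.rpow_pos_of_pos hy' (-α)).ne'] using hy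
  have := (f.continuous.ae_eq_iff_eq volume continuous_const).1 hf0
  exact hf (by ext y; exact congrFun this y)

/-! ### Superpositions of Gaussians -/

lemma exists_pow_mul_exp_neg_sq_le (N : ℕ) {c : ℝ} (hc : 0 < c) :
    ∃ C : ℝ, ∀ r : ℝ, 0 ≤ r → (1 + r) ^ N * Real.exp (-(c * r ^ 2)) ≤ C := by
  -- `(1 + r)^N ≤ N! e^{1+r}`, and `r - c r² ≤ 1/(4c)`.
  refine ⟨N.factorial * Real.exp (1 + 1 / (4 * c)), fun r hr => ?_⟩
  have h1 : (1 + r) ^ N ≤ N.factorial * Real.exp (1 + r) := by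
    have := Real.pow_div_factorial_le_exp (1 + r) (by positivity) N
    rwa [div_le_iff₀' (by positivity)] at this
  have h2 : 1 + r + -(c * r ^ 2) ≤ 1 + 1 / (4 * c) := by
    have : 1 / (4 * c) - r + c * r ^ 2 = c * (r - 1 / (2 * c)) ^ 2 := by field_simp; ring
    have : 0 ≤ c * (r - 1 / (2 * c)) ^ 2 := by positivity
    linarith
  calc _ ≤ N.factorial * Real.exp (1 + r) * Real.exp (-(c * r ^ 2)) := by gcongr
    _ = N.factorial * Real.exp (1 + r + -(c * r ^ 2)) := by rw [mul_assoc, ← Real.exp_add]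
    _ ≤ _ := by gcongr

/-- The real Gaussian `e^{-c|x|²}`, `c > 0`, as a Schwartz function. -/
noncomputable def realGaussian (c : ℝ) (hc : 0 < c) : 𝓢(EuclideanSpace ℝ (Fin n), ℝ) where
  toFun x := Real.exp (-(c * ‖x‖ ^ 2))
  smooth' := (contDiff_const.mul (contDiff_norm_sq ℝ)).neg.exp
  decay' := by
    intro k m
    set q : EuclideanSpace ℝ (Fin n) → ℝ := fun x => -(c * ‖x‖ ^ 2) with hq
    have hqs : ContDiff ℝ (⊤ : ℕ∞) q := (contDiff_const.mul (contDiff_norm_sq ℝ)).neg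
    have hqt : q.HasTemperateGrowth := by
      have h1 : (fun x : EuclideanSpace ℝ (Fin n) => ‖x‖ ^ 2).HasTemperateGrowth :=
        Function.hasTemperateGrowth_norm_sq _
      exact ((Function.HasTemperateGrowth.const c).mul h1).neg
    obtain ⟨l, C, hC0, hC⟩ := hqt.norm_iteratedFDeriv_le_uniform m
    obtain ⟨C', hC'⟩ := exists_pow_mul_exp_neg_sq_le (k + l * m) hc
    refine ⟨m.factorial * (1 + C) ^ m * C', fun x => ?_⟩
    have hexp : ∀ i ≤ m, ‖iteratedFDeriv ℝ i Real.exp (q x)‖ ≤ Real.exp (q x) := by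
      intro i _
      rw [norm_iteratedFDeriv_eq_norm_iteratedDeriv, iteratedDeriv_eq_iterate, Real.iter_deriv_exp,
        Real.norm_of_nonneg (Real.exp_pos _).le]
    have hone : 1 ≤ (1 + C) * (1 + ‖x‖) ^ l :=
      one_le_mul_of_one_le_of_one_le (by linarith) (one_le_pow₀ (by linarith [norm_nonneg x]))
    have hD : ∀ i, 1 ≤ i → i ≤ m → ‖iteratedFDeriv ℝ i q x‖ ≤ ((1 + C) * (1 + ‖x‖) ^ l) ^ i := by
      intro i hi him
      calc _ ≤ C * (1 + ‖x‖) ^ l := hC i him x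
        _ ≤ (1 + C) * (1 + ‖x‖) ^ l := by gcongr; linarith
        _ ≤ _ := le_self_pow₀ hone (by omega)
    have h := norm_iteratedFDeriv_comp_le (N := (⊤ : ℕ∞)) (Real.contDiff_exp) hqs
      (by exact_mod_cast le_top) x hexp hD
    calc _ ≤ ‖x‖ ^ k * (m.factorial * Real.exp (q x) * ((1 + C) * (1 + ‖x‖) ^ l) ^ m) := by
          gcongr; exact h
      _ ≤ (1 + ‖x‖) ^ k * (m.factorial * Real.exp (q x) * ((1 + C) * (1 + ‖x‖) ^ l) ^ m) := by
          gcongr; linarith [norm_nonneg x]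
      _ = m.factorial * (1 + C) ^ m * ((1 + ‖x‖) ^ (k + l * m) * Real.exp (-(c * ‖x‖ ^ 2))) := by
          rw [mul_pow, ← pow_mul, pow_add]; ring
      _ ≤ _ := by gcongr; exact hC' _ (norm_nonneg x)

/-- The Gaussian `e^{-π e^a |x|²}`. The logarithmic parametrization turns dilations into
translations of `a`. -/
noncomputable def gaussian (n : ℕ) (a : ℝ) : 𝓢(EuclideanSpace ℝ (Fin n), ℂ) :=
  (realGaussian (Real.pi * Real.exp a) (by positivity)).postcompCLM Complex.ofRealCLM

lemma gaussian_apply (a : ℝ) (x : EuclideanSpace ℝ (Fin n)) :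
    gaussian n a x = ((Real.exp (-(Real.pi * Real.exp a * ‖x‖ ^ 2)) : ℝ) : ℂ) := rfl

lemma hat_gaussian (a : ℝ) (ξ : EuclideanSpace ℝ (Fin n)) :
    hat (⇑(gaussian n a)) ξ
      = ((Real.exp a ^ (-((n : ℝ) / 2)) * Real.exp (-(Real.pi * ‖ξ‖ ^ 2 / Real.exp a)) : ℝ) : ℂ) := by
  set k : EuclideanSpace ℝ (Fin n) → ℂ := fun x =>
    ((Real.exp a ^ (-((n : ℝ) / 2)) * Real.exp (-(Real.pi * ‖x‖ ^ 2 / Real.exp a)) : ℝ) : ℂ) with hk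
  have h : ⇑(gaussian n a) = 𝓕 k := by
    ext x
    rw [gaussian_apply, hk, fourier_heat (Real.exp_pos a)]
  have hc : Continuous k := by rw [hk]; fun_prop
  rw [hat, h, hc.fourierInv_fourier_eq (integrable_heat (Real.exp_pos a))]
  rw [← h]; exact SchwartzMap.integrable _

/-- A finite superposition `∑ w_i e^{-π e^{a_i} |x|²}` of Gaussians. -/
noncomputable def gaussianSum (n : ℕ) {ι : Type*} (s : Finset ι) (w a : ι → ℝ) :
    𝓢(EuclideanSpace ℝ (Fin n), ℂ) :=
  ∑ i ∈ s, (w i : ℂ) • gaussian n (a i)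

lemma gaussianSum_apply {ι : Type*} (s : Finset ι) (w a : ι → ℝ) (x : EuclideanSpace ℝ (Fin n)) :
    gaussianSum n s w a x
      = ((∑ i ∈ s, w i * Real.exp (-(Real.pi * Real.exp (a i) * ‖x‖ ^ 2)) : ℝ) : ℂ) := by
  rw [gaussianSum, sum_apply, Complex.ofReal_sum]
  refine Finset.sum_congr rfl fun i _ => ?_
  rw [smul_apply, gaussian_apply, smul_eq_mul, Complex.ofReal_mul]

lemma hat_gaussianSum {ι : Type*} (s : Finset ι) (w a : ι → ℝ) (ξ : EuclideanSpace ℝ (Fin n)) :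
    hat (⇑(gaussianSum n s w a)) ξ
      = ((∑ i ∈ s, w i * (Real.exp (a i) ^ (-((n : ℝ) / 2))
          * Real.exp (-(Real.pi * Real.exp (-a i) * ‖ξ‖ ^ 2))) : ℝ) : ℂ) := by
  rw [hat_eq_coe, gaussianSum, FourierTransform.fourierInv_sum, sum_apply,
    Complex.ofReal_sum]
  refine Finset.sum_congr rfl fun i _ => ?_
  rw [FourierTransform.fourierInv_smul, smul_apply, ← hat_eq_coe, hat_gaussian, smul_eq_mul,
    ← Complex.ofReal_mul, Real.exp_neg (a i)]
  congr 4
  ring_nf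

/-- Moments of Gaussians; the constant depends on the dimension only. -/
lemma exists_gaussian_moment (hn : 0 < n) : ∃ κ : ℝ, 0 < κ ∧ ∀ p σ : ℝ, -n < p → 0 < σ →
    (Integrable fun x : EuclideanSpace ℝ (Fin n) => ‖x‖ ^ p * Real.exp (-(Real.pi * σ * ‖x‖ ^ 2))) ∧
    ∫ x : EuclideanSpace ℝ (Fin n), ‖x‖ ^ p * Real.exp (-(Real.pi * σ * ‖x‖ ^ 2))
      = κ * (Real.pi ^ (-((n + p) / 2)) * Real.Gamma ((n + p) / 2)) * σ ^ (-((n + p) / 2)) := by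
  have : Nonempty (Fin n) := ⟨⟨0, hn⟩⟩
  set V := (volume : Measure (EuclideanSpace ℝ (Fin n))).real (Metric.ball 0 1) with hV
  have hVpos : 0 < V := by
    refine ENNReal.toReal_pos (Metric.measure_ball_pos _ _ one_pos).ne' measure_ball_lt_top.ne
  refine ⟨n * V / 2, by positivity, fun p σ hp hσ => ?_⟩
  have hb : 0 < Real.pi * σ := by positivity
  have h1 := integral_rpow_mul_exp_neg_mul_rpow (p := 2) (q := n - 1 + p) (b := Real.pi * σ)
    (by norm_num) (by linarith) hb
  have hG := Real.Gamma_pos_of_pos (by linarith : 0 < ((n : ℝ) + p) / 2)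
  rw [show (n : ℝ) - 1 + p + 1 = n + p by ring, neg_div] at h1
  have hpow : ∀ y : ℝ, 0 < y → y ^ (n - 1) • (y ^ p * Real.exp (-(Real.pi * σ * y ^ 2)))
      = y ^ ((n : ℝ) - 1 + p) * Real.exp (-(Real.pi * σ) * y ^ (2 : ℝ)) := by
    intro y hy
    rw [smul_eq_mul, ← mul_assoc, ← Real.rpow_natCast, ← Real.rpow_add hy, Nat.cast_sub hn,
      show (2 : ℝ) = ((2 : ℕ) : ℝ) by norm_num, Real.rpow_natCast, Nat.cast_one, neg_mul]
  have hfin : Module.finrank ℝ (EuclideanSpace ℝ (Fin n)) = n := finrank_euclideanSpace_fin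
  constructor
  · rw [integrable_fun_norm_addHaar (μ := (volume : Measure (EuclideanSpace ℝ (Fin n))))
      (f := fun r => r ^ p * Real.exp (-(Real.pi * σ * r ^ 2))), hfin,
      integrableOn_congr_fun (s := Set.Ioi (0 : ℝ))
        (fun y (hy : y ∈ Set.Ioi (0 : ℝ)) => hpow y hy) measurableSet_Ioi]
    by_contra hni
    rw [integral_undef hni] at h1
    have : 0 < (Real.pi * σ) ^ (-(((n : ℝ) + p) / 2)) * (1 / 2) * Real.Gamma ((n + p) / 2) := by
      positivity
    exact this.ne h1
  · rw [integral_fun_norm_addHaar (μ := (volume : Measure (EuclideanSpace ℝ (Fin n))))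
      (f := fun r => r ^ p * Real.exp (-(Real.pi * σ * r ^ 2))), hfin,
      setIntegral_congr_fun measurableSet_Ioi 
        (fun y (hy : y ∈ Set.Ioi (0 : ℝ)) => hpow y hy), h1,
      Real.mul_rpow Real.pi_pos.le hσ.le, nsmul_eq_mul, smul_eq_mul, ← hV]
    ring

/-! ### Toeplitz forms and the logistic kernel -/

/-- The double sum of an even kernel over `{0, …, N}²` exceeds the one over `{0, …, N-1}²` by a
symmetric row. -/
lemma sum_sum_even_succ {k : ℝ → ℝ} (hk : ∀ x, k (-x) = k x) (δ : ℝ) (N : ℕ) :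
    ∑ i ∈ Finset.range (N + 1), ∑ j ∈ Finset.range (N + 1), k (δ * i - δ * j)
      = ∑ i ∈ Finset.range N, ∑ j ∈ Finset.range N, k (δ * i - δ * j)
        + (k 0 + 2 * ∑ m ∈ Finset.range N, k (δ * (m + 1 : ℕ))) := by
  have hr : ∑ i ∈ Finset.range N, k (δ * N - δ * i) = ∑ m ∈ Finset.range N, k (δ * (m + 1 : ℕ)) := by
    rw [← Finset.sum_range_reflect]
    refine Finset.sum_congr rfl fun i hi => ?_
    have hi := Finset.mem_range.1 hi
    have : ((N - 1 - i : ℕ) : ℝ) = N - 1 - i := by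
      rw [Nat.cast_sub (by omega), Nat.cast_sub (by omega), Nat.cast_one]
    rw [this]; congr 1; push_cast; ring
  have hr' : ∑ i ∈ Finset.range N, k (δ * i - δ * N)
      = ∑ m ∈ Finset.range N, k (δ * (m + 1 : ℕ)) := by
    rw [← hr]
    refine Finset.sum_congr rfl fun i _ => ?_
    rw [← hk]; congr 1; ring
  rw [Finset.sum_range_succ, Finset.sum_range_succ]
  simp_rw [Finset.sum_range_succ _ N]
  rw [Finset.sum_add_distrib, hr, hr', sub_self]
  ring

/-- If a monotone sequence has bounded Cesàro means, the bound holds for its terms. -/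
lemma le_of_sum_range_le_mul {T : ℕ → ℝ} (hT : Monotone T) (h0 : ∀ M, 0 ≤ T M) {X : ℝ}
    (h : ∀ N : ℕ, ∑ M ∈ Finset.range N, T M ≤ N * X) (M : ℕ) : T M ≤ X := by
  have key : ∀ N : ℕ, N * T M ≤ (N + M : ℕ) * X := by
    intro N
    refine le_trans ?_ (h (N + M))
    rw [add_comm N M, Finset.sum_range_add]
    have h1 : (N : ℝ) * T M ≤ ∑ x ∈ Finset.range N, T (M + x) := by
      rw [← nsmul_eq_mul]
      conv_lhs => rw [← Finset.card_range N]
      exact Finset.card_nsmul_le_sum _ _ _ fun x _ => hT (by omega)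
    linarith [Finset.sum_nonneg fun i (_ : i ∈ Finset.range M) => h0 i]
  by_contra! hlt
  obtain ⟨N, hN⟩ := exists_nat_gt (M * X / (T M - X))
  have := key N
  rw [div_lt_iff₀ (by linarith)] at hN
  push_cast at this
  nlinarith

/-- Comparison of quadratic forms of two Toeplitz kernels on all arithmetic progressions gives the
comparison of the integrals of the kernels. -/
lemma integral_le_of_toeplitz_le {k₁ k₂ : ℝ → ℝ} (e₁ : ∀ x, k₁ (-x) = k₁ x)
    (e₂ : ∀ x, k₂ (-x) = k₂ x) (p₁ : ∀ x, 0 ≤ k₁ x) (p₂ : ∀ x, 0 ≤ k₂ x)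
    (a₁ : AntitoneOn k₁ (Set.Ici 0)) (a₂ : AntitoneOn k₂ (Set.Ici 0))
    (i₁ : IntegrableOn k₁ (Set.Ioi 0)) (i₂ : IntegrableOn k₂ (Set.Ioi 0))
    (h : ∀ δ : ℝ, 0 < δ → ∀ N : ℕ,
      ∑ i ∈ Finset.range N, ∑ j ∈ Finset.range N, k₁ (δ * i - δ * j)
        ≤ ∑ i ∈ Finset.range N, ∑ j ∈ Finset.range N, k₂ (δ * i - δ * j)) :
    ∫ x in Set.Ioi 0, k₁ x ≤ ∫ x in Set.Ioi 0, k₂ x := by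
  set I₁ := ∫ x in Set.Ioi 0, k₁ x
  set I₂ := ∫ x in Set.Ioi 0, k₂ x
  have hsum : ∀ k : ℝ → ℝ, (∀ x, k (-x) = k x) → ∀ δ : ℝ, ∀ N : ℕ,
      ∑ i ∈ Finset.range N, ∑ j ∈ Finset.range N, k (δ * i - δ * j)
        = ∑ M ∈ Finset.range N, (k 0 + 2 * ∑ m ∈ Finset.range M, k (δ * (m + 1 : ℕ))) := by
    intro k hk δ N
    induction N with
    | zero => simp
    | succ N ih => rw [sum_sum_even_succ hk, ih, Finset.sum_range_succ _ N]
  have key : ∀ δ : ℝ, 0 < δ → I₁ ≤ I₂ + δ * (k₁ 0 + k₂ 0) / 2 := by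
    intro δ hδ
    have anti : ∀ k : ℝ → ℝ, AntitoneOn k (Set.Ici 0) → ∀ M : ℕ,
        AntitoneOn (fun x => k (δ * x)) (Set.Icc (0 : ℝ) (0 + M)) := by
      intro k hk M x hx y hy hxy
      exact hk (Set.mem_Ici.2 (mul_nonneg hδ.le hx.1)) (Set.mem_Ici.2 (mul_nonneg hδ.le hy.1))
        (by gcongr)
    have scale : ∀ k : ℝ → ℝ, ∀ M : ℕ,
        ∫ x in (0 : ℝ)..(0 + M), k (δ * x) = δ⁻¹ * ∫ x in (0 : ℝ)..(δ * M), k x := by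
      intro k M
      rw [intervalIntegral.integral_comp_mul_left _ hδ.ne', mul_zero, zero_add, smul_eq_mul]
    have up : ∀ M : ℕ, k₂ 0 + 2 * ∑ m ∈ Finset.range M, k₂ (δ * (m + 1 : ℕ))
        ≤ k₂ 0 + 2 * (δ⁻¹ * I₂) := by
      intro M
      have h1 := (anti k₂ a₂ M).sum_le_integral
      rw [scale] at h1
      have h2 : ∫ x in (0 : ℝ)..(δ * M), k₂ x ≤ I₂ := by
        rw [intervalIntegral.integral_of_le (by positivity)]
        exact setIntegral_mono_set i₂ (Filter.Eventually.of_forall p₂)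
          (Filter.Eventually.of_forall fun x hx => hx.1)
      have h3 : δ⁻¹ * ∫ x in (0 : ℝ)..(δ * M), k₂ x ≤ δ⁻¹ * I₂ := by gcongr
      simp only [zero_add] at h1
      linarith
    have low : ∀ M : ℕ, k₁ 0 + 2 * ∑ m ∈ Finset.range M, k₁ (δ * (m + 1 : ℕ))
        ≤ k₂ 0 + 2 * (δ⁻¹ * I₂) := by
      refine le_of_sum_range_le_mul ?_ ?_ ?_
      · refine monotone_nat_of_le_succ fun M => ?_
        rw [Finset.sum_range_succ]
        linarith [p₁ (δ * (M + 1 : ℕ))]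
      · intro M
        have := Finset.sum_nonneg fun m (_ : m ∈ Finset.range M) => p₁ (δ * (m + 1 : ℕ))
        linarith [p₁ 0]
      · intro N
        rw [← hsum k₁ e₁]
        refine (h δ hδ N).trans ?_
        rw [hsum k₂ e₂]
        calc _ ≤ ∑ _M ∈ Finset.range N, (k₂ 0 + 2 * (δ⁻¹ * I₂)) :=
              Finset.sum_le_sum fun M _ => up M
          _ = _ := by rw [Finset.sum_const, Finset.card_range, nsmul_eq_mul]
    have low' : ∀ M : ℕ, ∫ x in (0 : ℝ)..(δ * M), k₁ x ≤ I₂ + δ * (k₁ 0 + k₂ 0) / 2 := by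
      intro M
      have h1 := (anti k₁ a₁ M).integral_le_sum
      rw [scale] at h1
      simp only [zero_add] at h1
      have h2 : ∑ i ∈ Finset.range M, k₁ (δ * i)
          ≤ k₁ 0 + ∑ m ∈ Finset.range M, k₁ (δ * (m + 1 : ℕ)) := by
        have := Finset.sum_range_succ' (fun i : ℕ => k₁ (δ * i)) M
        rw [Finset.sum_range_succ] at this
        simp only [Nat.cast_zero, mul_zero] at this
        linarith [p₁ (δ * M)]
      have h3 : δ⁻¹ * ∫ x in (0 : ℝ)..(δ * M), k₁ x
          ≤ k₁ 0 / 2 + k₂ 0 / 2 + δ⁻¹ * I₂ := by linarith [low M]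
      rw [inv_mul_le_iff₀ hδ] at h3
      refine h3.trans_eq ?_
      field_simp
      ring
    refine le_of_tendsto' (intervalIntegral_tendsto_integral_Ioi 0 i₁
      (Filter.Tendsto.const_mul_atTop hδ tendsto_natCast_atTop_atTop)) low'
  refine le_of_forall_pos_le_add fun ε hε => ?_
  have hd : 0 ≤ k₁ 0 + k₂ 0 := add_nonneg (p₁ 0) (p₂ 0)
  refine (key (2 * ε / (k₁ 0 + k₂ 0 + 1)) (by positivity)).trans ?_
  gcongr
  rw [div_le_iff₀ two_pos, div_mul_eq_mul_div, div_le_iff₀ (by positivity)]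
  nlinarith

/-- The kernel `(e^τ / (1 + e^τ)²)^q`, written through the logistic function. -/
noncomputable def logisticKernel (q τ : ℝ) : ℝ :=
  (Real.sigmoid τ * Real.sigmoid (-τ)) ^ q

lemma logisticKernel_neg (q τ : ℝ) : logisticKernel q (-τ) = logisticKernel q τ := by
  rw [logisticKernel, logisticKernel, neg_neg, mul_comm]

lemma logisticKernel_nonneg (q τ : ℝ) : 0 ≤ logisticKernel q τ := by
  have := Real.sigmoid_pos τ
  have := Real.sigmoid_pos (-τ)
  unfold logisticKernel; positivity

lemma antitoneOn_logisticKernel {q : ℝ} (hq : 0 ≤ q) :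
    AntitoneOn (logisticKernel q) (Set.Ici 0) := by
  intro x hx y hy hxy
  have hx : 0 ≤ x := hx
  have h1 := Real.sigmoid_monotone hxy
  have h0 := Real.sigmoid_monotone hx
  rw [Real.sigmoid_zero] at h0
  unfold logisticKernel
  have := Real.sigmoid_pos y
  have := Real.sigmoid_pos (-y)
  refine Real.rpow_le_rpow (by positivity) ?_ hq
  rw [Real.sigmoid_neg, Real.sigmoid_neg]
  nlinarith

lemma continuous_logisticKernel (q : ℝ) : Continuous (logisticKernel q) := by
  unfold logisticKernel
  refine (continuous_sigmoid.mul (continuous_sigmoid.comp continuous_neg)).rpow_const fun x => Or.inl ?_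
  exact (mul_pos (Real.sigmoid_pos x) (Real.sigmoid_pos (-x))).ne'

/-- The substitution `t = e^τ / (1 + e^τ)` turns the integral into a Beta integral. -/
lemma lintegral_logisticKernel {q : ℝ} (hq : 0 < q) :
    ∫⁻ τ, ENNReal.ofReal (logisticKernel q τ)
      = ENNReal.ofReal (Real.Gamma q * Real.Gamma q / Real.Gamma (2 * q)) := by
  have h := lintegral_pw_conv hq hq 1
  have h2 : pw (q + q - 1) 1 = 1 := by simp [pw]
  rw [h2, mul_one, ← two_mul] at h
  rw [← h]
  have hz : ∀ s ∉ Set.Ioo (0 : ℝ) 1, pw (q - 1) s * pw (q - 1) (1 - s) = 0 := by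
    intro s hs
    by_cases h0 : 0 < s
    · have : ¬ 0 < 1 - s := fun h => hs ⟨h0, by linarith⟩
      simp [pw, this]
    · simp [pw, h0]
  rw [← setLIntegral_eq_of_support_subset (s := Set.Ioo (0 : ℝ) 1)
    (f := fun s => pw (q - 1) s * pw (q - 1) (1 - s))
    (fun s hs => by by_contra h'; exact hs (hz s h')), ← Real.range_sigmoid, ← Set.image_univ,
    lintegral_image_eq_lintegral_abs_deriv_mul MeasurableSet.univ
      (fun x _ => (Real.hasDerivAt_sigmoid x).hasDerivWithinAt) Real.sigmoid_injective.injOn,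
    setLIntegral_univ]
  refine lintegral_congr fun τ => ?_
  have h1 := Real.sigmoid_pos τ
  have h2 := Real.sigmoid_pos (-τ)
  rw [Real.sigmoid_neg] at h2
  rw [abs_of_nonneg (by positivity), logisticKernel, Real.sigmoid_neg, pw, pw, if_pos h1, if_pos h2,
    ← ENNReal.ofReal_mul (by positivity), ← ENNReal.ofReal_mul (by positivity),
    ← Real.mul_rpow h1.le h2.le, Real.rpow_sub_one (by positivity)]
  congr 1
  field_simp

lemma integrable_logisticKernel {q : ℝ} (hq : 0 < q) : Integrable (logisticKernel q) := by
  refine ⟨(continuous_logisticKernel q).aestronglyMeasurable, ?_⟩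
  rw [hasFiniteIntegral_iff_ofReal (Filter.Eventually.of_forall (logisticKernel_nonneg q)),
    lintegral_logisticKernel hq]
  exact ENNReal.ofReal_lt_top

lemma integral_Ioi_logisticKernel {q : ℝ} (hq : 0 < q) :
    ∫ τ in Set.Ioi 0, logisticKernel q τ = Real.Gamma q ^ 2 / Real.Gamma (2 * q) / 2 := by
  have hi := integrable_logisticKernel hq
  have h1 : ∫ τ, logisticKernel q τ = Real.Gamma q ^ 2 / Real.Gamma (2 * q) := by
    rw [integral_eq_lintegral_of_nonneg_ae (Filter.Eventually.of_forall (logisticKernel_nonneg q))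
      (continuous_logisticKernel q).aestronglyMeasurable, lintegral_logisticKernel hq,
      ENNReal.toReal_ofReal, sq]
    have := Real.Gamma_pos_of_pos hq
    have := Real.Gamma_pos_of_pos (by positivity : 0 < 2 * q)
    positivity
  have h2 : ∫ τ in Set.Iic 0, logisticKernel q τ = ∫ τ in Set.Ioi 0, logisticKernel q τ := by
    have := integral_comp_neg_Iic (0 : ℝ) (logisticKernel q)
    rw [neg_zero] at this
    rw [← this]
    simp_rw [logisticKernel_neg]
  have h3 := intervalIntegral.integral_Iic_add_Ioi (b := (0 : ℝ)) hi.integrableOn hi.integrableOn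
  rw [h2, h1] at h3
  linarith

/-! ### Sharpness of the constant -/

/-- The logistic kernel at `a - b` is the homogeneous kernel `(sr / (s+r)²)^q` at `s = e^a`,
`r = e^b`. -/
lemma exp_mul_exp_mul_rpow_eq_logisticKernel (q a b : ℝ) :
    Real.exp (a * q) * Real.exp (b * q) * (Real.exp a + Real.exp b) ^ (-(2 * q))
      = logisticKernel q (a - b) := by
  have ha := Real.exp_pos a
  have hb := Real.exp_pos b
  have e1 : Real.sigmoid (a - b) = Real.exp a / (Real.exp a + Real.exp b) := by
    rw [Real.sigmoid_def, neg_sub, Real.exp_sub]; field_simp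
  have e2 : Real.sigmoid (-(a - b)) = Real.exp b / (Real.exp a + Real.exp b) := by
    rw [Real.sigmoid_def, neg_neg, Real.exp_sub]; field_simp; ring
  rw [logisticKernel, e1, e2, div_mul_div_comm, Real.div_rpow (by positivity) (by positivity),
    Real.mul_rpow ha.le hb.le, Real.exp_mul, Real.exp_mul, ← sq, ← Real.rpow_natCast,
    ← Real.rpow_mul (by positivity), Real.rpow_neg (by positivity), div_eq_mul_inv]
  norm_num

/-- The energies of Gaussian superpositions are quadratic forms of logistic kernels. -/
lemma gaussianSum_energy {p : ℝ} {κ m : ℝ}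
    (hκ : ∀ σ : ℝ, 0 < σ →
      (Integrable fun x : EuclideanSpace ℝ (Fin n) =>
        ‖x‖ ^ p * Real.exp (-(Real.pi * σ * ‖x‖ ^ 2))) ∧
      ∫ x : EuclideanSpace ℝ (Fin n), ‖x‖ ^ p * Real.exp (-(Real.pi * σ * ‖x‖ ^ 2))
        = κ * σ ^ (-(2 * m)))
    {ι : Type*} (s : Finset ι) (a : ι → ℝ) :
    ∫ x : EuclideanSpace ℝ (Fin n), ‖x‖ ^ p * ‖((∑ i ∈ s, Real.exp (a i * m)
        * Real.exp (-(Real.pi * Real.exp (a i) * ‖x‖ ^ 2)) : ℝ) : ℂ)‖ ^ 2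
      = κ * ∑ i ∈ s, ∑ j ∈ s, logisticKernel m (a i - a j) := by
  have hpt : ∀ x : EuclideanSpace ℝ (Fin n), ‖x‖ ^ p * ‖((∑ i ∈ s, Real.exp (a i * m)
        * Real.exp (-(Real.pi * Real.exp (a i) * ‖x‖ ^ 2)) : ℝ) : ℂ)‖ ^ 2
      = ∑ i ∈ s, ∑ j ∈ s, Real.exp (a i * m) * Real.exp (a j * m) *
        (‖x‖ ^ p * Real.exp (-(Real.pi * (Real.exp (a i) + Real.exp (a j)) * ‖x‖ ^ 2))) := by
    intro x
    rw [Complex.norm_real, Real.norm_eq_abs, sq_abs, sq, Finset.sum_mul_sum, Finset.mul_sum]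
    refine Finset.sum_congr rfl fun i _ => ?_
    rw [Finset.mul_sum]
    refine Finset.sum_congr rfl fun j _ => ?_
    rw [show -(Real.pi * (Real.exp (a i) + Real.exp (a j)) * ‖x‖ ^ 2)
      = -(Real.pi * Real.exp (a i) * ‖x‖ ^ 2) + -(Real.pi * Real.exp (a j) * ‖x‖ ^ 2) by ring,
      Real.exp_add]
    ring
  have hpos : ∀ i j, 0 < Real.exp (a i) + Real.exp (a j) := fun i j => by positivity
  simp_rw [hpt]
  rw [integral_finsetSum _ fun i _ => integrable_finsetSum _ fun j _ =>
    (hκ _ (hpos i j)).1.const_mul _, Finset.mul_sum]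
  refine Finset.sum_congr rfl fun i _ => ?_
  rw [integral_finsetSum _ fun j _ => (hκ _ (hpos i j)).1.const_mul _, Finset.mul_sum]
  refine Finset.sum_congr rfl fun j _ => ?_
  rw [integral_const_mul, (hκ _ (hpos i j)).2, ← exp_mul_exp_mul_rpow_eq_logisticKernel]
  ring

/-- No constant smaller than `C_α` is admissible in Pitt's inequality. -/
lemma pittConst_le {α : ℝ} (hα : 0 < α) (hαn : α < n) {C : ℝ}
    (hC : ∀ f : 𝓢(EuclideanSpace ℝ (Fin n), ℂ),
      weightedMass α (⇑f) ≤ C * freqEnergy α (⇑f)) : pittConst n α ≤ C := by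
  have hn : 0 < n := by
    have : (0 : ℝ) < n := hα.trans hαn
    exact_mod_cast this
  obtain ⟨κ, hκ0, hκ⟩ := exists_gaussian_moment hn
  set q₁ : ℝ := (n - α) / 4 with hq₁
  set q₂ : ℝ := (n + α) / 4 with hq₂
  have hq₁0 : 0 < q₁ := by rw [hq₁]; linarith
  have hq₂0 : 0 < q₂ := by rw [hq₂]; linarith
  obtain ⟨A, hA⟩ : ∃ A, A = Real.pi ^ (-(2 * q₁)) * Real.Gamma (2 * q₁) := ⟨_, rfl⟩
  obtain ⟨B, hB⟩ : ∃ B, B = Real.pi ^ (-(2 * q₂)) * Real.Gamma (2 * q₂) := ⟨_, rfl⟩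
  have hG₁ := Real.Gamma_pos_of_pos hq₁0
  have hG₂ := Real.Gamma_pos_of_pos hq₂0
  have hG₁' := Real.Gamma_pos_of_pos (by positivity : 0 < 2 * q₁)
  have hG₂' := Real.Gamma_pos_of_pos (by positivity : 0 < 2 * q₂)
  have hA0 : 0 < A := by rw [hA]; positivity
  have hB0 : 0 < B := by rw [hB]; positivity
  have main : ∀ {ι : Type} (s : Finset ι) (a : ι → ℝ),
      A * ∑ i ∈ s, ∑ j ∈ s, logisticKernel q₁ (a i - a j)
        ≤ C * (B * ∑ i ∈ s, ∑ j ∈ s, logisticKernel q₂ (a i - a j)) := by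
    intro ι s a
    have h := hC (gaussianSum n s (fun i => Real.exp (a i * q₁)) a)
    have h1 : weightedMass α (⇑(gaussianSum n s (fun i => Real.exp (a i * q₁)) a))
        = κ * A * ∑ i ∈ s, ∑ j ∈ s, logisticKernel q₁ (a i - a j) := by
      simp_rw [weightedMass, gaussianSum_apply]
      rw [hA]
      refine gaussianSum_energy (fun σ hσ => ?_) s a
      have := hκ (-α) σ (by linarith) hσ
      rwa [show ((n : ℝ) + -α) / 2 = 2 * q₁ by rw [hq₁]; ring] at this
    have h2 : freqEnergy α (⇑(gaussianSum n s (fun i => Real.exp (a i * q₁)) a))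
        = κ * B * ∑ i ∈ s, ∑ j ∈ s, logisticKernel q₂ (a i - a j) := by
      simp_rw [freqEnergy, hat_gaussianSum, ← mul_assoc]
      -- The weights `e^{a q₁}` become `e^{a (q₁ - n/2)} = e^{-a q₂}` at the reciprocal scale.
      have hw : ∀ i, Real.exp (a i * q₁) * Real.exp (a i) ^ (-((n : ℝ) / 2))
          = Real.exp (-a i * q₂) := by
        intro i
        rw [← Real.exp_mul, ← Real.exp_add]
        congr 1; rw [hq₁, hq₂]; ring
      simp_rw [hw]
      rw [hB, gaussianSum_energy (m := q₂) (κ := κ * (Real.pi ^ (-(2 * q₂)) * Real.Gamma (2 * q₂)))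
        (fun σ hσ => ?_) s (fun i => -a i)]
      · congr 1
        refine Finset.sum_congr rfl fun i _ => Finset.sum_congr rfl fun j _ => ?_
        rw [← logisticKernel_neg]; congr 1; ring
      · have := hκ α σ (by linarith) hσ
        rwa [show ((n : ℝ) + α) / 2 = 2 * q₂ by rw [hq₂]; ring] at this
    rw [h1, h2, mul_assoc κ A, mul_assoc κ B, mul_left_comm C κ] at h
    exact le_of_mul_le_mul_left h hκ0
  have hk : ∀ q, 0 < logisticKernel q 0 := fun q =>
    Real.rpow_pos_of_pos (mul_pos (Real.sigmoid_pos _) (Real.sigmoid_pos _)) _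
  have hC0 : 0 ≤ C := by
    have h := main {()} fun _ => 0
    simp only [Finset.sum_singleton, sub_self] at h
    have h1 : 0 < A * logisticKernel q₁ 0 := mul_pos hA0 (hk _)
    have h2 : 0 < B * logisticKernel q₂ 0 := mul_pos hB0 (hk _)
    by_contra! hneg
    nlinarith
  have hint := integral_le_of_toeplitz_le (k₁ := fun τ => A * logisticKernel q₁ τ)
    (k₂ := fun τ => C * B * logisticKernel q₂ τ)
    (fun x => by rw [logisticKernel_neg]) (fun x => by rw [logisticKernel_neg])
    (fun x => mul_nonneg hA0.le (logisticKernel_nonneg _ _))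
    (fun x => mul_nonneg (mul_nonneg hC0 hB0.le) (logisticKernel_nonneg _ _))
    (fun x hx y hy hxy =>
      mul_le_mul_of_nonneg_left (antitoneOn_logisticKernel hq₁0.le hx hy hxy) hA0.le)
    (fun x hx y hy hxy => mul_le_mul_of_nonneg_left (antitoneOn_logisticKernel hq₂0.le hx hy hxy)
      (mul_nonneg hC0 hB0.le))
    ((integrable_logisticKernel hq₁0).const_mul _).integrableOn
    ((integrable_logisticKernel hq₂0).const_mul _).integrableOn
    (fun δ _ N => by
      have := main (Finset.range N) fun i => δ * i
      simp_rw [← Finset.mul_sum]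
      rwa [mul_assoc C B])
  rw [integral_const_mul, integral_const_mul, integral_Ioi_logisticKernel hq₁0,
    integral_Ioi_logisticKernel hq₂0] at hint
  have hA' : A * (Real.Gamma q₁ ^ 2 / Real.Gamma (2 * q₁) / 2)
      = Real.pi ^ (-(2 * q₁)) * Real.Gamma q₁ ^ 2 / 2 := by rw [hA]; field_simp
  have hB' : C * B * (Real.Gamma q₂ ^ 2 / Real.Gamma (2 * q₂) / 2)
      = C * (Real.pi ^ (-(2 * q₂)) * Real.Gamma q₂ ^ 2 / 2) := by rw [hB]; field_simp
  rw [hA', hB', ← div_le_iff₀ (by positivity)] at hint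
  refine le_of_eq_of_le ?_ hint
  have hpi : Real.pi ^ α = Real.pi ^ (-(2 * q₁)) / Real.pi ^ (-(2 * q₂)) := by
    rw [← Real.rpow_sub Real.pi_pos]; congr 1; rw [hq₁, hq₂]; ring
  rw [pittConst, ← hq₁, ← hq₂, hpi]
  field_simp

end Pitt

theorem theorem1 (n : ℕ) (α β : ℝ) (hβ : 0 < β) (hβ2 : β < 2) (hβα : β ≤ α) (hαn : α < n) :
    -- the three integrals converge, and Pitt's inequality holds with the Besov remainder
    (∀ f : 𝓢(EuclideanSpace ℝ (Fin n), ℂ),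
      Integrable (fun ξ : EuclideanSpace ℝ (Fin n) => ‖ξ‖ ^ α * ‖Pitt.hat (⇑f) ξ‖ ^ 2) ∧
      Integrable (fun x : EuclideanSpace ℝ (Fin n) => ‖x‖ ^ (-α) * ‖f x‖ ^ 2) ∧
      Integrable (Pitt.besovIntegrand β (Pitt.groundState α β (⇑f))) ∧
      Pitt.pittConst n α * Pitt.freqEnergy α (⇑f) ≥
        Pitt.weightedMass α (⇑f) +
          Pitt.pittConst n α / Pitt.besovConst n β *
            ∫ p : EuclideanSpace ℝ (Fin n) × EuclideanSpace ℝ (Fin n),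
              Pitt.besovIntegrand β (Pitt.groundState α β (⇑f)) p) ∧
    -- `C_α` is the sharp constant in Pitt's inequality
    IsLeast {C : ℝ | ∀ f : 𝓢(EuclideanSpace ℝ (Fin n), ℂ),
      Pitt.weightedMass α (⇑f) ≤ C * Pitt.freqEnergy α (⇑f)} (Pitt.pittConst n α) ∧
    -- and it is not attained
    (∀ f : 𝓢(EuclideanSpace ℝ (Fin n), ℂ), f ≠ 0 →
      Pitt.weightedMass α (⇑f) < Pitt.pittConst n α * Pitt.freqEnergy α (⇑f)) := by
  refine ⟨fun f => ⟨Pitt.integrable_rpow_mul_hat_sq (by linarith) f,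
    Pitt.integrable_weightedMass hβ hβα hαn f, Pitt.integrable_besovIntegrand hβ hβα hαn hβ2 f,
    Pitt.pitt_besov hβ hβα hαn hβ2 f⟩, ⟨fun f => ?_, fun C hC =>
      Pitt.pittConst_le (hβ.trans_le hβα) hαn hC⟩,
    fun f hf => Pitt.weightedMass_lt hβ hβα hαn hβ2 f hf⟩
  have hP : 0 ≤ Pitt.pittConst n α / Pitt.besovConst n β :=
    div_nonneg (Pitt.pittConst_pos (by linarith) hαn).le (Pitt.besovConst_pos hβ hβ2).le
  have hI : 0 ≤ ∫ p, Pitt.besovIntegrand β (Pitt.groundState α β (⇑f)) p :=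
    integral_nonneg fun p => Pitt.besovIntegrand_nonneg β _ p
  linarith [Pitt.pitt_besov hβ hβα hαn hβ2 f, mul_nonneg hP hI]
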